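/- An instance of \textsc{Committee Election with Candidate Attribute Constraints} (CECAC) consists of a finite set $C$ of candidates, a finite set $A$ of attributes, an integer profit $S(c)$ and a set $\alpha(c)\subseteq A$ of attributes for every candidate $c\in C$, a finite collection $R$ of constraints, and two positive integers $k\le |C|$ and $p$. Each constraint has the form $\varphi\rightarrow\psi$, where $\varphi$ and $\psi$ are built from literals $a$ or $\overline a$ ($a\in A$) with $\wedge$ and $\vee$. A set $W\subseteq C$ sets the Boolean variable $a$ to true if $a\in\alpha(c)$ for some $c\in W$, and to false otherwise. The question is whether there is a committee $W\subseteq C$ with $|W|=k$ such that all constraints in $R$ are true under the assignment set by $W$ and $\sum_{c\in W}S(c)\ge p$. \textbf{Theorem.} CECAC, restricted to the instances that fulfil the following three conditions, is solvable in polynomial time (numbers being encoded in binary): \begin{enumerate} \item each candidate has at most one attribute, i.e. $|\alpha(c)|\le 1$ for all $c\in C$; \item each attribute occurs at most twice in the constraints, i.e. $N(a)\le 2$ for all $a\in A$, where $N(a)$ is the total number of occurrences of $a$ and $\overline a$ in $R$; \item at most two attributes occur in each constraint, i.e. $L(r)\le 2$ for all $r\in R$, where $L(r)$ is the number of distinct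 attributes $a$ such that $a$ or $\overline a$ occurs in $r$. \end{enumerate} -/

import Mathlib

/-! ## Random access machines with logarithmic cost

Programs are while-programs over integer arrays. A program mentions only finitely many arrays; array
`a` has a cell for every integer index, cells hold integers, and indices may be computed (indirect
addressing). Every integer that is written down in the course of a computation, as an intermediate
value, an index or a cell content, is charged with its length in binary. This is the logarithmic-cost
random access machine, which is polynomially equivalent to the Turing machine. -/

namespace RAM

/-- Length of an integer in binary, with one extra symbol for its sign. -/
def bitLength (z : ℤ) : ℕ := z.natAbs.size + 1

/-- Memory contents: `M a i` is the content of cell `i` of array `a`. -/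
abbrev Memory := ℕ → ℤ → ℤ

/-- Side-effect free integer expressions. -/
inductive Expr : Type
  /-- an integer constant -/
  | const (z : ℤ)
  /-- the content of the cell of array `a` whose index is the value of `i` -/
  | load (a : ℕ) (i : Expr)
  | add (e₁ e₂ : Expr)
  | sub (e₁ e₂ : Expr)
  | mul (e₁ e₂ : Expr)
  /-- comparison: `1` if the value of `e₁` is at most the value of `e₂`, and `0` otherwise -/
  | le (e₁ e₂ : Expr)

/-- The value of an expression. -/
def Expr.eval (M : Memory) : Expr → ℤ
  | const z => z
  | load a i => M a (i.eval M)
  | add e₁ e₂ => e₁.eval M + e₂.eval M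
  | sub e₁ e₂ => e₁.eval M - e₂.eval M
  | mul e₁ e₂ => e₁.eval M * e₂.eval M
  | le e₁ e₂ => if e₁.eval M ≤ e₂.eval M then 1 else 0

/-- The cost of evaluating an expression: the total binary length of the values of all its
subexpressions. -/
def Expr.cost (M : Memory) : Expr → ℕ
  | const z => bitLength z
  | load a i => i.cost M + bitLength (M a (i.eval M))
  | add e₁ e₂ => e₁.cost M + e₂.cost M + bitLength (e₁.eval M + e₂.eval M)
  | sub e₁ e₂ => e₁.cost M + e₂.cost M + bitLength (e₁.eval M - e₂.eval M)
  | mul e₁ e₂ => e₁.cost M + e₂.cost M + bitLength (e₁.eval M * e₂.eval M)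
  | le e₁ e₂ => e₁.cost M + e₂.cost M + bitLength (if e₁.eval M ≤ e₂.eval M then 1 else 0)

/-- The memory after writing `v` into cell `i` of array `a`. -/
def Memory.write (M : Memory) (a : ℕ) (i v : ℤ) : Memory :=
  fun b j => if b = a ∧ j = i then v else M b j

/-- Programs. A condition counts as true when its value is nonzero. -/
inductive Prog : Type
  | skip
  /-- write the value of `e` into the cell of array `a` whose index is the value of `i` -/
  | store (a : ℕ) (i e : Expr)
  | seq (P Q : Prog)
  | ite (e : Expr) (P Q : Prog)
  | loop (e : Expr) (P : Prog)

/-- `Run P M M' t`: started on memory `M`, the program `P` halts with memory `M'` after time exactly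
`t`. The program `loop e P` executes `P` as long as `e` is nonzero. -/
inductive Run : Prog → Memory → Memory → ℕ → Prop
  | skip (M : Memory) : Run Prog.skip M M 1
  | store (a : ℕ) (i e : Expr) (M : Memory) :
      Run (Prog.store a i e) M (M.write a (i.eval M) (e.eval M)) (1 + i.cost M + e.cost M)
  | seq {P Q : Prog} {M M' M'' : Memory} {t t' : ℕ} (hP : Run P M M' t) (hQ : Run Q M' M'' t') :
      Run (Prog.seq P Q) M M'' (t + t')
  | ite_true {e : Expr} {P Q : Prog} {M M' : Memory} {t : ℕ} (he : e.eval M ≠ 0)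
      (hP : Run P M M' t) : Run (Prog.ite e P Q) M M' (1 + e.cost M + t)
  | ite_false {e : Expr} {P Q : Prog} {M M' : Memory} {t : ℕ} (he : e.eval M = 0)
      (hQ : Run Q M M' t) : Run (Prog.ite e P Q) M M' (1 + e.cost M + t)
  | loop_true {e : Expr} {P : Prog} {M M' M'' : Memory} {t t' : ℕ} (he : e.eval M ≠ 0)
      (hP : Run P M M' t) (hL : Run (Prog.loop e P) M' M'' t') :
      Run (Prog.loop e P) M M'' (1 + e.cost M + t + t')
  | loop_false {e : Expr} {P : Prog} {M : Memory} (he : e.eval M = 0) :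
      Run (Prog.loop e P) M M (1 + e.cost M)

/-- Initial memory on input `w`: array `0` holds the entries of `w` in cells `0, 1, …`, cell `0` of
array `1` holds the length of `w`, and every other cell is `0`. -/
def initial (w : List ℤ) : Memory := fun a i =>
  if a = 0 ∧ 0 ≤ i then w.getD i.toNat 0
  else if a = 1 ∧ i = 0 then (w.length : ℤ)
  else 0

/-- The size of an input: the total binary length of its entries. -/
def inputSize (w : List ℤ) : ℕ := (w.map bitLength).sum

/-- The question `Yes`, asked for the instances that satisfy `Promise`, is solvable in polynomial
time: one program, and one polynomial `q`, such that on the encoding of every such instance the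
program halts within time `q` of the input size, with `1` in cell `0` of array `0` if the answer is
yes, and with `0` there if it is no. -/
def SolvableInPolyTime {α : Type} (encode : α → List ℤ) (Promise Yes : α → Prop) : Prop :=
  ∃ (P : Prog) (q : Polynomial ℕ), ∀ x : α, Promise x →
    ∃ (M : Memory) (t : ℕ), Run P (initial (encode x)) M t ∧
      t ≤ q.eval (inputSize (encode x)) ∧
      (Yes x → M 0 0 = 1) ∧ (¬ Yes x → M 0 0 = 0)

end RAM

/-! ## Committee election with candidate attribute constraints -/

namespace CECAC

/-- One side of a constraint: literals `a` or `¬ a` joined by `∧` and `∨`, with any bracketing. -/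
inductive Formula (A : Type) : Type
  /-- the literal `a` if `positive` is true, and its negation otherwise -/
  | lit (positive : Bool) (a : A)
  | and (f g : Formula A)
  | or (f g : Formula A)

namespace Formula

/-- Truth of a formula under the assignment `v`. -/
def Holds {A : Type} (v : A → Prop) : Formula A → Prop
  | lit positive a => if positive then v a else ¬ v a
  | and f g => f.Holds v ∧ g.Holds v
  | or f g => f.Holds v ∨ g.Holds v

/-- The number of occurrences of `a` and of its negation. -/
def occ {A : Type} [DecidableEq A] (a : A) : Formula A → ℕ
  | lit _ b => if b = a then 1 else 0
  | and f g => f.occ a + g.occ a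
  | or f g => f.occ a + g.occ a

/-- The set of attributes that occur. -/
def attrs {A : Type} [DecidableEq A] : Formula A → Finset A
  | lit _ a => {a}
  | and f g => f.attrs ∪ g.attrs
  | or f g => f.attrs ∪ g.attrs

/-- Postfix notation: `0` for `∧`, `1` for `∨`, `a + 2` for the literal `a`, and `-(a + 2)` for its
negation. -/
def tokens {l : ℕ} : Formula (Fin l) → List ℤ
  | lit positive a => [if positive then (a : ℤ) + 2 else -((a : ℤ) + 2)]
  | and f g => f.tokens ++ g.tokens ++ [0]
  | or f g => f.tokens ++ g.tokens ++ [1]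

/-- A formula is encoded by the number of its tokens, followed by the tokens. -/
def encode {l : ℕ} (f : Formula (Fin l)) : List ℤ := (f.tokens.length : ℤ) :: f.tokens

end Formula

/-- A constraint `lhs → rhs`. -/
structure Constraint (A : Type) : Type where
  lhs : Formula A
  rhs : Formula A

namespace Constraint

/-- Truth of a constraint under the assignment `v`. -/
def Holds {A : Type} (r : Constraint A) (v : A → Prop) : Prop := r.lhs.Holds v → r.rhs.Holds v

/-- The number of occurrences of `a` and of its negation in a constraint. -/
def occ {A : Type} [DecidableEq A] (r : Constraint A) (a : A) : ℕ := r.lhs.occ a + r.rhs.occ a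

/-- The set of attributes that occur in a constraint. -/
def attrs {A : Type} [DecidableEq A] (r : Constraint A) : Finset A := r.lhs.attrs ∪ r.rhs.attrs

/-- A constraint is encoded by its left-hand side followed by its right-hand side. -/
def encode {l : ℕ} (r : Constraint (Fin l)) : List ℤ := r.lhs.encode ++ r.rhs.encode

end Constraint

/-- An instance: `m` candidates, `l` attributes, the set of attributes and the profit of every
candidate, the constraints, the size `k` of the committee and the profit bound `p`. -/
structure Instance : Type where
  m : ℕ
  l : ℕ
  attributes : Fin m → Finset (Fin l)
  profit : Fin m → ℤ
  constraints : List (Constraint (Fin l))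
  k : ℕ
  p : ℕ
  k_pos : 0 < k
  k_le : k ≤ m
  p_pos : 0 < p

namespace Instance

/-- The committee `W` sets the variable `a` to true if some member of `W` owns the attribute `a`. -/
def assignment (I : Instance) (W : Finset (Fin I.m)) (a : Fin I.l) : Prop :=
  ∃ c ∈ W, a ∈ I.attributes c

/-- The question: is there a committee of `k` candidates that satisfies all constraints and has total
profit at least `p`? -/
def HasCommittee (I : Instance) : Prop :=
  ∃ W : Finset (Fin I.m), W.card = I.k ∧
    (∀ r ∈ I.constraints, r.Holds (I.assignment W)) ∧
    (I.p : ℤ) ≤ ∑ c ∈ W, I.profit c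

/-- The number of occurrences of `a` and of its negation in all the constraints together. -/
def occ (I : Instance) (a : Fin I.l) : ℕ := (I.constraints.map fun r => r.occ a).sum

/-- A candidate is encoded by its profit, the number of its attributes, and its attributes. -/
def encodeCandidate (I : Instance) (c : Fin I.m) : List ℤ :=
  I.profit c :: ((I.attributes c).card : ℤ) ::
    ((List.finRange I.l).filter fun a => a ∈ I.attributes c).map fun a => ((a : ℕ) : ℤ)

/-- An instance is encoded by the number of candidates, the number of attributes, the number of
constraints, `k` and `p`, followed by the list of the attributes, the candidates and the
constraints. -/
def encode (I : Instance) : List ℤ :=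
  [(I.m : ℤ), (I.l : ℤ), (I.constraints.length : ℤ), (I.k : ℤ), (I.p : ℤ)] ++
    ((List.finRange I.l).map fun a => ((a : ℕ) : ℤ)) ++
    (List.finRange I.m).flatMap I.encodeCandidate ++
    I.constraints.flatMap Constraint.encode

end Instance

end CECAC

/-! Whether the constraints hold depends on a committee only through the attributes that it hits. A
candidate has at most one attribute, so the candidates split into disjoint classes, one for each
attribute and one more, with index `l`, for those without attribute. Give a candidate the cost minus
its profit and compute in the min-plus semiring. The coefficient of X^j in the product of 1 + s(c) X
over a class is then the least cost of j of its members. The constant term belongs to the value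
false of the attribute, the other terms to the value true (`coeff_ownWeight`). Sum, over all
assignments, the product of the class series and of the 0/1 indicators of the constraints: the
coefficient of X^k is the least cost of an admissible committee of size k (`coeff_sumOver`,
`enc_coeff_sumOver_le`).

This sum is computed by eliminating one variable after the other. A constraint on at most two
attributes is a table indexed by two variables, and every variable lies in at most two of these
tables, so the constraints form paths and cycles. By distributivity, a variable is eliminated by
multiplying the tables that contain it with the series of its class and summing over its two values
(`value_eliminate`). At most two tables are consumed, each with at most one other variable, so the
new table again has at most two variables, and no other variable gets into more tables than before
(`card_touching_eliminate`). The entries are series of which only the coefficients below the input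
length are kept, so an elimination is a bounded number of convolutions of polynomial length.

The running time is separated from the algorithm. The program is written in a language without
multiplication whose loops are bounded by the input length. Each step then adds only a bounded
number of binary digits and the number of steps is polynomial, so the translation to a random access
machine has polynomial logarithmic cost (`compile_correct`, `solvableInPolyTime`). What remains is
to show that the program computes the sum (`exec_program`) and that comparing its coefficient with
the profit bound answers the question (`hasCommittee_iff`). -/

/-! ## Programs with bounded loops

A small language without multiplication in which every loop runs at most as often as the input has
entries. Its programs have a total semantics, and they translate to random access machines that run
in polynomial time. -/

namespace BoundedLoop

/-- Memory contents, for arrays named by `V`. -/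
abbrev Mem (V : Type) := V → ℤ → ℤ

/-- Expressions without multiplication; `len` is the number of entries of the input. -/
inductive Ex (V : Type) : Type
  | const (z : ℤ)
  | len
  | load (a : V) (i : Ex V)
  | add (e₁ e₂ : Ex V)
  | sub (e₁ e₂ : Ex V)
  | le (e₁ e₂ : Ex V)

/-- Programs; `rep v e P` executes `P` for `v = 0, 1, …` below the minimum of `e` and `len`. -/
inductive LProg (V : Type) : Type
  | skip
  | store (a : V) (i e : Ex V)
  | seq (P Q : LProg V)
  | ite (e : Ex V) (P Q : LProg V)
  | rep (v : V) (e : Ex V) (P : LProg V)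

variable {V : Type}

/-- The value of an expression. -/
def Ex.eval (N : ℕ) (M : Mem V) : Ex V → ℤ
  | const z => z
  | len => N
  | load a i => M a (i.eval N M)
  | add e₁ e₂ => e₁.eval N M + e₂.eval N M
  | sub e₁ e₂ => e₁.eval N M - e₂.eval N M
  | le e₁ e₂ => if e₁.eval N M ≤ e₂.eval N M then 1 else 0

/-- `n` executions of `f`, for the indices `s, s + 1, …`. -/
def iter {α : Type} (f : ℕ → α → α) (s : ℕ) : ℕ → α → α
  | 0, M => M
  | n + 1, M => f (s + n) (iter f s n M)

theorem iter_add {α : Type} (f : ℕ → α → α) (s a b : ℕ) (M : α) :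
    iter f s (a + b) M = iter f (s + a) b (iter f s a M) := by
  induction b with
  | zero => rfl
  | succ b ih => rw [← Nat.add_assoc, iter, iter, ih, Nat.add_assoc]

/-! ### Translation to random access machines -/

/-- Arrays of `V` become even arrays, and `len` is read from array `1`. -/
def Ex.toExpr (idx : V → ℕ) : Ex V → RAM.Expr
  | const z => .const z
  | len => .load 1 (.const 0)
  | load a i => .load (2 * idx a) (i.toExpr idx)
  | add e₁ e₂ => .add (e₁.toExpr idx) (e₂.toExpr idx)
  | sub e₁ e₂ => .sub (e₁.toExpr idx) (e₂.toExpr idx)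
  | le e₁ e₂ => .le (e₁.toExpr idx) (e₂.toExpr idx)

/-- A loop at depth `d` keeps its counter and its bound in array `2 * d + 3`. -/
def LProg.compile (idx : V → ℕ) : ℕ → LProg V → RAM.Prog
  | _, .skip => .skip
  | _, .store a i e => .store (2 * idx a) (i.toExpr idx) (e.toExpr idx)
  | d, .seq P Q => .seq (P.compile idx d) (Q.compile idx d)
  | d, .ite e P Q => .ite (e.toExpr idx) (P.compile idx d) (Q.compile idx d)
  | d, .rep v e P =>
      .seq (.store (2 * d + 3) (.const 1) (e.toExpr idx))
      (.seq (.store (2 * d + 3) (.const 0) (.const 0))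
        -- A conjunction is expressed as a sum of two truth values that is at least 2. The bound was
        -- stored beforehand, and the counter is copied to `v` in each round, so the body can change
        -- neither the number of rounds nor the next index by writing to arrays of `V`.
        (.loop (.le (.const 2)
            (.add (.le (.add (.load (2 * d + 3) (.const 0)) (.const 1)) (.load 1 (.const 0)))
              (.le (.add (.load (2 * d + 3) (.const 0)) (.const 1)) (.load (2 * d + 3) (.const 1)))))
          (.seq (.store (2 * idx v) (.const 0) (.load (2 * d + 3) (.const 0)))
            (.seq (P.compile idx (d + 1))
              (.store (2 * d + 3) (.const 0)
                (.add (.load (2 * d + 3) (.const 0)) (.const 1)))))))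

/-- Every cell has at most `b` binary digits. -/
def Bits (b : ℕ) (M : RAM.Memory) : Prop := ∀ a i, (M a i).natAbs < 2 ^ b

theorem Bits.mono {b c : ℕ} {M : RAM.Memory} (h : Bits b M) (hbc : b ≤ c) : Bits c M :=
  fun a i => (h a i).trans_le (Nat.pow_le_pow_right (by norm_num) hbc)

/-- Expressions of random access machines without multiplication. -/
def MulFree : RAM.Expr → Prop
  | .const _ => True
  | .load _ i => MulFree i
  | .add e₁ e₂ => MulFree e₁ ∧ MulFree e₂
  | .sub e₁ e₂ => MulFree e₁ ∧ MulFree e₂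
  | .mul _ _ => False
  | .le e₁ e₂ => MulFree e₁ ∧ MulFree e₂

/-- A weight that bounds the growth of values and the cost of evaluation. -/
def weight : RAM.Expr → ℕ
  | .const z => RAM.bitLength z
  | .load _ i => weight i + 2
  | .add e₁ e₂ => weight e₁ + weight e₂ + 2
  | .sub e₁ e₂ => weight e₁ + weight e₂ + 2
  | .mul e₁ e₂ => weight e₁ + weight e₂ + 2
  | .le e₁ e₂ => weight e₁ + weight e₂ + 2

theorem bitLength_le {z : ℤ} {n : ℕ} (h : z.natAbs < 2 ^ n) : RAM.bitLength z ≤ n + 1 := by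
  have := Nat.size_le.2 h
  unfold RAM.bitLength; omega

theorem weight_pos (e : RAM.Expr) : 1 ≤ weight e := by
  cases e <;> simp [weight, RAM.bitLength]

theorem natAbs_add_lt {x y : ℤ} {b c n : ℕ} (hx : x.natAbs < 2 ^ b) (hy : y.natAbs < 2 ^ c)
    (hb : b + 1 ≤ n) (hc : c + 1 ≤ n) :
    (x + y).natAbs < 2 ^ n ∧ (x - y).natAbs < 2 ^ n := by
  obtain ⟨n, rfl⟩ : ∃ k, n = k + 1 := ⟨n - 1, by omega⟩
  have h1 : 2 ^ b ≤ 2 ^ n := Nat.pow_le_pow_right (by norm_num) (by omega)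
  have h2 : 2 ^ c ≤ 2 ^ n := Nat.pow_le_pow_right (by norm_num) (by omega)
  rw [pow_succ]
  constructor <;> omega

/-- Without multiplication, an operation lengthens the longer operand by at most one digit, so the
growth is bounded by the syntax of the expression and not by the memory. Products would allow
repeated squaring in a loop and exponentially long numbers. -/
theorem eval_bound {e : RAM.Expr} (he : MulFree e) {b : ℕ} {M : RAM.Memory} (hM : Bits b M) :
    (e.eval M).natAbs < 2 ^ (b + weight e) ∧ e.cost M ≤ weight e * (b + weight e) := by
  have key : ∀ {w₁ w₂ c₁ c₂ c : ℕ}, c₁ ≤ w₁ * (b + w₁) → c₂ ≤ w₂ * (b + w₂) →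
      c ≤ b + (w₁ + w₂ + 2) + 1 →
      c₁ + c₂ + c ≤ (w₁ + w₂ + 2) * (b + (w₁ + w₂ + 2)) := by
    intro w₁ w₂ c₁ c₂ c h1 h2 h3
    nlinarith [Nat.zero_le (w₁ * w₂), Nat.zero_le (w₁ * b)]
  have one_lt : ∀ {p : Prop} [Decidable p] (n : ℕ), (if p then (1 : ℤ) else 0).natAbs < 2 ^ (n + 2) := by
    intro p _ n
    have : 2 ^ 1 ≤ 2 ^ (n + 2) := Nat.pow_le_pow_right (by norm_num) (by omega)
    split_ifs
    · exact this
    · simp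
  induction e with
  | const z =>
    refine ⟨Nat.size_le.1 ?_, ?_⟩
    · simp only [RAM.Expr.eval, weight, RAM.bitLength]; omega
    · simp only [RAM.Expr.cost, weight, RAM.bitLength]; nlinarith
  | load a i ih =>
    obtain ⟨-, h2⟩ := ih he
    have h := hM a (i.eval M)
    refine ⟨(hM.mono (by omega)) _ _, ?_⟩
    have h3 := bitLength_le h
    simp only [RAM.Expr.cost, weight]
    nlinarith
  | add e₁ e₂ ih₁ ih₂ =>
    obtain ⟨h1, h2⟩ := ih₁ he.1
    obtain ⟨h3, h4⟩ := ih₂ he.2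
    have h := (natAbs_add_lt (n := b + weight (.add e₁ e₂)) h1 h3 (by simp only [weight]; omega)
      (by simp only [weight]; omega)).1
    exact ⟨h, key h2 h4 (bitLength_le h)⟩
  | sub e₁ e₂ ih₁ ih₂ =>
    obtain ⟨h1, h2⟩ := ih₁ he.1
    obtain ⟨h3, h4⟩ := ih₂ he.2
    have h := (natAbs_add_lt (n := b + weight (.sub e₁ e₂)) h1 h3 (by simp only [weight]; omega)
      (by simp only [weight]; omega)).2
    exact ⟨h, key h2 h4 (bitLength_le h)⟩
  | mul e₁ e₂ => exact he.elim
  | le e₁ e₂ ih₁ ih₂ =>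
    obtain ⟨h1, h2⟩ := ih₁ he.1
    obtain ⟨h3, h4⟩ := ih₂ he.2
    have h : (RAM.Expr.eval M (.le e₁ e₂)).natAbs < 2 ^ (b + weight (.le e₁ e₂)) := one_lt _
    exact ⟨h, key h2 h4 (bitLength_le h)⟩

/-- `P` runs from `M` to `M'`, and `s` bounds the number of new binary digits and, up to the length
of the numbers, the time. -/
def RunWithin (P : RAM.Prog) (M M' : RAM.Memory) (s : ℕ) : Prop :=
  ∀ b, Bits b M → Bits (b + s) M' ∧ ∃ t, RAM.Run P M M' t ∧ t ≤ s * (b + s)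

theorem RunWithin.mono {P : RAM.Prog} {M M' : RAM.Memory} {s s' : ℕ} (h : RunWithin P M M' s)
    (hs : s ≤ s') : RunWithin P M M' s' := by
  intro b hb
  obtain ⟨h1, t, h2, h3⟩ := h b hb
  exact ⟨h1.mono (by omega), t, h2, h3.trans (Nat.mul_le_mul hs (by omega))⟩

theorem RunWithin.skip (M : RAM.Memory) : RunWithin .skip M M 1 :=
  fun b hb => ⟨hb.mono (by omega), 1, .skip M, by nlinarith⟩

theorem RunWithin.store (a : ℕ) {i e : RAM.Expr} (hi : MulFree i) (he : MulFree e)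
    (M : RAM.Memory) :
    RunWithin (.store a i e) M (M.write a (i.eval M) (e.eval M)) (1 + weight i + weight e) := by
  intro b hb
  obtain ⟨-, h2⟩ := eval_bound hi hb
  obtain ⟨h3, h4⟩ := eval_bound he hb
  refine ⟨?_, _, .store a i e M, ?_⟩
  · intro c j
    unfold RAM.Memory.write
    split_ifs
    · exact h3.trans_le (Nat.pow_le_pow_right (by norm_num) (by omega))
    · exact hb.mono (by omega) c j
  · have := weight_pos e
    nlinarith [Nat.zero_le (weight i * weight e), Nat.zero_le (weight i * b)]

/-- The bound s(b + s) is chosen to compose: s(b + s) + s'(b + s + s') is at most (s + s')(b + s +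
s'). Quantifying over `b` in `RunWithin` lets the second program start from the numbers that the
first one has lengthened. -/
theorem RunWithin.seq {P Q : RAM.Prog} {M M' M'' : RAM.Memory} {s s' : ℕ}
    (hP : RunWithin P M M' s) (hQ : RunWithin Q M' M'' s') :
    RunWithin (.seq P Q) M M'' (s + s') := by
  intro b hb
  obtain ⟨h1, t, h2, h3⟩ := hP b hb
  obtain ⟨h4, t', h5, h6⟩ := hQ _ h1
  refine ⟨h4.mono (by omega), _, .seq h2 h5, ?_⟩
  nlinarith [Nat.zero_le (s * s')]

theorem RunWithin.ite {e : RAM.Expr} {P Q : RAM.Prog} {M M' : RAM.Memory} {s : ℕ}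
    (he : MulFree e) (h : if e.eval M ≠ 0 then RunWithin P M M' s else RunWithin Q M M' s) :
    RunWithin (.ite e P Q) M M' (1 + weight e + s) := by
  intro b hb
  obtain ⟨-, h2⟩ := eval_bound he hb
  have hw := weight_pos e
  have key : ∀ t ≤ s * (b + s),
      1 + e.cost M + t ≤ (1 + weight e + s) * (b + (1 + weight e + s)) := by
    intro t ht
    nlinarith [Nat.zero_le (weight e * s)]
  split_ifs at h with h0
  · obtain ⟨h3, t, h4, h5⟩ := h b hb
    exact ⟨h3.mono (by omega), _, .ite_true h0 h4, key t h5⟩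
  · obtain ⟨h3, t, h4, h5⟩ := h b hb
    exact ⟨h3.mono (by omega), _, .ite_false (not_not.1 h0) h4, key t h5⟩

theorem RunWithin.loop_false {e : RAM.Expr} {P : RAM.Prog} {M : RAM.Memory}
    (he : MulFree e) (h : e.eval M = 0) : RunWithin (.loop e P) M M (1 + weight e) := by
  intro b hb
  obtain ⟨-, h2⟩ := eval_bound he hb
  refine ⟨hb.mono (by omega), _, .loop_false h, ?_⟩
  nlinarith

theorem RunWithin.loop_true {e : RAM.Expr} {P : RAM.Prog} {M M' M'' : RAM.Memory} {s s' : ℕ}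
    (he : MulFree e) (h : e.eval M ≠ 0) (hP : RunWithin P M M' s)
    (hL : RunWithin (.loop e P) M' M'' s') :
    RunWithin (.loop e P) M M'' (1 + weight e + s + s') := by
  intro b hb
  obtain ⟨-, h2⟩ := eval_bound he hb
  obtain ⟨h3, t, h4, h5⟩ := hP b hb
  obtain ⟨h6, t', h7, h8⟩ := hL _ h3
  refine ⟨h6.mono (by omega), _, .loop_true h h4 h7, ?_⟩
  have hw := weight_pos e
  nlinarith [Nat.zero_le (weight e * s), Nat.zero_le (weight e * s'), Nat.zero_le (s * s')]

theorem mulFree_toExpr (idx : V → ℕ) (e : Ex V) : MulFree (e.toExpr idx) := by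
  induction e <;> simp_all [Ex.toExpr, MulFree]

/-- The machine memory `M'` holds the arrays of `M` and the number `N`. -/
def Agree (idx : V → ℕ) (N : ℕ) (M : Mem V) (M' : RAM.Memory) : Prop :=
  (∀ v, M' (2 * idx v) = M v) ∧ M' 1 0 = N

theorem Agree.eval {idx : V → ℕ} {N : ℕ} {M : Mem V} {M' : RAM.Memory} (h : Agree idx N M M')
    (e : Ex V) : (e.toExpr idx).eval M' = e.eval N M := by
  induction e <;> simp_all [Ex.toExpr, RAM.Expr.eval, Ex.eval, h.1, h.2]

theorem Agree.write_counter {idx : V → ℕ} {N : ℕ} {M : Mem V} {M' : RAM.Memory}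
    (h : Agree idx N M M') (d : ℕ) (i z : ℤ) :
    Agree idx N M (M'.write (2 * d + 3) i z) := by
  constructor
  · intro v
    funext j
    have : ¬ (2 * idx v = 2 * d + 3 ∧ j = i) := by omega
    simp only [RAM.Memory.write, this, if_false, h.1]
  · have : ¬ (1 = 2 * d + 3 ∧ (0 : ℤ) = i) := by omega
    simp only [RAM.Memory.write, this, if_false, h.2]

/-! ### Semantics of programs with bounded loops, and the rule for loops -/

variable [DecidableEq V]

/-- Writing `v` into cell `i` of array `a`. -/
def Mem.write (M : Mem V) (a : V) (i v : ℤ) : Mem V :=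
  fun b j => if b = a ∧ j = i then v else M b j

/-- The memory after the execution of a program. -/
def exec (N : ℕ) : LProg V → Mem V → Mem V
  | .skip, M => M
  | .store a i e, M => M.write a (i.eval N M) (e.eval N M)
  | .seq P Q, M => exec N Q (exec N P M)
  | .ite e P Q, M => if e.eval N M ≠ 0 then exec N P M else exec N Q M
  | .rep v e P, M =>
      iter (fun i M => exec N P (M.write v 0 i)) 0 (min (e.eval N M).toNat N) M

/-- Whether the array `a` is written by a program. -/
def LProg.writes (a : V) : LProg V → Bool
  | .skip => false
  | .store b _ _ => decide (a = b)
  | .seq P Q => P.writes a || Q.writes a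
  | .ite _ P Q => P.writes a || Q.writes a
  | .rep v _ P => decide (a = v) || P.writes a

theorem write_of_ne (M : Mem V) {a b : V} (h : b ≠ a) (i v : ℤ) : M.write a i v b = M b := by
  funext j; simp [Mem.write, h]

/-- A frame rule. `LProg.writes` is computed from the syntax, so for a concrete program the
hypothesis is closed by `rfl`. -/
theorem exec_of_not_writes (N : ℕ) (a : V) (P : LProg V) (M : Mem V) (h : P.writes a = false) :
    exec N P M a = M a := by
  induction P generalizing M with
  | skip => rfl
  | store b i e => simp only [LProg.writes, decide_eq_false_iff_not] at h; exact write_of_ne _ h _ _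
  | seq P Q ihP ihQ =>
    simp only [LProg.writes, Bool.or_eq_false_iff] at h
    rw [exec, ihQ _ h.2, ihP _ h.1]
  | ite e P Q ihP ihQ =>
    simp only [LProg.writes, Bool.or_eq_false_iff] at h
    rw [exec]; split_ifs
    · exact ihP _ h.1
    · exact ihQ _ h.2
  | rep v e P ih =>
    simp only [LProg.writes, Bool.or_eq_false_iff, decide_eq_false_iff_not] at h
    rw [exec]
    generalize min (e.eval N M).toNat N = n
    induction n with
    | zero => rfl
    | succ n ihn => rw [iter, ih _ h.2, write_of_ne _ h.1, ihn]

/-- The rule for loops: an invariant may use that arrays not written by the loop are unchanged. -/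
theorem rep_induction {N : ℕ} {v : V} {e : Ex V} {P : LProg V} {M₀ : Mem V} {n : ℕ}
    (he : e.eval N M₀ = n) (hn : n ≤ N) (Inv : ℕ → Mem V → Prop) (h0 : Inv 0 M₀)
    (hstep : ∀ i < n, ∀ M : Mem V, (∀ a, (LProg.rep v e P).writes a = false → M a = M₀ a) →
      Inv i M → Inv (i + 1) (exec N P (M.write v 0 i))) :
    Inv n (exec N (.rep v e P) M₀) := by
  rw [exec, he, Int.toNat_natCast, min_eq_left hn]
  suffices h : ∀ i ≤ n, (∀ a, (LProg.rep v e P).writes a = false →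
      iter (fun i M => exec N P (M.write v 0 i)) 0 i M₀ a = M₀ a) ∧
      Inv i (iter (fun i M => exec N P (M.write v 0 i)) 0 i M₀) from (h n le_rfl).2
  intro i hi
  induction i with
  | zero => exact ⟨fun _ _ => rfl, h0⟩
  | succ i ih =>
    obtain ⟨h1, h2⟩ := ih (by omega)
    constructor
    · intro a ha
      have h := ha
      simp only [LProg.writes, Bool.or_eq_false_iff, decide_eq_false_iff_not] at h
      rw [iter, exec_of_not_writes _ _ _ _ h.2, write_of_ne _ h.1, h1 a ha]
    · rw [iter, Nat.zero_add]
      exact hstep i (by omega) _ h1 h2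

/-! ### Correctness and running time of the translation -/

theorem Agree.write {idx : V → ℕ} (hidx : idx.Injective) {N : ℕ} {M : Mem V} {M' : RAM.Memory}
    (h : Agree idx N M M') (a : V) (i z : ℤ) :
    Agree idx N (M.write a i z) (M'.write (2 * idx a) i z) := by
  constructor
  · intro v
    funext j
    have : 2 * idx v = 2 * idx a ↔ v = a := ⟨fun h => hidx (by omega), fun h => by rw [h]⟩
    simp only [RAM.Memory.write, Mem.write, this, h.1]
  · have : ¬ (1 = 2 * idx a ∧ (0 : ℤ) = i) := by omega
    simp only [RAM.Memory.write, this, if_false, h.2]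

/-- The condition of a translated loop. -/
abbrev loopCond (d : ℕ) : RAM.Expr :=
  .le (.const 2)
    (.add (.le (.add (.load (2 * d + 3) (.const 0)) (.const 1)) (.load 1 (.const 0)))
      (.le (.add (.load (2 * d + 3) (.const 0)) (.const 1)) (.load (2 * d + 3) (.const 1))))

/-- A polynomial that bounds the number of steps of a program. -/
noncomputable def LProg.steps (idx : V → ℕ) : ℕ → LProg V → Polynomial ℕ
  | _, .skip => 1
  | _, .store _ i e => Polynomial.C (1 + weight (i.toExpr idx) + weight (e.toExpr idx))
  | d, .seq P Q => P.steps idx d + Q.steps idx d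
  | d, .ite e P Q =>
      Polynomial.C (1 + weight (e.toExpr idx)) + (P.steps idx d + Q.steps idx d)
  | d, .rep _ e P =>
      Polynomial.C (60 + weight (e.toExpr idx) + weight (loopCond d)) +
        Polynomial.X * (P.steps idx (d + 1) + Polynomial.C (60 + weight (loopCond d)))

theorem weight_zero : weight (.const 0) = 1 := by simp [weight, RAM.bitLength]

theorem weight_one : weight (.const 1) = 2 := by simp [weight, RAM.bitLength]

/-- The arrays of `V` become even arrays and the counter of a loop at depth d lies in array 2d + 3,
so the two never collide, and array 1 stays free for the input length. The last conclusion makes the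
induction work: a body compiled at depth d + 1 preserves the counters of all enclosing loops. -/
theorem compile_correct {idx : V → ℕ} (hidx : idx.Injective) (N : ℕ) (P : LProg V) (d : ℕ)
    (M : Mem V) (M' : RAM.Memory) (h : Agree idx N M M') :
    ∃ M'', RunWithin (P.compile idx d) M' M'' ((P.steps idx d).eval N) ∧
      Agree idx N (exec N P M) M'' ∧ ∀ c < d, M'' (2 * c + 3) = M' (2 * c + 3) := by
  induction P generalizing d M M' with
  | skip => exact ⟨M', by simpa [LProg.steps, LProg.compile] using RunWithin.skip M', h, fun _ _ => rfl⟩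
  | store a i e =>
    refine ⟨M'.write (2 * idx a) ((i.toExpr idx).eval M') ((e.toExpr idx).eval M'), ?_, ?_, ?_⟩
    rotate_left
    · have := h.write hidx a (i.eval N M) (e.eval N M)
      rw [← h.eval, ← h.eval] at this
      rw [exec, ← h.eval, ← h.eval]; exact this
    · intro c _
      funext j
      have : ¬ (2 * c + 3 = 2 * idx a ∧ j = (i.toExpr idx).eval M') := by omega
      simp only [RAM.Memory.write, this, if_false]
    · simp only [LProg.steps, Polynomial.eval_C]
      exact RunWithin.store _ (mulFree_toExpr _ _) (mulFree_toExpr _ _) _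
  | seq P Q ihP ihQ =>
    obtain ⟨M₁, h1, h2, h3⟩ := ihP d M M' h
    obtain ⟨M₂, h4, h5, h6⟩ := ihQ d _ _ h2
    refine ⟨M₂, ?_, h5, fun c hc => (h6 c hc).trans (h3 c hc)⟩
    simpa [LProg.steps, LProg.compile] using h1.seq h4
  | ite e P Q ihP ihQ =>
    have hcond := h.eval e
    by_cases h0 : e.eval N M ≠ 0
    · obtain ⟨M₁, h1, h2, h3⟩ := ihP d M M' h
      refine ⟨M₁, ?_, by rwa [exec, if_pos h0], h3⟩
      simp only [LProg.steps, Polynomial.eval_add, Polynomial.eval_C]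
      exact RunWithin.ite (mulFree_toExpr _ _) (by rw [hcond, if_pos h0]; exact h1.mono (by omega))
    · obtain ⟨M₁, h1, h2, h3⟩ := ihQ d M M' h
      refine ⟨M₁, ?_, by rwa [exec, if_neg h0], h3⟩
      simp only [LProg.steps, Polynomial.eval_add, Polynomial.eval_C]
      exact RunWithin.ite (mulFree_toExpr _ _) (by rw [hcond, if_neg h0]; exact h1.mono (by omega))
  | rep v e P ih =>
    set f : ℕ → Mem V → Mem V := fun i M => exec N P (M.write v 0 i) with hf
    set n := min (e.eval N M).toNat N with hn
    set s := (P.steps idx (d + 1)).eval N with hs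
    set B : RAM.Prog := (.seq (.store (2 * idx v) (.const 0) (.load (2 * d + 3) (.const 0)))
            (.seq (P.compile idx (d + 1))
              (.store (2 * d + 3) (.const 0)
                (.add (.load (2 * d + 3) (.const 0)) (.const 1))))) with hB
    have cond : ∀ (M' : RAM.Memory) (i : ℕ), M' (2 * d + 3) 0 = i →
        M' (2 * d + 3) 1 = e.eval N M → M' 1 0 = N →
        ((loopCond d).eval M' = if i < n then 1 else 0) := by
      intro M' i h1 h2 h3
      simp only [RAM.Expr.eval, h1, h2, h3, hn]
      split_ifs <;> omega
    -- Here `i` rounds are done and `j` remain. The induction is on `j`, because the machine unfolds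
    -- a loop at its first round; `iter` unfolds at the last one, and `iter_add` mediates.
    have main : ∀ j i, i + j = n → ∀ M₁ M₁', Agree idx N M₁ M₁' → M₁' (2 * d + 3) 0 = i →
        M₁' (2 * d + 3) 1 = e.eval N M →
        ∃ M'', RunWithin (.loop (loopCond d) B) M₁' M''
            (1 + weight (loopCond d) + j * (s + 60 + weight (loopCond d))) ∧
          Agree idx N (iter f i j M₁) M'' ∧ ∀ c < d, M'' (2 * c + 3) = M₁' (2 * c + 3) := by
      intro j
      induction j with
      | zero =>
        intro i hi M₁ M₁' h1 h2 h3
        refine ⟨M₁', ?_, h1, fun _ _ => rfl⟩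
        have := cond M₁' i h2 h3 h1.2
        rw [if_neg (by omega)] at this
        refine (RunWithin.loop_false (by simp [MulFree]) this).mono (by omega)
      | succ j ihj =>
        intro i hi M₁ M₁' h1 h2 h3
        have hc := cond M₁' i h2 h3 h1.2
        rw [if_pos (by omega)] at hc
        have ha := h1.write hidx v 0 i
        obtain ⟨M₂, r1, a2, p2⟩ := ih (d + 1) _ _ ha
        have hp := p2 d (by omega)
        -- The loop variable lies in an even array and the body is compiled one level deeper, so
        -- both the counter and the stored bound survive the round.
        have q0 : ∀ j, M₂ (2 * d + 3) j = M₁' (2 * d + 3) j := by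
          intro j
          rw [hp]
          have : ¬ (2 * d + 3 = 2 * idx v ∧ j = 0) := by omega
          simp only [RAM.Memory.write, this, if_false]
        obtain ⟨M₃, r2, a3, p3⟩ := ihj (i + 1) (by omega) (f i M₁)
          (M₂.write (2 * d + 3) 0 (i + 1)) (a2.write_counter d 0 _) (by simp [RAM.Memory.write])
          (by simp [RAM.Memory.write, q0, h3])
        refine ⟨M₃, ?_, ?_, ?_⟩
        · have r0 := RunWithin.store (2 * idx v) (i := .const 0) (e := .load (2 * d + 3) (.const 0))
            (by simp [MulFree]) (by simp [MulFree]) M₁'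
          have r3 := RunWithin.store (2 * d + 3) (i := .const 0)
            (e := .add (.load (2 * d + 3) (.const 0)) (.const 1))
            (by simp [MulFree]) (by simp [MulFree]) M₂
          simp only [RAM.Expr.eval, h2] at r0
          simp only [RAM.Expr.eval, q0, h2] at r3
          have r4 := RunWithin.loop_true (by simp [MulFree]) (by rw [hc]; norm_num)
            (r0.seq (r1.seq r3)) r2
          -- Besides the condition and the body, a round costs 5 and 9 for the two stores and 1 for
          -- the test; 60 is a generous bound.
          refine r4.mono ?_
          have w1 : weight (.load (2 * d + 3) (.const 0)) = 3 := by simp [weight, RAM.bitLength]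
          have w2 : weight (.add (.load (2 * d + 3) (.const 0)) (.const 1)) = 7 := by
            simp [weight, RAM.bitLength]
          rw [weight_zero, w1, w2, ← hs]
          generalize weight (loopCond d) = W
          ring_nf
          omega
        · rw [Nat.add_comm j 1, iter_add]
          simpa [iter] using a3
        · intro c hc
          rw [p3 c hc]
          funext j
          have h5 : ¬ (2 * c + 3 = 2 * d + 3 ∧ j = 0) := by omega
          have h6 : ¬ (2 * c + 3 = 2 * idx v ∧ j = 0) := by omega
          simp only [RAM.Memory.write, h5, if_false, p2 c (by omega), h6]
    have r0 := RunWithin.store (2 * d + 3) (i := .const 1) (e := e.toExpr idx)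
      (by simp [MulFree]) (mulFree_toExpr _ _) M'
    set M₁ := M'.write (2 * d + 3) 1 (e.eval N M) with hM₁
    have r1 := RunWithin.store (2 * d + 3) (i := .const 0) (e := .const 0)
      (by simp [MulFree]) (by simp [MulFree]) M₁
    simp only [RAM.Expr.eval, h.eval] at r0 r1
    have a1 := (h.write_counter d 1 (e.eval N M)).write_counter d 0 0
    obtain ⟨M'', r2, a2, p2⟩ := main n 0 (by omega) M _ a1 (by simp [RAM.Memory.write])
      (by simp [RAM.Memory.write])
    refine ⟨M'', ?_, a2, ?_⟩
    · refine (r0.seq (r1.seq r2)).mono ?_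
      simp only [LProg.steps, Polynomial.eval_add, Polynomial.eval_mul, Polynomial.eval_C,
        Polynomial.eval_X, weight_zero, weight_one, ← hs]
      have : n * (s + 60 + weight (loopCond d)) ≤ N * (s + (60 + weight (loopCond d))) :=
        Nat.mul_le_mul (min_le_right _ _) (by omega)
      omega
    · intro c hc
      rw [p2 c hc]
      funext j
      have h5 : ∀ z : ℤ, ¬ (2 * c + 3 = 2 * d + 3 ∧ j = z) := by omega
      simp only [RAM.Memory.write, h5, if_false]

/-! ### From programs with bounded loops to polynomial time -/

theorem bitLength_le_inputSize {w : List ℤ} {z : ℤ} (h : z ∈ w) :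
    RAM.bitLength z ≤ RAM.inputSize w :=
  List.single_le_sum (by simp) _ (List.mem_map_of_mem h)

theorem length_le_inputSize (w : List ℤ) : w.length ≤ RAM.inputSize w := by
  have : ∀ w : List ℤ, w.length ≤ (w.map RAM.bitLength).sum := by
    intro w
    induction w with
    | nil => simp
    | cons z w ih => simp only [List.length_cons, List.map_cons, List.sum_cons, RAM.bitLength]; omega
  exact this w

theorem bits_initial (w : List ℤ) : Bits (RAM.inputSize w) (RAM.initial w) := by
  intro a i
  unfold RAM.initial
  split_ifs
  · rw [List.getD_eq_getElem?_getD]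
    cases h : w[i.toNat]? with
    | none => simp
    | some z =>
      have := bitLength_le_inputSize (List.mem_of_getElem? h)
      simp only [Option.getD_some]
      rw [← Nat.size_le]
      unfold RAM.bitLength at this; omega
  · simp only [Int.natAbs_natCast]
    exact (length_le_inputSize w).trans_lt Nat.lt_two_pow_self
  · simp

theorem eval_mono (q : Polynomial ℕ) {a b : ℕ} (h : a ≤ b) : q.eval a ≤ q.eval b := by
  rw [Polynomial.eval_eq_sum, Polynomial.eval_eq_sum]
  exact Finset.sum_le_sum fun i _ => Nat.mul_le_mul_left _ (Nat.pow_le_pow_left h i)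

/-- The initial memory, with the input in the array `inp`. -/
def start (inp : V) (w : List ℤ) : Mem V := fun a i =>
  if a = inp ∧ 0 ≤ i then w.getD i.toNat 0 else 0

/-- A problem decided by a program with bounded loops is solvable in polynomial time. -/
theorem solvableInPolyTime {α : Type} {encode : α → List ℤ} {Promise Yes : α → Prop}
    {idx : V → ℕ} (hidx : idx.Injective) {inp : V} (hinp : idx inp = 0) (P : LProg V)
    (hP : ∀ x, Promise x →
      (Yes x → exec (encode x).length P (start inp (encode x)) inp 0 = 1) ∧
      (¬ Yes x → exec (encode x).length P (start inp (encode x)) inp 0 = 0)) :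
    RAM.SolvableInPolyTime encode Promise Yes := by
  refine ⟨P.compile idx 0, P.steps idx 0 * (Polynomial.X + P.steps idx 0), fun x hx => ?_⟩
  set w := encode x
  have hag : Agree idx w.length (start inp w) (RAM.initial w) := by
    constructor
    · intro v
      funext i
      have h1 : 2 * idx v = 0 ↔ v = inp :=
        ⟨fun h => hidx (by omega), fun h => by rw [h, hinp]⟩
      have h2 : 2 * idx v ≠ 1 := by omega
      simp [RAM.initial, start, h1, h2]
    · simp [RAM.initial]
  obtain ⟨M, h1, h2, -⟩ := compile_correct hidx w.length P 0 _ _ hag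
  obtain ⟨-, t, h3, h4⟩ := h1 _ (bits_initial w)
  have h0 : M 0 0 = exec w.length P (start inp w) inp 0 := by
    rw [← h2.1 inp, hinp]
  refine ⟨M, t, h3, h4.trans ?_, ?_, ?_⟩
  -- The run takes time s(b + s), where b is the input size and s is the value of the step
  -- polynomial at the input length. That length is at most b, and polynomials with natural
  -- coefficients are monotone.
  · have := eval_mono (P.steps idx 0) (length_le_inputSize w)
    simp only [Polynomial.eval_mul, Polynomial.eval_add, Polynomial.eval_X]
    exact Nat.mul_le_mul this (by omega)
  · rw [h0]; exact (hP x hx).1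
  · rw [h0]; exact (hP x hx).2

end BoundedLoop

/-! ## Costs, and their encoding by integers -/

namespace CECAC

/-- Costs: integers with an infinite cost, under minimum and addition. -/
abbrev Cost := Tropical (WithTop ℤ)

/-- Costs encoded as integers: `0` for the infinite cost, and `2 * v + 1` for `v`. -/
def Cost.enc (x : Cost) : ℤ :=
  match Tropical.untrop x with
  | ⊤ => 0
  | (v : ℤ) => 2 * v + 1

namespace Cost

theorem enc_zero : enc 0 = 0 := rfl

theorem enc_one : enc 1 = 1 := rfl

theorem enc_trop (v : ℤ) : enc (Tropical.trop (v : WithTop ℤ)) = 2 * v + 1 := rfl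

theorem eq_zero_or_trop (x : Cost) : x = 0 ∨ ∃ v : ℤ, x = Tropical.trop (v : WithTop ℤ) := by
  induction x using Tropical.tropRec with
  | h x =>
    induction x using WithTop.recTopCoe with
    | top => exact .inl rfl
    | coe v => exact .inr ⟨v, rfl⟩

theorem trop_mul_trop (v w : ℤ) :
    (Tropical.trop (v : WithTop ℤ) * Tropical.trop (w : WithTop ℤ) : Cost) =
      Tropical.trop ((v + w : ℤ) : WithTop ℤ) := rfl

theorem trop_add_trop (v w : ℤ) :
    (Tropical.trop (v : WithTop ℤ) + Tropical.trop (w : WithTop ℤ) : Cost) =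
      Tropical.trop ((min v w : ℤ) : WithTop ℤ) := by
  rw [WithTop.coe_min]; rfl

/-- Finite costs have odd codes and (2v + 1) + (2w + 1) - 1 = 2(v + w) + 1, so the semiring product
needs only additions. The code 0 of the semiring zero is also the content of a fresh cell, so tables
start out as zero tables. -/
theorem enc_mul (x y : Cost) :
    enc (x * y) = if enc x = 0 ∨ enc y = 0 then 0 else enc x + enc y - 1 := by
  rcases eq_zero_or_trop x with rfl | ⟨v, rfl⟩
  · simp [enc_zero]
  rcases eq_zero_or_trop y with rfl | ⟨w, rfl⟩
  · simp [enc_zero]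
  rw [trop_mul_trop, enc_trop, enc_trop, enc_trop, if_neg (by omega)]
  ring

theorem enc_add (x y : Cost) :
    enc (x + y) = if enc x = 0 then enc y else if enc y = 0 then enc x else min (enc x) (enc y) := by
  rcases eq_zero_or_trop x with rfl | ⟨v, rfl⟩
  · simp [enc_zero]
  rcases eq_zero_or_trop y with rfl | ⟨w, rfl⟩
  · simp [enc_zero]
  rw [trop_add_trop, enc_trop, enc_trop, enc_trop, if_neg (by omega), if_neg (by omega)]
  omega

/-- The sum is a minimum, which is at most `q` exactly when a term is. The threshold must be
negative, since otherwise the code 0 of the infinite cost would pass the test. -/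
theorem enc_sum_le {ι : Type} (s : Finset ι) (f : ι → Cost) {q : ℤ} (hq : q < 0) :
    enc (∑ i ∈ s, f i) ≤ q ↔ ∃ i ∈ s, enc (f i) ≤ q := by
  classical
  induction s using Finset.induction_on with
  | empty => simp [enc_zero, hq]
  | insert a s ha ih =>
    rw [Finset.sum_insert ha, enc_add, Finset.exists_mem_insert, ← ih]
    split_ifs <;> omega

theorem prod_trop {ι : Type} (s : Finset ι) (f : ι → ℤ) :
    (∏ i ∈ s, (Tropical.trop (f i : WithTop ℤ) : Cost)) =
      Tropical.trop ((∑ i ∈ s, f i : ℤ) : WithTop ℤ) := by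
  classical
  induction s using Finset.induction_on with
  | empty => rfl
  | insert a s ha ih => rw [Finset.prod_insert ha, Finset.sum_insert ha, ih, trop_mul_trop]

end Cost

/-! ## Variable elimination -/

/-- The elements of `T`, at most two, are listed by `i` and `j`; missing ones are replaced
by `r`. -/
def Lists (r : ℕ) (T : Finset ℕ) (i j : ℕ) : Prop :=
  (i = r ∧ j = r ∧ T = ∅) ∨ (i ≠ r ∧ j = r ∧ T = {i}) ∨ (i ≠ r ∧ j ≠ r ∧ i ≠ j ∧ T = {i, j})

/-- Factors that depend on the variables `u i` and `v i` through the table `t i`, for `i ∈ act`. -/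
structure Factors (K : Type) : Type where
  act : Finset ℕ
  u : ℕ → ℕ
  v : ℕ → ℕ
  t : ℕ → Bool → Bool → K

namespace Factors

variable {K : Type} [CommSemiring K]

/-- The value of a factor under an assignment. -/
def factor (F : Factors K) (i : ℕ) (X : ℕ → Bool) : K := F.t i (X (F.u i)) (X (F.v i))

/-- The product of the active factors. -/
def value (F : Factors K) (X : ℕ → Bool) : K := ∏ i ∈ F.act, F.factor i X

/-- The active factors that depend on the variable `a`. -/
def touching (F : Factors K) (a : ℕ) : Finset ℕ := F.act.filter fun i => F.u i = a ∨ F.v i = a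

/-- The variables `u i` and `v i` are set to `a`. -/
def setScope (F : Factors K) (i a : ℕ) : Factors K where
  act := F.act
  u := Function.update F.u i a
  v := Function.update F.v i a
  t := F.t

theorem value_setScope (F : Factors K) {i : ℕ} (hi : i ∉ F.act) (a : ℕ) (X : ℕ → Bool) :
    (F.setScope i a).value X = F.value X := by
  refine Finset.prod_congr rfl fun j hj => ?_
  have : j ≠ i := fun h => hi (h ▸ hj)
  simp [factor, setScope, this]

theorem touching_setScope (F : Factors K) {i : ℕ} (hi : i ∉ F.act) (a b : ℕ) :
    (F.setScope i a).touching b = F.touching b := by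
  refine Finset.filter_congr fun j hj => ?_
  have : j ≠ i := fun h => hi (h ▸ hj)
  simp [setScope, this]

/-- The factors `i` and `j` are those that depend on `a`, where `r` stands for a missing one. -/
def Selects (F : Factors K) (r a i j : ℕ) : Prop := Lists r (F.touching a) i j

/-- The assignment of `b` to `a`, of `y` to `q`, and of `x` to all other variables. -/
def pick (a q : ℕ) (x y b : Bool) (c : ℕ) : Bool := if c = a then b else if c = q then y else x

/-- The table of the factor that results when `a` is eliminated from the factors `i` and `j`. -/
def joint (F : Factors K) (g : Bool → K) (a i j : ℕ) (x y : Bool) : K :=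
  ∑ b, g b * F.factor i (pick a (F.u j + F.v j - a) x y b) *
    F.factor j (pick a (F.u j + F.v j - a) x y b)

/-- The factors `i` and `j` are replaced by one that does not depend on `a`. -/
def eliminate (F : Factors K) (g : Bool → K) (a i j k : ℕ) : Factors K where
  act := insert k ((F.act.erase i).erase j)
  u := Function.update F.u k (F.u i + F.v i - a)
  v := Function.update F.v k (F.u j + F.v j - a)
  t := Function.update F.t k (F.joint g a i j)

variable {F : Factors K} {r a i j k : ℕ}

/-- One of the two variables of factor `i` is `a`, so their sum minus `a` is the other one, and is
`a` again if both are `a`; likewise for `j`. Hence `a` and these two are all the variables that the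
two factors see, and `pick` reproduces `X` on them after `a` has been set to `b`. If the two other
variables coincide, their values agree as well; if one of them is `a`, the value `b` takes
precedence. -/
theorem joint_eq (hi : F.u i = a ∨ F.v i = a) (hj : F.u j = a ∨ F.v j = a) (g : Bool → K)
    (X : ℕ → Bool) :
    F.joint g a i j (X (F.u i + F.v i - a)) (X (F.u j + F.v j - a)) =
      ∑ b, g b * F.factor i (Function.update X a b) * F.factor j (Function.update X a b) := by
  refine Finset.sum_congr rfl fun b _ => ?_
  set p := F.u i + F.v i - a with hp
  set q := F.u j + F.v j - a with hq
  have key : ∀ c, c = a ∨ c = p ∨ c = q → pick a q (X p) (X q) b c = Function.update X a b c := by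
    intro c hc
    unfold pick
    rw [Function.update_apply]
    split_ifs with h1 h2
    · rfl
    · rw [h2]
    · rcases hc with rfl | rfl | rfl
      · exact absurd rfl h1
      · rfl
      · exact absurd rfl h2
  unfold factor
  rw [key (F.u i) (by omega), key (F.v i) (by omega), key (F.u j) (by omega),
    key (F.v j) (by omega)]

/-- A missing factor is represented by the inactive index `r`. Erasing it changes nothing and its
value is 1, so zero, one and two factors on `a` are covered by the same formula. -/
theorem prod_split (hr : r ∉ F.act) (hsel : F.Selects r a i j)
    (f : ℕ → K) (hf : f r = 1) :
    ∏ c ∈ F.act, f c = f i * f j * ∏ c ∈ (F.act.erase i).erase j, f c := by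
  have hsub : F.touching a ⊆ F.act := Finset.filter_subset _ _
  rcases hsel with ⟨rfl, rfl, -⟩ | ⟨-, rfl, h⟩ | ⟨-, -, hij, h⟩
  · rw [Finset.erase_eq_of_notMem hr, Finset.erase_eq_of_notMem hr, hf, one_mul, one_mul]
  · have hi : i ∈ F.act := hsub (by simp [h])
    rw [Finset.erase_eq_of_notMem (fun h => hr (Finset.mem_of_mem_erase h)), hf, mul_one,
      Finset.mul_prod_erase _ _ hi]
  · have hi : i ∈ F.act := hsub (by simp [h])
    have hj : j ∈ F.act.erase i := Finset.mem_erase.2 ⟨hij.symm, hsub (by simp [h])⟩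
    rw [mul_assoc, Finset.mul_prod_erase _ _ hj, Finset.mul_prod_erase _ _ hi]

theorem Selects.not_touching (hsel : F.Selects r a i j) {c : ℕ}
    (hc : c ∈ (F.act.erase i).erase j) : F.u c ≠ a ∧ F.v c ≠ a := by
  simp only [Finset.mem_erase] at hc
  by_contra h
  have hmem : c ∈ F.touching a := Finset.mem_filter.2 ⟨hc.2.2, by tauto⟩
  rcases hsel with ⟨-, -, h⟩ | ⟨-, -, h⟩ | ⟨-, -, -, h⟩ <;> rw [h] at hmem <;> simp at hmem <;>
    tauto

theorem Selects.touches (hsel : F.Selects r a i j) (hru : F.u r = a) :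
    (F.u i = a ∨ F.v i = a) ∧ (F.u j = a ∨ F.v j = a) := by
  have h : ∀ c ∈ F.touching a, F.u c = a ∨ F.v c = a := fun c hc => (Finset.mem_filter.1 hc).2
  rcases hsel with ⟨rfl, rfl, -⟩ | ⟨-, rfl, e⟩ | ⟨-, -, -, e⟩
  · exact ⟨.inl hru, .inl hru⟩
  · exact ⟨h _ (by simp [e]), .inl hru⟩
  · exact ⟨h _ (by simp [e]), h _ (by simp [e])⟩

/-- Distributivity: only the selected factors depend on `a`, so all others can be taken out of the
sum over the values of `a`. -/
theorem value_eliminate (hr : r ∉ F.act) (hru : F.u r = a) (hrt : ∀ x y, F.t r x y = 1)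
    (hk : k ∉ F.act) (hsel : F.Selects r a i j) (g : Bool → K) (X : ℕ → Bool) :
    (F.eliminate g a i j k).value X = ∑ b, g b * F.value (Function.update X a b) := by
  obtain ⟨hi, hj⟩ := hsel.touches hru
  have hk' : k ∉ (F.act.erase i).erase j := fun h =>
    hk (Finset.mem_of_mem_erase (Finset.mem_of_mem_erase h))
  have h1 : (F.eliminate g a i j k).value X =
      F.joint g a i j (X (F.u i + F.v i - a)) (X (F.u j + F.v j - a)) *
        ∏ c ∈ (F.act.erase i).erase j, F.factor c X := by
    unfold value
    change ∏ c ∈ insert k ((F.act.erase i).erase j), _ = _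
    rw [Finset.prod_insert hk']
    congr 1
    · simp [factor, eliminate]
    · refine Finset.prod_congr rfl fun c hc => ?_
      have : c ≠ k := fun h => hk' (h ▸ hc)
      simp [factor, eliminate, this]
  rw [h1, joint_eq hi hj, Finset.sum_mul]
  refine Finset.sum_congr rfl fun b _ => ?_
  unfold value
  rw [prod_split hr hsel (fun c => F.factor c (Function.update X a b)) (hrt _ _), mul_assoc,
    mul_assoc, mul_assoc]
  congr 3
  refine Finset.prod_congr rfl fun c hc => ?_
  obtain ⟨h2, h3⟩ := hsel.not_touching hc
  simp [factor, h2, h3]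

/-- If the new factor depends on b ≠ `a`, then b is the other variable of `i` or of `j`. That factor
depended on b and is removed, which pays for the new one. It cannot be the neutral factor, both of
whose variables are `a`. -/
theorem card_touching_eliminate (hr : r ∉ F.act) (hru : F.u r = a) (hrv : F.v r = a)
    (hk : k ∉ F.act) (hsel : F.Selects r a i j) (g : Bool → K) {b : ℕ} (hb : b ≠ a) :
    ((F.eliminate g a i j k).touching b).card ≤ (F.touching b).card := by
  obtain ⟨hi, hj⟩ := hsel.touches hru
  set E := (F.act.erase i).erase j with hE
  have hkE : k ∉ E := fun h => hk (Finset.mem_of_mem_erase (Finset.mem_of_mem_erase h))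
  have hsub : E.filter (fun c => F.u c = b ∨ F.v c = b) ⊆ F.touching b :=
    Finset.filter_subset_filter _ ((Finset.erase_subset _ _).trans (Finset.erase_subset _ _))
  have h1 : E.filter (fun c => (F.eliminate g a i j k).u c = b ∨ (F.eliminate g a i j k).v c = b) =
      E.filter (fun c => F.u c = b ∨ F.v c = b) := by
    refine Finset.filter_congr fun c hc => ?_
    have : c ≠ k := fun h => hkE (h ▸ hc)
    simp [eliminate, this]
  have h2 : (F.eliminate g a i j k).touching b =
      (insert k E).filter
        (fun c => (F.eliminate g a i j k).u c = b ∨ (F.eliminate g a i j k).v c = b) := rfl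
  have act_of : ∀ c, (F.u c = a ∨ F.v c = a) → F.u c + F.v c - a = b → c = i ∨ c = j →
      c ∈ F.act := by
    intro c hc hcb hcij
    -- For the neutral factor, the sum of the variables minus `a` is `a` itself, which differs from
    -- `b`.
    have hcr : c ≠ r := by rintro rfl; omega
    have hact : F.touching a ⊆ F.act := Finset.filter_subset _ _
    rcases hsel with ⟨rfl, rfl, -⟩ | ⟨-, rfl, e⟩ | ⟨-, -, -, e⟩
    · tauto
    · obtain rfl : c = i := by tauto
      exact hact (by simp [e])
    · exact hact (by rw [e]; simpa using hcij)
  have strict : ∀ c, (F.u c = a ∨ F.v c = a) → F.u c + F.v c - a = b → c = i ∨ c = j →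
      (E.filter (fun c => F.u c = b ∨ F.v c = b)).card + 1 ≤ (F.touching b).card := by
    intro c hc hcb hcij
    refine Finset.card_lt_card ⟨hsub, fun h => ?_⟩
    have hmem : c ∈ F.touching b := Finset.mem_filter.2 ⟨act_of c hc hcb hcij, by omega⟩
    have := (Finset.mem_filter.1 (h hmem)).1
    simp only [hE, Finset.mem_erase] at this
    tauto
  rw [h2, Finset.filter_insert, h1]
  split_ifs with h3
  · refine (Finset.card_insert_le _ _).trans ?_
    simp only [eliminate, Function.update_self] at h3
    rcases h3 with h3 | h3
    · exact strict i hi h3 (.inl rfl)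
    · exact strict j hj h3 (.inr rfl)
  · exact Finset.card_le_card hsub

end Factors

/-- The sum of `h` over the values of the variables below `n`, weighted by `g`. -/
def sumOver {K : Type} [CommSemiring K] (g : ℕ → Bool → K) (h : (ℕ → Bool) → K) :
    ℕ → (ℕ → Bool) → K
  | 0, X => h X
  | n + 1, X => ∑ b, g n b * sumOver g h n (Function.update X n b)

/-! ## Sums over committees -/

section Committees

variable {ι : Type} [Fintype ι] [DecidableEq ι] {K : Type} [CommSemiring K]

theorem sum_powerset_union {S T : Finset ι} (hST : Disjoint S T) (f : Finset ι → K) :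
    ∑ W ∈ (S ∪ T).powerset, f W = ∑ W₂ ∈ T.powerset, ∑ W₁ ∈ S.powerset, f (W₁ ∪ W₂) := by
  rw [Finset.sum_comm, ← Finset.sum_product']
  symm
  refine Finset.sum_nbij' (fun p => p.1 ∪ p.2) (fun W => (W ∩ S, W ∩ T)) ?_ ?_ ?_ ?_ ?_
  · intro p hp
    simp only [Finset.mem_product, Finset.mem_powerset] at hp ⊢
    exact Finset.union_subset_union hp.1 hp.2
  · intro W _
    simp [Finset.mem_product]
  · rintro ⟨A, B⟩ hp
    simp only [Finset.mem_product, Finset.mem_powerset] at hp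
    have h1 : Disjoint B S := (hST.symm).mono_left hp.2
    have h2 : Disjoint A T := hST.mono_left hp.1
    rw [Finset.disjoint_iff_inter_eq_empty] at h1 h2
    simp only [Finset.union_inter_distrib_right, h1, h2, Finset.union_empty, Finset.empty_union,
      Finset.inter_eq_left.2 hp.1, Finset.inter_eq_left.2 hp.2]
  · intro W hW
    simp only [Finset.mem_powerset] at hW
    simp only [← Finset.inter_union_distrib_left, Finset.inter_eq_left.2 hW]
  · intro p _; rfl

/-- The assignment set by `W` on the variables below `n`, and `X` on the others. -/
def override (att : ι → ℕ) (n : ℕ) (W : Finset ι) (X : ℕ → Bool) (b : ℕ) : Bool :=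
  if b < n then decide (∃ c ∈ W, att c = b) else X b

/-- The total weight of the sets of elements of attribute `a` that are nonempty if and only if `b`
is true. -/
def ownWeight (att : ι → ℕ) (w : ι → K) (a : ℕ) (b : Bool) : K :=
  ∑ W ∈ (Finset.univ.filter fun c => att c = a).powerset,
    if decide W.Nonempty = b then ∏ c ∈ W, w c else 0

/-- A set of candidates decomposes uniquely into its parts in the attribute classes, and the part in
class a alone determines the truth value of a. The sum over assignments therefore expands to a sum
over committees. -/
theorem sumOver_ownWeight (att : ι → ℕ) (w : ι → K) (h : (ℕ → Bool) → K) (n : ℕ) (X : ℕ → Bool) :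
    sumOver (ownWeight att w) h n X =
      ∑ W ∈ (Finset.univ.filter fun c => att c < n).powerset,
        (∏ c ∈ W, w c) * h (override att n W X) := by
  induction n generalizing X with
  | zero =>
    have : override att 0 ∅ X = X := by funext b; simp [override]
    simp [sumOver, this]
  | succ n ih =>
    have hdis : Disjoint (Finset.univ.filter fun c => att c < n)
        (Finset.univ.filter fun c => att c = n) := by
      rw [Finset.disjoint_filter]; intros; omega
    have hun : (Finset.univ.filter fun c => att c < n + 1) =
        (Finset.univ.filter fun c => att c < n) ∪ (Finset.univ.filter fun c => att c = n) := by
      ext c; simp only [Finset.mem_filter, Finset.mem_univ, true_and, Finset.mem_union]; omega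
    rw [hun, sum_powerset_union hdis, sumOver]
    simp only [ownWeight, Finset.sum_mul]
    rw [Finset.sum_comm]
    refine Finset.sum_congr rfl fun W₂ h₂ => ?_
    -- For a fixed part `W₂` in class n, only one truth value of n gives a nonzero term.
    rw [Finset.sum_eq_single (decide W₂.Nonempty)]
    · rw [if_pos rfl, ih, Finset.mul_sum]
      refine Finset.sum_congr rfl fun W₁ h₁ => ?_
      rw [Finset.mem_powerset] at h₁ h₂
      have hov : override att n W₁ (Function.update X n (decide W₂.Nonempty)) =
          override att (n + 1) (W₁ ∪ W₂) X := by
        funext b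
        have e1 : ∀ c ∈ W₁, att c < n := fun c hc => (Finset.mem_filter.1 (h₁ hc)).2
        have e2 : ∀ c ∈ W₂, att c = n := fun c hc => (Finset.mem_filter.1 (h₂ hc)).2
        unfold override
        rcases lt_trichotomy b n with hb | rfl | hb
        · rw [if_pos hb, if_pos (by omega), decide_eq_decide]
          constructor
          · rintro ⟨c, hc, h⟩; exact ⟨c, Finset.mem_union_left _ hc, h⟩
          · rintro ⟨c, hc, h⟩
            rcases Finset.mem_union.1 hc with hc | hc
            · exact ⟨c, hc, h⟩
            · have := e2 c hc; omega
        · rw [if_neg (by omega), if_pos (by omega), Function.update_self, decide_eq_decide]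
          constructor
          · rintro ⟨c, hc⟩; exact ⟨c, Finset.mem_union_right _ hc, e2 c hc⟩
          · rintro ⟨c, hc, h⟩
            rcases Finset.mem_union.1 hc with hc | hc
            · have := e1 c hc; omega
            · exact ⟨c, hc⟩
        · rw [if_neg (by omega), if_neg (by omega), Function.update_of_ne (by omega)]
      rw [hov, Finset.prod_union (hdis.mono h₁ h₂)]
      ring
    · intro b _ hb
      rw [if_neg (Ne.symm hb), zero_mul]
    · simp

/-- The generating function, by size, of the sets of elements of attribute `a`. -/
noncomputable def sizeSeries {A : Type} [CommSemiring A] (att : ι → ℕ) (s : ι → A) (a : ℕ) :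
    PowerSeries A :=
  ∏ c ∈ Finset.univ.filter (fun c => att c = a), (1 + PowerSeries.C (s c) * PowerSeries.X)

theorem coeff_prod_mul_X {A : Type} [CommSemiring A] (s : ι → A) (W : Finset ι) (j : ℕ) :
    PowerSeries.coeff j (∏ c ∈ W, (PowerSeries.C (s c) * PowerSeries.X)) =
      if j = W.card then ∏ c ∈ W, s c else 0 := by
  rw [Finset.prod_mul_distrib, Finset.prod_const, ← map_prod, PowerSeries.coeff_C_mul,
    PowerSeries.coeff_X_pow]
  split_ifs <;> simp

/-- A set contributes a monomial whose degree is its size, so it is nonempty exactly if the degree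
is positive. One series per attribute thus serves both truth values. -/
theorem coeff_ownWeight {A : Type} [CommSemiring A] (att : ι → ℕ) (s : ι → A) (a : ℕ) (b : Bool)
    (j : ℕ) :
    PowerSeries.coeff j (ownWeight att (fun c => PowerSeries.C (s c) * PowerSeries.X) a b) =
      if decide (1 ≤ j) = b then PowerSeries.coeff j (sizeSeries att s a) else 0 := by
  rw [ownWeight, sizeSeries, Finset.prod_one_add, map_sum, map_sum]
  have ht : ∀ W : Finset ι, PowerSeries.coeff j
      (if decide W.Nonempty = b then ∏ c ∈ W, (PowerSeries.C (s c) * PowerSeries.X) else 0) =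
      if decide (1 ≤ j) = b then
        PowerSeries.coeff j (∏ c ∈ W, (PowerSeries.C (s c) * PowerSeries.X)) else 0 := by
    intro W
    rw [apply_ite (PowerSeries.coeff j), coeff_prod_mul_X, map_zero]
    by_cases hj : j = W.card
    · subst hj
      have : (1 ≤ W.card) = W.Nonempty := propext Finset.one_le_card
      simp only [this]
    · simp [hj]
  simp_rw [ht]
  split_ifs
  · rfl
  · simp

theorem coeff_sumOver {A : Type} [CommSemiring A] (att : ι → ℕ) (s : ι → A) {n : ℕ}
    (hatt : ∀ c, att c < n) (sat : (ℕ → Bool) → Prop) [DecidablePred sat] (X : ℕ → Bool) (k : ℕ) :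
    PowerSeries.coeff k (sumOver (ownWeight att fun c => PowerSeries.C (s c) * PowerSeries.X)
      (fun X => if sat X then 1 else 0) n X) =
      ∑ W ∈ (Finset.univ : Finset (Finset ι)).filter
        (fun W => W.card = k ∧ sat (override att n W X)), ∏ c ∈ W, s c := by
  have huniv : (Finset.univ.filter fun c => att c < n) = Finset.univ := by simp [hatt]
  rw [sumOver_ownWeight, huniv, Finset.powerset_univ, map_sum, Finset.sum_filter]
  refine Finset.sum_congr rfl fun W _ => ?_
  rw [mul_ite, mul_one, mul_zero, apply_ite (PowerSeries.coeff k), coeff_prod_mul_X, map_zero]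
  by_cases h1 : sat (override att n W X) <;> by_cases h2 : W.card = k <;>
    simp [h1, h2, eq_comm (a := k)]

/-- In the min-plus semiring the coefficient is the least total cost of an admissible set of size
`k`. A profit of at least p is a cost of at most -p, whose code is 1 - 2p; this is negative because
p is positive, so the absence of admissible sets is not mistaken for a solution. -/
theorem enc_coeff_sumOver_le (att : ι → ℕ) (S : ι → ℤ) {n : ℕ}
    (hatt : ∀ c, att c < n) (sat : (ℕ → Bool) → Prop) [DecidablePred sat] (X : ℕ → Bool) (k : ℕ)
    {p : ℤ} (hp : 0 < p) :
    Cost.enc (PowerSeries.coeff k (sumOver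
      (ownWeight att fun c => PowerSeries.C (Tropical.trop ((-S c : ℤ) : WithTop ℤ) : Cost) *
        PowerSeries.X) (fun X => if sat X then 1 else 0) n X)) ≤ 1 - 2 * p ↔
      ∃ W : Finset ι, W.card = k ∧ sat (override att n W X) ∧ p ≤ ∑ c ∈ W, S c := by
  rw [coeff_sumOver att _ hatt, Cost.enc_sum_le _ _ (by omega)]
  simp only [Finset.mem_filter, Finset.mem_univ, true_and, Cost.prod_trop, Cost.enc_trop,
    Finset.sum_neg_distrib, and_assoc]
  refine exists_congr fun W => and_congr_right fun _ => and_congr_right fun _ => ?_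
  omega

end Committees

/-! ### Convolutions -/

theorem coeff_mul_mul {A : Type} [CommSemiring A] (a b c : PowerSeries A) {j N : ℕ} (hj : j < N) :
    PowerSeries.coeff j (a * b * c) = ∑ j₁ ∈ Finset.range N, ∑ j₂ ∈ Finset.range N,
      if j₁ + j₂ ≤ j then PowerSeries.coeff j₁ a * PowerSeries.coeff j₂ b *
        PowerSeries.coeff (j - j₁ - j₂) c else 0 := by
  have ext : ∀ (i : ℕ) (f : ℕ → A), i < N →
      ∑ x ∈ Finset.range (i + 1), f x = ∑ x ∈ Finset.range N, if x ≤ i then f x else 0 := by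
    intro i f hi
    rw [← Finset.sum_filter]
    refine Finset.sum_congr ?_ fun _ _ => rfl
    ext x; simp only [Finset.mem_range, Finset.mem_filter]; omega
  rw [mul_assoc, PowerSeries.coeff_mul, Finset.Nat.sum_antidiagonal_eq_sum_range_succ_mk, ext j _ hj]
  refine Finset.sum_congr rfl fun j₁ _ => ?_
  split_ifs with h
  · rw [PowerSeries.coeff_mul, Finset.Nat.sum_antidiagonal_eq_sum_range_succ_mk,
      ext (j - j₁) _ (by omega), Finset.mul_sum]
    refine Finset.sum_congr rfl fun j₂ _ => ?_
    by_cases h2 : j₂ ≤ j - j₁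
    · rw [if_pos h2, if_pos (by omega), mul_assoc]
    · rw [if_neg h2, if_neg (by omega), mul_zero]
  · symm
    refine Finset.sum_eq_zero fun j₂ _ => if_neg (by omega)

/-- Once the degree `j₁` taken from the first series is fixed, the truth value of the eliminated
variable is forced to be that of 1 ≤ j₁. The sum over `x` disappears and a single triple convolution
remains. -/
theorem coeff_sum_mul_mul {A : Type} [CommSemiring A] (d : ℕ → A) (g b c : Bool → PowerSeries A)
    (hg : ∀ x j, PowerSeries.coeff j (g x) = if decide (1 ≤ j) = x then d j else 0)
    {j N : ℕ} (hj : j < N) :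
    PowerSeries.coeff j (∑ x, g x * b x * c x) =
      ∑ j₁ ∈ Finset.range N, ∑ j₂ ∈ Finset.range N,
        if j₁ + j₂ ≤ j then d j₁ * PowerSeries.coeff j₂ (b (decide (1 ≤ j₁))) *
          PowerSeries.coeff (j - j₁ - j₂) (c (decide (1 ≤ j₁))) else 0 := by
  simp only [map_sum, coeff_mul_mul _ _ _ hj, hg]
  rw [Finset.sum_comm]
  refine Finset.sum_congr rfl fun j₁ _ => ?_
  rw [Finset.sum_comm]
  refine Finset.sum_congr rfl fun j₂ _ => ?_
  rw [Finset.sum_eq_single (decide (1 ≤ j₁))]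
  · simp
  · intro x _ hx
    simp [Ne.symm hx]
  · simp

end CECAC

/-! ## The program -/

namespace CECAC

open BoundedLoop

/-- The arrays of the program. The scalar variables are kept in cell `0`. -/
inductive Cell : Type
  | inp | row | own | tab | fin | uu | vv | act | asg | stk
  | pos | cnd | attr | j | j1 | j2 | j3 | x1 | x2 | x3 | tmp | acc
  | con | start | u | v | bx | bz | i | tok | sp | cnt | val
  | a | i1 | i2 | p | q | out
  deriving DecidableEq

namespace Cell

/-- The inverse of the enumeration of the arrays. -/
def ofIdx (n : ℕ) : Cell :=
  [inp, row, own, tab, fin, uu, vv, act, asg, stk, pos, cnd, attr, j, j1, j2, j3, x1, x2, x3, tmp,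
    acc, con, start, u, v, bx, bz, i, tok, sp, cnt, val, a, i1, i2, p, q, out].getD n inp

theorem ctorIdx_injective : Function.Injective Cell.ctorIdx :=
  Function.LeftInverse.injective (g := ofIdx) fun c => by cases c <;> rfl

end Cell

instance : Add (Ex Cell) := ⟨.add⟩
instance : Sub (Ex Cell) := ⟨.sub⟩
instance (n : ℕ) : OfNat (Ex Cell) n := ⟨.const n⟩
instance : Coe Cell (Ex Cell) := ⟨fun c => .load c (.const 0)⟩

/-- `1` if both values are equal, and `0` otherwise. -/
def eqE (e f : Ex Cell) : Ex Cell := .le e f + .le f e - 1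

/-- The index of entry `(j, x, y)` of table `i`. -/
def adr (i j x y : Ex Cell) : Ex Cell := .load .row i + (j + j + j + j) + (x + x) + y

/-- Assignment to a scalar variable. -/
def assign (c : Cell) (e : Ex Cell) : LProg Cell := .store c 0 e

infix:62 " ≔ " => assign
infixr:60 " ;; " => LProg.seq

section Eval

variable (N : ℕ) (M : Mem Cell)

@[simp] theorem eval_add (e f : Ex Cell) : (e + f).eval N M = e.eval N M + f.eval N M := (rfl)
@[simp] theorem eval_sub (e f : Ex Cell) : (e - f).eval N M = e.eval N M - f.eval N M := (rfl)
@[simp] theorem eval_two : Ex.eval N M (2 : Ex Cell) = 2 := (rfl)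
@[simp] theorem eval_three : Ex.eval N M (3 : Ex Cell) = 3 := (rfl)
@[simp] theorem eval_five : Ex.eval N M (5 : Ex Cell) = 5 := (rfl)
@[simp] theorem eval_zero : Ex.eval N M (0 : Ex Cell) = 0 := (rfl)
@[simp] theorem eval_one : Ex.eval N M (1 : Ex Cell) = 1 := (rfl)
@[simp] theorem eval_len : Ex.eval N M (.len : Ex Cell) = N := (rfl)
@[simp] theorem eval_load (c : Cell) (e : Ex Cell) :
    Ex.eval N M (.load c e) = M c (e.eval N M) := (rfl)
@[simp] theorem eval_const (z : ℤ) : Ex.eval N M (.const z) = z := (rfl)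
@[simp] theorem eval_le (e f : Ex Cell) :
    Ex.eval N M (.le e f) = if e.eval N M ≤ f.eval N M then 1 else 0 := (rfl)
@[simp] theorem eval_eqE (e f : Ex Cell) :
    Ex.eval N M (eqE e f) = if e.eval N M = f.eval N M then 1 else 0 := by
  simp only [eqE, eval_sub, eval_add, eval_le, eval_one]
  split_ifs <;> omega
@[simp] theorem exec_assign (c : Cell) (e : Ex Cell) :
    exec N (c ≔ e) M = M.write c 0 (e.eval N M) := rfl
@[simp] theorem exec_seq (P Q : LProg Cell) : exec N (P ;; Q) M = exec N Q (exec N P M) := rfl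
@[simp] theorem exec_store (c : Cell) (i e : Ex Cell) :
    exec N (.store c i e) M = M.write c (i.eval N M) (e.eval N M) := rfl
@[simp] theorem exec_skip : exec N (.skip : LProg Cell) M = M := rfl
theorem exec_ite (e : Ex Cell) (P Q : LProg Cell) :
    exec N (.ite e P Q) M = if e.eval N M ≠ 0 then exec N P M else exec N Q M := rfl

end Eval

/-- `acc` becomes the minimum of itself and the sum of `x1`, `x2`, `x3`, as encoded costs. -/
def accumulate : LProg Cell :=
  .ite Cell.x1 (.ite Cell.x2 (.ite Cell.x3
    (.tmp ≔ Cell.x1 + Cell.x2 + Cell.x3 - 2 ;;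
      .ite Cell.acc (.ite (.le Cell.tmp Cell.acc) (.acc ≔ Cell.tmp) .skip) (.acc ≔ Cell.tmp))
    .skip) .skip) .skip

/-- Entry `j` of the convolution of three series, whose entries are provided by `pre`. -/
def convolve (pre : LProg Cell) : LProg Cell :=
  .acc ≔ 0 ;;
  .rep .j1 .len (.rep .j2 .len (.ite (.le (Cell.j1 + Cell.j2) Cell.j)
    (.j3 ≔ Cell.j - Cell.j1 - Cell.j2 ;; pre ;; accumulate) .skip))

/-- The row starts are written. -/
def prepareRows : LProg Cell :=
  .rep .i .len (.store .row (Cell.i + 1) (.load .row Cell.i + (.len + .len + .len + .len)))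

/-- The series of all attributes are set to one. -/
def prepareOwn : LProg Cell :=
  .rep .a (.load .inp 1 + 1) (.store .own (adr Cell.a 0 0 0) 1)

/-- One entry of the series of `attr` is updated. -/
def addCandidateAt : LProg Cell :=
  .acc ≔ .load .own (adr Cell.attr (.len - 1 - Cell.j) 0 0) ;;
  .x2 ≔ .load .own (adr Cell.attr (.len - 1 - Cell.j - 1) 0 0) ;;
  .x3 ≔ 1 ;; accumulate ;;
  .store .own (adr Cell.attr (.len - 1 - Cell.j) 0 0) Cell.acc

/-- The series of `attr` is multiplied by one plus the monomial with coefficient `x1`. -/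
def addCandidate : LProg Cell := .rep .j (.len - 1) addCandidateAt

/-- The attribute of a candidate is read. -/
def readAttribute : LProg Cell :=
  .ite (.load .inp (Cell.pos + 1))
    (.attr ≔ .load .inp (Cell.pos + 2) ;; .pos ≔ Cell.pos + 3)
    (.attr ≔ .load .inp 1 ;; .pos ≔ Cell.pos + 2)

/-- A candidate is read. -/
def readCandidate : LProg Cell :=
  .x1 ≔ 1 - .load .inp Cell.pos - .load .inp Cell.pos ;; readAttribute ;; addCandidate

/-- The candidates are read. -/
def readCandidates : LProg Cell :=
  .pos ≔ 5 + .load .inp 1 ;; .rep .cnd (.load .inp 0) readCandidate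

/-- The operator `tok` is applied to the two topmost entries of the stack. -/
def applyOperator : LProg Cell :=
  .sp ≔ Cell.sp - 1 ;;
  -- On values 0 and 1, a conjunction asks for a sum of at least 2 and a disjunction for at least 1;
  -- with the tokens 0 and 1 the threshold is 2 - `tok`.
  .store .stk (Cell.sp - 1) (.le (2 - Cell.tok) (.load .stk (Cell.sp - 1) + .load .stk Cell.sp))

/-- The attribute of the literal `tok` is determined. -/
def literalAttr : LProg Cell :=
  .ite (.le 0 Cell.tok) (.attr ≔ Cell.tok - 2) (.attr ≔ 0 - Cell.tok - 2)

/-- The value of an attribute is determined. -/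
def literalVal : LProg Cell :=
  .ite (eqE Cell.attr Cell.u) (.val ≔ Cell.bx) (.val ≔ Cell.bz ;; .v ≔ Cell.attr)

/-- The value is negated if the literal `tok` is negative. -/
def literalSign : LProg Cell := .ite (.le 0 Cell.tok) .skip (.val ≔ 1 - Cell.val)

/-- The value of the literal `tok` is put on the stack. -/
def pushLiteral : LProg Cell :=
  literalAttr ;; literalVal ;; literalSign ;; .store .stk Cell.sp Cell.val ;; .sp ≔ Cell.sp + 1

/-- A token is read, and the stack is updated. -/
def readToken : LProg Cell :=
  .tok ≔ .load .inp Cell.pos ;; .pos ≔ Cell.pos + 1 ;;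
  .ite (.le 2 (.le 0 Cell.tok + .le Cell.tok 1)) applyOperator pushLiteral

/-- A side of a constraint is evaluated. -/
def readFormula : LProg Cell :=
  .cnt ≔ .load .inp Cell.pos ;; .pos ≔ Cell.pos + 1 ;; .rep .i Cell.cnt readToken

/-- A constraint is evaluated under an assignment of `bx` to `u` and `bz` to all other variables. -/
def evalConstraint : LProg Cell :=
  .pos ≔ Cell.start ;; .v ≔ Cell.u ;; .sp ≔ 0 ;; readFormula ;; readFormula ;;
  -- The two sides have left their values in cells 0 and 1 of the stack, and implication between
  -- values 0 and 1 is the order.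
  .store .tab (adr Cell.con 0 Cell.bx Cell.bz) (.le (.load .stk 0) (.load .stk 1))

/-- The first attribute of a constraint is read. -/
def readFirst : LProg Cell :=
  -- The cell at `pos` holds the number of tokens. The next one holds the first token, which in
  -- postfix notation is a literal.
  .ite (.le 0 (.load .inp (Cell.pos + 1))) (.u ≔ .load .inp (Cell.pos + 1) - 2)
    (.u ≔ 0 - .load .inp (Cell.pos + 1) - 2)

/-- A constraint is read, and becomes an active factor. -/
def readConstraint : LProg Cell :=
  .start ≔ Cell.pos ;; readFirst ;;
  .rep .bx 2 (.rep .bz 2 evalConstraint) ;;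
  .store .uu Cell.con Cell.u ;; .store .vv Cell.con Cell.v ;; .store .act Cell.con 1

/-- The constraints are read. -/
def readConstraints : LProg Cell := .rep .con (.load .inp 2) readConstraint

/-- The last table becomes that of a neutral factor. -/
def neutral : LProg Cell :=
  .rep .bx 2 (.rep .bz 2 (.store .tab (adr (.len - 1) 0 Cell.bx Cell.bz) 1))

/-- The active factors that depend on `a` are found. -/
def scan : LProg Cell :=
  .i1 ≔ .len - 1 ;; .i2 ≔ .len - 1 ;;
  .store .uu (.len - 1) Cell.a ;; .store .vv (.len - 1) Cell.a ;;
  .rep .i (.len - 1)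
    (.ite (.le 2 (.load .act Cell.i +
        .le 1 (eqE (.load .uu Cell.i) Cell.a + eqE (.load .vv Cell.i) Cell.a)))
      (.ite (eqE Cell.i1 (.len - 1)) (.i1 ≔ Cell.i) (.i2 ≔ Cell.i)) .skip)

/-- The values of the variables on which the multiplied factors depend are written. -/
def assignVars : LProg Cell :=
  -- Later writes prevail, so if variables coincide then `a` has priority over `q`, and `q` over
  -- `p`, as in `Factors.pick`.
  .store .asg Cell.p Cell.bx ;; .store .asg Cell.q Cell.bz ;; .store .asg Cell.a (.le 1 Cell.j1)

/-- The entries of the tables that are multiplied when `a` is eliminated. -/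
def fetch : LProg Cell :=
  assignVars ;;
  .x1 ≔ .load .own (adr Cell.a Cell.j1 0 0) ;;
  .x2 ≔ .load .tab (adr Cell.i1 Cell.j2 (.load .asg (.load .uu Cell.i1))
    (.load .asg (.load .vv Cell.i1))) ;;
  .x3 ≔ .load .tab (adr Cell.i2 Cell.j3 (.load .asg (.load .uu Cell.i2))
    (.load .asg (.load .vv Cell.i2)))

/-- The table of the new factor is computed. -/
def join : LProg Cell :=
  .rep .bx 2 (.rep .bz 2 (.rep .j .len
    (convolve fetch ;; .store .tab (adr Cell.out Cell.j Cell.bx Cell.bz) Cell.acc)))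

/-- Two factors are replaced by a new one. -/
def replaceFactors : LProg Cell :=
  .store .act Cell.i1 0 ;; .store .act Cell.i2 0 ;; .store .act Cell.out 1 ;;
  .store .uu Cell.out Cell.p ;; .store .vv Cell.out Cell.q

/-- The variable `a` is eliminated. -/
def eliminateVar : LProg Cell :=
  scan ;;
  .p ≔ .load .uu Cell.i1 + .load .vv Cell.i1 - Cell.a ;;
  .q ≔ .load .uu Cell.i2 + .load .vv Cell.i2 - Cell.a ;;
  -- This index is fresh: it follows those of the constraints and of the factors made for smaller
  -- variables.
  .out ≔ .load .inp 2 + Cell.a ;; join ;; replaceFactors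

/-- All variables are eliminated. -/
def eliminateAll : LProg Cell := .rep .a (.load .inp 1 + 1) eliminateVar

/-- The entries that `multiply` multiplies. -/
def multiplyFetch : LProg Cell :=
  .x1 ≔ .load .fin (adr Cell.i Cell.j1 0 0) ;;
  .x2 ≔ .load .tab (adr Cell.i1 Cell.j2 0 0) ;; .x3 ≔ .le Cell.j3 0

/-- One entry of the next product is computed. -/
def multiplyEntry : LProg Cell :=
  convolve multiplyFetch ;; .store .fin (adr (Cell.i + 1) Cell.j 0 0) Cell.acc

/-- The factor with which `multiply` multiplies is selected. -/
def multiplySelect : LProg Cell :=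
  .i1 ≔ .len - 1 ;; .ite (.load .act Cell.i) (.i1 ≔ Cell.i) .skip

/-- The active factors are multiplied. -/
def multiply : LProg Cell :=
  .store .fin 0 1 ;; .rep .i .len (multiplySelect ;; .rep .j .len multiplyEntry)

/-- The profit is compared with the bound. -/
def answer : LProg Cell :=
  .store .inp 0 (.le (.load .fin (adr .len (.load .inp 3) 0 0))
    (1 - .load .inp 4 - .load .inp 4))

/-- The program for elections with at most one attribute per candidate. -/
def program : LProg Cell :=
  prepareRows ;; prepareOwn ;; readCandidates ;; readConstraints ;; neutral ;; eliminateAll ;;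
    multiply ;; answer

/-! ### Arithmetic of costs -/

theorem exec_accumulate {N : ℕ} {M : Mem Cell} {s x y z : Cost} (hs : M .acc 0 = s.enc)
    (hx : M .x1 0 = x.enc) (hy : M .x2 0 = y.enc) (hz : M .x3 0 = z.enc) :
    exec N accumulate M .acc 0 = (s + x * y * z).enc := by
  -- By parity, the code of a product of finite costs never vanishes, so it is not mistaken for the
  -- infinite cost in the case distinctions.
  have h : ∀ e : Cost, e.enc = 0 ∨ e.enc % 2 = 1 := by
    intro e
    rcases Cost.eq_zero_or_trop e with rfl | ⟨v, rfl⟩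
    · exact .inl rfl
    · rw [Cost.enc_trop]; omega
  have h0 := h s; have h1 := h x; have h2 := h y; have h3 := h z
  rw [Cost.enc_add, Cost.enc_mul, Cost.enc_mul]
  by_cases g1 : x.enc = 0
  · simp [accumulate, exec_ite, g1, hs, hx]
  by_cases g2 : y.enc = 0
  · simp [accumulate, exec_ite, g1, g2, hs, hx, hy]
  by_cases g3 : z.enc = 0
  · simp [accumulate, exec_ite, g1, g2, g3, hs, hx, hy, hz]
  have e1 : x.enc + y.enc - 1 ≠ 0 := by omega
  have e2 : x.enc + y.enc - 1 + z.enc - 1 ≠ 0 := by omega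
  by_cases g0 : s.enc = 0
  · simp [accumulate, exec_ite, g1, g2, g3, g0, hs, hx, hy, hz, Mem.write, e1]
    ring
  by_cases g4 : x.enc + y.enc + z.enc - 2 ≤ s.enc
  · simp [accumulate, exec_ite, g1, g2, g3, g0, hs, hx, hy, hz, Mem.write, e1, e2, g4]
    omega
  · simp [accumulate, exec_ite, g1, g2, g3, g0, hs, hx, hy, hz, Mem.write, e1, e2, g4]
    omega

/-- The second and third series may depend on `j₁`, because during an elimination the degree taken
from the class series fixes the value of the eliminated variable. The hypothesis on `pre` is
required only for memories that agree with `M₀` outside the written arrays, which is all that the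
two nested invariants preserve. -/
theorem exec_convolve {N : ℕ} {pre : LProg Cell} {M₀ : Mem Cell} {j : ℕ}
    (hj : M₀ .j 0 = j) (hw : ∀ c ∈ [Cell.j, .j1, .j2, .acc], pre.writes c = false)
    (α : ℕ → Cost) (β γ : ℕ → ℕ → Cost)
    (hpre : ∀ j₁ < N, ∀ j₂ < N, j₁ + j₂ ≤ j → ∀ M : Mem Cell,
      (∀ c, (convolve pre).writes c = false → M c = M₀ c) →
      M .j1 0 = j₁ → M .j2 0 = j₂ → M .j3 0 = (j - j₁ - j₂ : ℕ) →
      exec N pre M .x1 0 = (α j₁).enc ∧ exec N pre M .x2 0 = (β j₁ j₂).enc ∧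
        exec N pre M .x3 0 = (γ j₁ (j - j₁ - j₂)).enc) :
    exec N (convolve pre) M₀ .acc 0 = Cost.enc (∑ j₁ ∈ Finset.range N, ∑ j₂ ∈ Finset.range N,
      if j₁ + j₂ ≤ j then α j₁ * β j₁ j₂ * γ j₁ (j - j₁ - j₂) else 0) := by
  have hwj := hw .j (by simp)
  have hw1 := hw .j1 (by simp)
  have hw2 := hw .j2 (by simp)
  have hwa := hw .acc (by simp)
  have hfr : ∀ c, (convolve pre).writes c = false →
      c ≠ .acc ∧ c ≠ .j1 ∧ c ≠ .j2 ∧ c ≠ .j3 ∧ pre.writes c = false ∧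
        accumulate.writes c = false := by
    intro c hc
    simp only [convolve, assign, LProg.writes, Bool.or_eq_false_iff, decide_eq_false_iff_not] at hc
    tauto
  have hjw : (convolve pre).writes .j = false := by
    simp [convolve, assign, accumulate, LProg.writes, hwj]
  rw [convolve, exec_seq]
  set f : ℕ → ℕ → Cost := fun j₁ j₂ =>
    if j₁ + j₂ ≤ j then α j₁ * β j₁ j₂ * γ j₁ (j - j₁ - j₂) else 0 with hf
  have base : ∀ c, (convolve pre).writes c = false → exec N (.acc ≔ 0) M₀ c = M₀ c :=
    fun c hc => by rw [exec_assign, write_of_ne _ (hfr c hc).1]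
  refine rep_induction (n := N) (by simp) le_rfl
    (fun (k : ℕ) (M : Mem Cell) => M .acc 0 = Cost.enc (∑ j₁ ∈ Finset.range k, ∑ j₂ ∈ Finset.range N, f j₁ j₂))
    (by simp [Mem.write, Cost.enc_zero]) ?_
  intro j₁ hj₁ M₁ hM₁ inv₁
  rw [Finset.sum_range_succ]
  have out₁ : ∀ c, (convolve pre).writes c = false → M₁ c = M₀ c := by
    intro c hc
    rw [hM₁ c ?_, base c hc]
    have := hfr c hc
    simp [LProg.writes, assign, this]
  refine rep_induction (n := N) (by simp) le_rfl
    (fun (k : ℕ) (M : Mem Cell) => M .acc 0 = Cost.enc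
      (∑ j₁ ∈ Finset.range j₁, ∑ j₂ ∈ Finset.range N, f j₁ j₂ + ∑ j₂ ∈ Finset.range k, f j₁ j₂))
    (by simpa [Mem.write] using inv₁) ?_
  intro j₂ hj₂ M₂ hM₂ inv₂
  have out₂ : ∀ c, (convolve pre).writes c = false → M₂ c = M₀ c := by
    intro c hc
    have := hfr c hc
    rw [hM₂ c (by simp [LProg.writes, assign, this]), write_of_ne _ this.2.1, out₁ c hc]
  have e1 : M₂ .j1 0 = j₁ := by
    rw [hM₂ .j1 (by simp [LProg.writes, assign, accumulate, hw1])]; simp [Mem.write]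
  have e0 : M₂ .j 0 = j := by rw [out₂ _ hjw, hj]
  rw [Finset.sum_range_succ, ← add_assoc]
  set M₃ := M₂.write .j2 0 j₂ with hM₃
  have acc₃ : M₃ .acc 0 = M₂ .acc 0 := by simp [hM₃, Mem.write]
  rw [exec_ite]
  have hcond : Ex.eval N M₃ (.le (Cell.j1 + Cell.j2) Cell.j) = if j₁ + j₂ ≤ j then 1 else 0 := by
    have g0 : M₃ .j 0 = j := by simpa [hM₃, Mem.write] using e0
    have g1 : M₃ .j1 0 = j₁ := by simpa [hM₃, Mem.write] using e1
    have g2 : M₃ .j2 0 = j₂ := by simp [hM₃, Mem.write]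
    simp only [eval_le, eval_add, eval_load, eval_const, g0, g1, g2]
    split_ifs <;> omega
  rw [hcond]
  by_cases hle : j₁ + j₂ ≤ j
  · rw [if_pos hle, if_pos (by norm_num), exec_seq, exec_seq]
    set M₄ := exec N (.j3 ≔ Cell.j - Cell.j1 - Cell.j2) M₃ with hM₄
    have h4 : ∀ c, c ≠ .j2 → c ≠ .j3 → M₄ c = M₂ c := by
      intro c h1 h2
      rw [hM₄, exec_assign, write_of_ne _ h2, hM₃, write_of_ne _ h1]
    obtain ⟨r1, r2, r3⟩ := hpre j₁ hj₁ j₂ hj₂ hle M₄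
      (fun c hc => by rw [h4 c (hfr c hc).2.2.1 (hfr c hc).2.2.2.1, out₂ c hc])
      (by rw [h4 _ (by simp) (by simp), e1])
      (by simp [hM₄, hM₃, Mem.write])
      (by
        simp only [hM₄, hM₃, exec_assign, Mem.write, eval_sub, eval_load, eval_const]
        simp [e1, e0]; omega)
    rw [exec_accumulate (s := _) (x := _) (y := _) (z := _) (by
      rw [exec_of_not_writes _ _ _ _ hwa, h4 _ (by simp) (by simp)]; exact inv₂) r1 r2 r3]
    simp only [hf, if_pos hle]
  · rw [if_neg hle, if_neg (by norm_num), exec_skip, acc₃, inv₂]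
    simp only [hf, if_neg hle, add_zero]

/-! ### Addresses -/

/-- Truth values as integers. -/
def bit (b : Bool) : ℤ := if b then 1 else 0

theorem bit_nonneg (b : Bool) : 0 ≤ bit b := by cases b <;> simp [bit]

theorem bit_le_one (b : Bool) : bit b ≤ 1 := by cases b <;> simp [bit]

theorem bit_inj {x y : Bool} : bit x = bit y ↔ x = y := by cases x <;> cases y <;> simp [bit]

/-- The index of entry `(j, x, y)` of table `i`. -/
def addr (N i j : ℕ) (x y : Bool) : ℤ := 4 * N * i + 4 * j + 2 * bit x + bit y

/-- The part 4j + 2x + y is less than 4N when j < N, so tables with different numbers occupy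
disjoint blocks, and within a block x and y are the two lowest binary digits. -/
theorem addr_inj {N i i' j j' : ℕ} {x x' y y' : Bool} (hj : j < N) (hj' : j' < N) :
    addr N i j x y = addr N i' j' x' y' ↔ i = i' ∧ j = j' ∧ x = x' ∧ y = y' := by
  constructor
  · intro h
    have b1 := bit_nonneg x; have b2 := bit_nonneg y; have b3 := bit_nonneg x'
    have b4 := bit_nonneg y'
    have c1 := bit_le_one x; have c2 := bit_le_one y; have c3 := bit_le_one x'
    have c4 := bit_le_one y'
    unfold addr at h
    have hi : i = i' := by
      rcases lt_trichotomy i i' with hlt | heq | hlt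
      · have : (4 * N * (i + 1) : ℤ) ≤ 4 * N * i' := by
          have : ((i + 1 : ℕ) : ℤ) ≤ i' := by exact_mod_cast hlt
          push_cast at this
          nlinarith
        nlinarith
      · exact heq
      · have : (4 * N * (i' + 1) : ℤ) ≤ 4 * N * i := by
          have : ((i' + 1 : ℕ) : ℤ) ≤ i := by exact_mod_cast hlt
          push_cast at this
          nlinarith
        nlinarith
    subst hi
    refine ⟨rfl, by omega, bit_inj.1 (by omega), bit_inj.1 (by omega)⟩
  · rintro ⟨rfl, rfl, rfl, rfl⟩; rfl

/-- The rows of the tables start at the multiples of `4 * N`. -/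
def Rows (N : ℕ) (M : Mem Cell) : Prop := ∀ i ≤ N, M .row i = 4 * N * i

theorem eval_adr {N : ℕ} {M : Mem Cell} (h : Rows N M) {i j x y : Ex Cell} {i' j' : ℕ}
    {x' y' : Bool} (hi : i.eval N M = i') (hi' : i' ≤ N) (hj : j.eval N M = j')
    (hx : x.eval N M = bit x') (hy : y.eval N M = bit y') :
    (adr i j x y).eval N M = addr N i' j' x' y' := by
  simp only [adr, eval_add, eval_load, hi, hj, hx, hy, h i' hi', addr]
  ring

theorem eval_adr_zero {N : ℕ} {M : Mem Cell} (h : Rows N M) {i j : Ex Cell} {i' j' : ℕ}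
    (hi : i.eval N M = i') (hi' : i' ≤ N) (hj : j.eval N M = j') :
    (adr i j 0 0).eval N M = addr N i' j' false false :=
  eval_adr h hi hi' hj rfl rfl

theorem Rows.congr {N : ℕ} {M M' : Mem Cell} (h : Rows N M) (hM : M' .row = M .row) :
    Rows N M' := fun i hi => by rw [hM]; exact h i hi

/-- The series of the attributes up to `l`. -/
def Own (N l : ℕ) (M : Mem Cell) (d : ℕ → PowerSeries Cost) : Prop :=
  ∀ a ≤ l, ∀ j < N, M .own (addr N a j false false) = (PowerSeries.coeff j (d a)).enc

theorem Own.congr {N l : ℕ} {M M' : Mem Cell} {d : ℕ → PowerSeries Cost} (h : Own N l M d)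
    (hM : M' .own = M .own) : Own N l M' d := fun a ha j hj => by rw [hM]; exact h a ha j hj

theorem exec_prepareRows {N : ℕ} {M₀ : Mem Cell} (h0 : M₀ .row 0 = 0) :
    Rows N (exec N prepareRows M₀) := by
  refine rep_induction (n := N) (by simp) le_rfl
    (fun (k : ℕ) (M : Mem Cell) => ∀ i ≤ k, M .row i = 4 * N * i) ?_ ?_
  · intro i hi
    obtain rfl : i = 0 := by omega
    simp [h0]
  · intro k _ M _ inv i hi
    by_cases hik : i = k + 1
    · subst hik
      simp [Mem.write, inv k le_rfl]
      ring
    · have : ¬ ((i : ℤ) = (k : ℤ) + 1) := by omega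
      simp [Mem.write, this, inv i (by omega)]

theorem exec_prepareOwn {N l : ℕ} {M₀ : Mem Cell} (hl : M₀ .inp 1 = l) (hlN : l + 1 ≤ N)
    (hrow : Rows N M₀) (h0 : M₀ .own = 0) : Own N l (exec N prepareOwn M₀) 1 := by
  have := rep_induction (N := N) (v := .a) (e := .load .inp 1 + 1)
    (P := .store .own (adr Cell.a 0 0 0) 1) (M₀ := M₀) (n := l + 1) (by simp [hl]) hlN
    (fun (k : ℕ) (M : Mem Cell) => ∀ a ≤ l, ∀ j < N,
      M .own (addr N a j false false) = if a < k ∧ j = 0 then 1 else 0) ?_ ?_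
  · intro a ha j hj
    refine (this a ha j hj).trans ?_
    rw [Pi.one_apply, PowerSeries.coeff_one]
    by_cases hj0 : j = 0
    · rw [if_pos ⟨by omega, hj0⟩, if_pos hj0, Cost.enc_one]
    · rw [if_neg (by omega), if_neg hj0, Cost.enc_zero]
  · intro a _ j _
    simp [h0]
  · intro k hk M hM inv a ha j hj
    have hr : Rows N (M.write .a 0 k) :=
      hrow.congr ((write_of_ne _ (by simp) _ _).trans (hM _ rfl))
    rw [exec_store, eval_adr_zero hr (i' := k) (j' := 0) (by simp [Mem.write]) (by omega) (by simp)]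
    simp only [Mem.write, addr_inj hj (by omega : 0 < N)]
    have := inv a ha j hj
    by_cases h : a = k ∧ j = 0
    · simp [h]
    · have e : (a < k + 1 ∧ j = 0) ↔ (a < k ∧ j = 0) := by omega
      simp only [e]
      simp [h, this]

/-! ### Candidates -/

theorem coeff_mul_one_add {A : Type} [CommSemiring A] (d : PowerSeries A) (s : A) (j : ℕ) :
    PowerSeries.coeff (j + 1) (d * (1 + PowerSeries.C s * PowerSeries.X)) =
      PowerSeries.coeff (j + 1) d + s * PowerSeries.coeff j d := by
  rw [mul_add, mul_one, map_add, ← mul_assoc, PowerSeries.coeff_succ_mul_X, mul_comm d,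
    PowerSeries.coeff_C_mul]

/-- Multiplication by 1 + sX adds s times the entry of degree j to the entry of degree j + 1. Going
through the degrees downwards allows this in place, since each step reads only entries that still
have their old values. -/
theorem exec_addCandidate {N l a : ℕ} {M₀ : Mem Cell} {d : ℕ → PowerSeries Cost} {s : Cost}
    (hlN : l < N) (hrow : Rows N M₀) (hown : Own N l M₀ d) (ha : M₀ .attr 0 = a) (hal : a ≤ l)
    (hs : M₀ .x1 0 = s.enc) :
    Own N l (exec N addCandidate M₀)
      (Function.update d a (d a * (1 + PowerSeries.C s * PowerSeries.X))) := by
  set d' := d a * (1 + PowerSeries.C s * PowerSeries.X) with hd'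
  have := rep_induction (N := N) (v := .j) (e := .len - 1)
    (P := addCandidateAt) (M₀ := M₀) (n := N - 1)
    (by simp; omega) (by omega)
    -- After `k` rounds, exactly the entries of degree at least N - k have their new values.
    (fun (k : ℕ) (M : Mem Cell) => ∀ b ≤ l, ∀ j < N, M .own (addr N b j false false) =
      (PowerSeries.coeff j (if b = a ∧ N ≤ j + k then d' else d b)).enc) ?_ ?_
  · intro b hb j hj
    refine (this b hb j hj).trans ?_
    by_cases hba : b = a
    · subst hba
      rw [Function.update_self]
      -- The loop stops at degree 1; the constant coefficient is not changed by the multiplication.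
      by_cases hj0 : j = 0
      · subst hj0
        rw [if_neg (by omega), hd']
        congr 1
        simp [PowerSeries.coeff_zero_eq_constantCoeff]
      · rw [if_pos ⟨rfl, by omega⟩]
    · rw [if_neg (by tauto), Function.update_of_ne hba]
  · intro b hb j hj
    rw [hown b hb j hj, if_neg (by omega)]
  · intro k hk M hM inv b hb j hj
    set M₁ := M.write .j 0 k with hM₁
    have e1 : ∀ c ∈ [Cell.row, .attr, .x1], M₁ c = M₀ c := by
      intro c hc
      simp only [List.mem_cons, List.not_mem_nil, or_false] at hc
      rcases hc with rfl | rfl | rfl <;>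
        exact (write_of_ne _ (by simp) _ _).trans (hM _ rfl)
    have r1 : Rows N M₁ := hrow.congr (e1 _ (by simp))
    have hj1 : M₁ .j 0 = k := by simp [hM₁, Mem.write]
    have a1 : M₁ .attr 0 = a := by rw [e1 _ (by simp), ha]
    have own1 : M₁ .own = M .own := write_of_ne _ (by simp) _ _
    simp only [addCandidateAt, exec_seq]
    set M₂ := exec N (.acc ≔ .load .own (adr Cell.attr (.len - 1 - Cell.j) 0 0)) M₁ with hM₂
    have acc2 : M₂ .acc 0 = (PowerSeries.coeff (N - 1 - k) (d a)).enc := by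
      rw [hM₂, exec_assign, eval_load, eval_adr_zero r1 (i' := a) (j' := N - 1 - k)
        (by simpa using a1) (by omega) (by simp [hj1]; omega), own1, inv a hal _ (by omega),
        if_neg (by omega)]
      simp [Mem.write]
    have f2 : ∀ c ≠ Cell.acc, M₂ c = M₁ c := fun c hc => write_of_ne _ hc _ _
    have r2 : Rows N M₂ := r1.congr (f2 _ (by simp))
    set M₃ := exec N (.x2 ≔ .load .own (adr Cell.attr (.len - 1 - Cell.j - 1) 0 0)) M₂ with hM₃
    have x23 : M₃ .x2 0 = (PowerSeries.coeff (N - 1 - k - 1) (d a)).enc := by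
      rw [hM₃, exec_assign, eval_load, eval_adr_zero r2 (i' := a) (j' := N - 1 - k - 1)
        (by simpa [f2] using a1) (by omega) (by simp [f2, hj1]; omega), f2 _ (by simp), own1,
        inv a hal _ (by omega), if_neg (by omega)]
      simp [Mem.write]
    have f3 : ∀ c ≠ Cell.x2, M₃ c = M₂ c := fun c hc => write_of_ne _ hc _ _
    set M₄ := exec N (.x3 ≔ 1) M₃ with hM₄
    have f4 : ∀ c ≠ Cell.x3, M₄ c = M₃ c := fun c hc => write_of_ne _ hc _ _
    have acc5 := exec_accumulate (N := N) (M := M₄) (z := 1)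
      (by rw [f4 _ (by simp), f3 _ (by simp), acc2])
      (by rw [f4 _ (by simp), f3 _ (by simp), f2 _ (by simp), e1 _ (by simp), hs])
      (by rw [f4 _ (by simp), x23]) (by simp [hM₄, Mem.write, Cost.enc_one])
    set M₅ := exec N accumulate M₄ with hM₅
    have f5 : ∀ c, c ≠ .acc → c ≠ .x2 → c ≠ .x3 → c ≠ .tmp → M₅ c = M₁ c := by
      intro c h1 h2 h3 h4
      rw [hM₅, exec_of_not_writes _ _ _ _ (by simp [accumulate, LProg.writes, assign, h1, h4]),
        f4 _ h3, f3 _ h2, f2 _ h1]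
    rw [exec_store, eval_adr_zero (r1.congr (f5 _ (by simp) (by simp) (by simp) (by simp)))
      (i' := a) (j' := N - 1 - k) (by simpa [f5] using a1) (by omega) (by simp [f5, hj1]; omega)]
    simp only [Mem.write, addr_inj hj (by omega : N - 1 - k < N)]
    by_cases h : b = a ∧ j = N - 1 - k
    · obtain ⟨rfl, rfl⟩ := h
      have e : N - 1 - k = N - 1 - k - 1 + 1 := by omega
      rw [if_pos (by simp), if_pos ⟨rfl, by omega⟩, eval_load, eval_const, acc5, mul_one, hd', e,
        coeff_mul_one_add, Nat.add_sub_cancel]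
    · rw [if_neg (by tauto), f5 _ (by simp) (by simp) (by simp) (by simp), own1, inv b hb j hj]
      have e : (b = a ∧ N ≤ j + (k + 1)) ↔ (b = a ∧ N ≤ j + k) := by omega
      simp only [e]

/-! ### Lists in memory, and the attribute of a candidate -/

/-- The cells from `p` on hold the entries of a list. -/
def Reads (A : ℤ → ℤ) : ℤ → List ℤ → Prop
  | _, [] => True
  | p, z :: w => A p = z ∧ Reads A (p + 1) w

theorem reads_append {A : ℤ → ℤ} {p : ℤ} {w w' : List ℤ} :
    Reads A p (w ++ w') ↔ Reads A p w ∧ Reads A (p + w.length) w' := by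
  induction w generalizing p with
  | nil => simp [Reads]
  | cons z w ih =>
    simp only [List.cons_append, Reads, ih, List.length_cons, and_assoc]
    push_cast
    rw [add_assoc p 1, add_comm (1 : ℤ)]

theorem reads_start (w : List ℤ) : Reads (start Cell.inp w .inp) 0 w := by
  have key : ∀ (A : ℤ → ℤ) (w : List ℤ) (p : ℤ), (∀ i : ℕ, i < w.length → A (p + i) = w.getD i 0) →
      Reads A p w := by
    intro A w
    induction w with
    | nil => intros; trivial
    | cons z w ih =>
      intro p h
      refine ⟨by simpa using h 0 (by simp), ih _ fun i hi => ?_⟩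
      have := h (i + 1) (by simpa using hi)
      rw [List.getD_cons_succ] at this
      rw [← this]; congr 1; push_cast; ring
  refine key _ _ _ fun i _ => ?_
  have : (0 : ℤ) ≤ i := by omega
  simp [BoundedLoop.start, this]

namespace Instance

variable (I : Instance)

/-- The attribute of a candidate, and `l` if it has none. -/
def attrOf (c : Fin I.m) : ℕ :=
  if h : (I.attributes c).Nonempty then ((I.attributes c).min' h : ℕ) else I.l

theorem attrOf_lt (c : Fin I.m) : I.attrOf c < I.l + 1 := by
  unfold attrOf
  split_ifs with h
  · have := ((I.attributes c).min' h).2; omega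
  · omega

variable {I}

theorem mem_attributes_iff {c : Fin I.m} (hc : (I.attributes c).card ≤ 1) (a : Fin I.l) :
    a ∈ I.attributes c ↔ I.attrOf c = a := by
  unfold attrOf
  split_ifs with h
  · obtain ⟨b, hb⟩ := Finset.card_eq_one.1 (le_antisymm hc (Finset.card_pos.2 h))
    simp only [hb, Finset.mem_singleton, Finset.min'_singleton]
    rw [eq_comm, Fin.ext_iff]
  · rw [Finset.not_nonempty_iff_eq_empty] at h
    have := a.2
    simp only [h, Finset.notMem_empty, false_iff]; omega

theorem encodeCandidate_eq {c : Fin I.m} (hc : (I.attributes c).card ≤ 1) :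
    (I.encodeCandidate c = [I.profit c, 0] ∧ I.attrOf c = I.l) ∨
      I.encodeCandidate c = [I.profit c, 1, I.attrOf c] := by
  unfold encodeCandidate
  rcases Nat.lt_or_ge 0 (I.attributes c).card with h | h
  · obtain ⟨b, hb⟩ := Finset.card_eq_one.1 (le_antisymm hc h)
    right
    have h1 : (List.finRange I.l).filter (fun a => a ∈ I.attributes c) = [b] := by
      rw [← List.perm_singleton, List.perm_ext_iff_of_nodup ((List.nodup_finRange _).filter _)
        (List.nodup_singleton _)]
      simp [hb]
    have h2 : I.attrOf c = b := (mem_attributes_iff hc b).1 (by simp [hb])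
    rw [h1, h2, hb]; simp
  · have h0 : I.attributes c = ∅ := Finset.card_eq_zero.1 (by omega)
    left
    refine ⟨by simp [h0], by simp [attrOf, h0]⟩

/-- The cost of a candidate. -/
def cost (I : Instance) (c : Fin I.m) : Cost := Tropical.trop ((-I.profit c : ℤ) : WithTop ℤ)

end Instance

theorem exec_readCandidates {N : ℕ} {M₀ : Mem Cell} {I : Instance} {w : List ℤ}
    (hcard : ∀ c, (I.attributes c).card ≤ 1) (hlN : I.l < N) (hmN : I.m ≤ N)
    (hm : M₀ .inp 0 = I.m) (hl : M₀ .inp 1 = I.l) (hrow : Rows N M₀) (hown : Own N I.l M₀ 1)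
    (hreads : Reads (M₀ .inp) (5 + I.l) ((List.finRange I.m).flatMap I.encodeCandidate ++ w)) :
    Own N I.l (exec N readCandidates M₀) (sizeSeries I.attrOf I.cost) ∧
      Reads (M₀ .inp) (exec N readCandidates M₀ .pos 0) w := by
  -- The invariant: after `k` candidates, the series of a class is the product over its members
  -- among them.
  set part : ℕ → ℕ → PowerSeries Cost := fun k a =>
    ∏ c ∈ Finset.univ.filter (fun c : Fin I.m => c.val < k ∧ I.attrOf c = a),
      (1 + PowerSeries.C (I.cost c) * PowerSeries.X) with hpart
  rw [readCandidates, exec_seq]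
  set M₁ := exec N (.pos ≔ 5 + .load .inp 1) M₀ with hM₁
  have f1 : ∀ c ≠ Cell.pos, M₁ c = M₀ c := fun c hc => write_of_ne _ hc _ _
  have := rep_induction (N := N) (v := .cnd) (e := .load .inp 0)
    (P := readCandidate) (M₀ := M₁) (n := I.m)
    (by simp [f1, hm]) hmN
    (fun (k : ℕ) (M : Mem Cell) => Own N I.l M (part k) ∧ Reads (M₀ .inp) (M .pos 0)
      (((List.finRange I.m).drop k).flatMap I.encodeCandidate ++ w)) ?_ ?_
  · obtain ⟨h1, h2⟩ := this
    refine ⟨?_, ?_⟩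
    · convert h1 using 1
      funext a
      simp [hpart, sizeSeries]
    · simpa [List.drop_eq_nil_of_le] using h2
  · refine ⟨?_, ?_⟩
    · have : part 0 = 1 := by funext a; simp [hpart]
      rw [this]; exact hown.congr (f1 _ (by simp))
    · have : M₁ .pos 0 = 5 + I.l := by simp [hM₁, Mem.write, hl]
      rw [this]; exact hreads
  · rintro k hk M hM ⟨inv1, inv2⟩
    have hd : (List.finRange I.m).drop k = ⟨k, hk⟩ :: (List.finRange I.m).drop (k + 1) := by
      rw [List.drop_eq_getElem_cons (by simpa using hk)]; simp
    set c : Fin I.m := ⟨k, hk⟩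
    rw [hd, List.flatMap_cons, List.append_assoc, reads_append] at inv2
    -- The classes are disjoint, so the next candidate changes one series only.
    have hpk : part (k + 1) = Function.update (part k) (I.attrOf c)
        (part k (I.attrOf c) * (1 + PowerSeries.C (I.cost c) * PowerSeries.X)) := by
      funext a
      by_cases ha : a = I.attrOf c
      · subst ha
        rw [Function.update_self, mul_comm]
        have e : Finset.univ.filter (fun c' : Fin I.m => c'.val < k + 1 ∧ I.attrOf c' = I.attrOf c) =
            insert c (Finset.univ.filter fun c' : Fin I.m => c'.val < k ∧ I.attrOf c' = I.attrOf c) := by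
          ext c'
          simp only [Finset.mem_filter, Finset.mem_univ, true_and, Finset.mem_insert]
          constructor
          · intro h
            by_cases e : c'.val = k
            · exact .inl (Fin.ext e)
            · exact .inr ⟨by omega, h.2⟩
          · rintro (h | h)
            · subst h; simp [c]
            · exact ⟨by omega, h.2⟩
        simp only [hpart]
        rw [e, Finset.prod_insert (by simp [c])]
      · rw [Function.update_of_ne ha]
        simp only [hpart]
        congr 1
        ext c'
        simp only [Finset.mem_filter, Finset.mem_univ, true_and]
        constructor
        · rintro ⟨h1, h2⟩
          refine ⟨?_, h2⟩
          by_contra h3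
          have : c' = c := Fin.ext (by simp only [c]; omega)
          rw [this] at h2
          exact ha h2.symm
        · rintro ⟨h1, h2⟩
          exact ⟨by omega, h2⟩
    rw [hpk]
    set M₂ := M.write .cnd 0 k with hM₂
    have inp2 : M₂ .inp = M₀ .inp := by
      rw [hM₂, write_of_ne _ (by simp), hM _ rfl, f1 _ (by simp)]
    have row2 : M₂ .row = M₀ .row := by
      rw [hM₂, write_of_ne _ (by simp), hM _ rfl, f1 _ (by simp)]
    have own2 : M₂ .own = M .own := by rw [hM₂, write_of_ne _ (by simp)]
    have pos2 : M₂ .pos 0 = M .pos 0 := by rw [hM₂, write_of_ne _ (by simp)]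
    rw [readCandidate, exec_seq, exec_seq]
    set M₃ := exec N (.x1 ≔ 1 - .load .inp Cell.pos - .load .inp Cell.pos) M₂ with hM₃
    have f3 : ∀ c ≠ Cell.x1, M₃ c = M₂ c := fun c hc => write_of_ne _ hc _ _
    set M₄ := exec N readAttribute M₃ with hM₄
    have f4 : ∀ c, c ≠ .attr → c ≠ .pos → M₄ c = M₃ c := fun c h1 h2 =>
      exec_of_not_writes _ _ _ _ (by simp [readAttribute, LProg.writes, assign, h1, h2])
    have hprofit : M₀ .inp (M .pos 0) = I.profit c := by
      rcases I.encodeCandidate_eq (hcard c) with ⟨h, -⟩ | h <;> rw [h] at inv2 <;> exact inv2.1.1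
    have h4 : M₄ .attr 0 = I.attrOf c ∧
        M₄ .pos 0 = M .pos 0 + (I.encodeCandidate c).length := by
      rcases I.encodeCandidate_eq (hcard c) with ⟨h, h'⟩ | h
      · rw [h] at inv2 ⊢
        have e := inv2.1.2.1
        simp [hM₄, readAttribute, exec_ite, f3, inp2, pos2, e, Mem.write, hl, h']
      · rw [h] at inv2 ⊢
        have e := inv2.1.2.1
        have e' := inv2.1.2.2.1
        rw [add_assoc] at e'
        norm_num at e'
        simp [hM₄, readAttribute, exec_ite, f3, inp2, pos2, e, e', Mem.write]
    refine ⟨?_, ?_⟩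
    · refine exec_addCandidate hlN (hrow.congr ?_) (inv1.congr ?_) h4.1
        (Nat.lt_succ_iff.1 (I.attrOf_lt c)) ?_
      · rw [f4 _ (by simp) (by simp), f3 _ (by simp), row2]
      · rw [f4 _ (by simp) (by simp), f3 _ (by simp), own2]
      · rw [f4 _ (by simp) (by simp), hM₃, Instance.cost, Cost.enc_trop]
        simp [Mem.write, inp2, pos2, hprofit]
        ring
    · rw [exec_of_not_writes _ .pos addCandidate _ rfl, h4.2]
      exact inv2.2

/-! ### Formulas -/

namespace Formula

variable {l : ℕ}

/-- The truth value under a Boolean assignment. -/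
def test (X : ℕ → Bool) : Formula (Fin l) → Bool
  | lit positive a => if positive then X a else !X a
  | and f g => f.test X && g.test X
  | or f g => f.test X || g.test X

theorem test_iff (X : ℕ → Bool) (f : Formula (Fin l)) :
    f.test X = true ↔ f.Holds fun a : Fin l => X a = true := by
  induction f with
  | lit p a => cases p <;> simp [test, Holds]
  | and f g hf hg => simp [test, Holds, hf, hg]
  | or f g hf hg => simp [test, Holds, hf, hg]

theorem test_congr {X Y : ℕ → Bool} (f : Formula (Fin l)) (h : ∀ a ∈ f.attrs, X a = Y a) :
    f.test X = f.test Y := by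
  induction f with
  | lit p a => simp [test, h a (by simp [attrs])]
  | and f g hf hg =>
    rw [test, test, hf fun a ha => h a (by simp [attrs, ha]),
      hg fun a ha => h a (by simp [attrs, ha])]
  | or f g hf hg =>
    rw [test, test, hf fun a ha => h a (by simp [attrs, ha]),
      hg fun a ha => h a (by simp [attrs, ha])]

/-- The attribute of the first literal. -/
def first : Formula (Fin l) → Fin l
  | lit _ a => a
  | and f _ => f.first
  | or f _ => f.first

theorem first_mem (f : Formula (Fin l)) : f.first ∈ f.attrs := by
  induction f with
  | lit p a => simp [first, attrs]
  | and f g hf _ => simp [first, attrs, hf]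
  | or f g hf _ => simp [first, attrs, hf]

/-- The attribute other than `u` that occurs last, and `v` if there is none. -/
def last (u v : ℕ) : Formula (Fin l) → ℕ
  | lit _ a => if (a : ℕ) = u then v else a
  | and f g => g.last u (f.last u v)
  | or f g => g.last u (f.last u v)

/-- The second and third parts say that the recorded attribute differs from `u` as soon as some
attribute other than `u` has been met, and from then on. This is what makes it a correct second
attribute when two formulas are read in turn. -/
theorem last_spec (u v : ℕ) (f : Formula (Fin l)) :
    (f.last u v = v ∨ ∃ a ∈ f.attrs, f.last u v = a) ∧
      (∀ a ∈ f.attrs, (a : ℕ) ≠ u → f.last u v ≠ u) ∧ (v ≠ u → f.last u v ≠ u) := by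
  induction f generalizing v with
  | lit p a => simp only [last, attrs, Finset.mem_singleton]; split_ifs with h <;> simp_all
  | and f g hf hg =>
    obtain ⟨h1, h2, h3⟩ := hf v
    obtain ⟨h4, h5, h6⟩ := hg (f.last u v)
    simp only [last, attrs, Finset.mem_union]
    refine ⟨?_, ?_, fun h => h6 (h3 h)⟩
    · rcases h4 with h4 | ⟨a, ha, h⟩
      · rw [h4]
        rcases h1 with h1 | ⟨a, ha, h⟩
        · exact .inl h1
        · exact .inr ⟨a, .inl ha, h⟩
      · exact .inr ⟨a, .inr ha, h⟩
    · rintro a (ha | ha) hau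
      · exact h6 (h2 a ha hau)
      · exact h5 a ha hau
  | or f g hf hg =>
    obtain ⟨h1, h2, h3⟩ := hf v
    obtain ⟨h4, h5, h6⟩ := hg (f.last u v)
    simp only [last, attrs, Finset.mem_union]
    refine ⟨?_, ?_, fun h => h6 (h3 h)⟩
    · rcases h4 with h4 | ⟨a, ha, h⟩
      · rw [h4]
        rcases h1 with h1 | ⟨a, ha, h⟩
        · exact .inl h1
        · exact .inr ⟨a, .inl ha, h⟩
      · exact .inr ⟨a, .inr ha, h⟩
    · rintro a (ha | ha) hau
      · exact h6 (h2 a ha hau)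
      · exact h5 a ha hau

theorem tokens_eq_cons (f : Formula (Fin l)) :
    ∃ w, f.tokens = ((f.first : ℕ) + 2 : ℤ) :: w ∨ f.tokens = (-((f.first : ℕ) + 2) : ℤ) :: w := by
  induction f with
  | lit p a => cases p <;> simp [tokens, first]
  | and f g hf _ =>
    obtain ⟨w, h | h⟩ := hf <;> simp [tokens, first, h]
  | or f g hf _ =>
    obtain ⟨w, h | h⟩ := hf <;> simp [tokens, first, h]

end Formula

/-! ### Constraints with at most two attributes -/

/-- The assignment of `x` to `u`, and of `y` to all other variables. -/
def pair (u : ℕ) (x y : Bool) (a : ℕ) : Bool := if a = u then x else y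

namespace Constraint

variable {l : ℕ}

/-- The truth value under a Boolean assignment. -/
def test (r : Constraint (Fin l)) (X : ℕ → Bool) : Bool := !r.lhs.test X || r.rhs.test X

theorem test_iff (X : ℕ → Bool) (r : Constraint (Fin l)) :
    r.test X = true ↔ r.Holds fun a : Fin l => X a = true := by
  rw [Holds, ← Formula.test_iff, ← Formula.test_iff, test]
  cases r.lhs.test X <;> simp

/-- The attribute of the first literal. -/
def first (r : Constraint (Fin l)) : ℕ := r.lhs.first

/-- An attribute other than the first one, if there is one. -/
def second (r : Constraint (Fin l)) : ℕ := r.rhs.last r.first (r.lhs.last r.first r.first)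

theorem first_mem (r : Constraint (Fin l)) : ∃ a ∈ r.attrs, (a : ℕ) = r.first :=
  ⟨_, Finset.mem_union_left _ r.lhs.first_mem, rfl⟩

theorem second_mem (r : Constraint (Fin l)) : ∃ a ∈ r.attrs, (a : ℕ) = r.second := by
  obtain ⟨h1, -, -⟩ := r.lhs.last_spec r.first r.first
  obtain ⟨h4, -, -⟩ := r.rhs.last_spec r.first (r.lhs.last r.first r.first)
  rcases h4 with h4 | ⟨a, ha, h⟩
  · rcases h1 with h1 | ⟨a, ha, h⟩
    · obtain ⟨a, ha, h⟩ := r.first_mem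
      exact ⟨a, ha, by rw [second, h4, h1, h]⟩
    · exact ⟨a, Finset.mem_union_left _ ha, by rw [second, h4, h]⟩
  · exact ⟨a, Finset.mem_union_right _ ha, h.symm⟩

/-- If an attribute differed from both, then the second would differ from the first by `last_spec`,
and the constraint would contain three attributes. -/
theorem eq_first_or_second {r : Constraint (Fin l)} (hr : r.attrs.card ≤ 2) {a : Fin l}
    (ha : a ∈ r.attrs) : (a : ℕ) = r.first ∨ (a : ℕ) = r.second := by
  by_contra! hne
  have hs : r.second ≠ r.first := by
    obtain ⟨-, h2, -⟩ := r.lhs.last_spec r.first r.first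
    obtain ⟨-, h5, h6⟩ := r.rhs.last_spec r.first (r.lhs.last r.first r.first)
    rcases Finset.mem_union.1 ha with h | h
    · exact h6 (h2 a h hne.1)
    · exact h5 a h hne.1
  obtain ⟨b, hb, hb'⟩ := r.first_mem
  obtain ⟨c, hc, hc'⟩ := r.second_mem
  have hsub : ({a, b, c} : Finset (Fin l)) ⊆ r.attrs := by
    intro d hd
    simp only [Finset.mem_insert, Finset.mem_singleton] at hd
    rcases hd with rfl | rfl | rfl <;> assumption
  have hcard : ({a, b, c} : Finset (Fin l)).card = 3 := by
    rw [Finset.card_eq_three]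
    refine ⟨a, b, c, ?_, ?_, ?_, rfl⟩ <;> rintro rfl
    · exact hne.1 hb'
    · exact hne.2 hc'
    · exact hs (hc'.symm.trans hb')
  have := Finset.card_le_card hsub
  omega

/-- Every attribute of the constraint other than the first is the second, so assigning the second
value to all other variables is harmless. The program can thus tabulate a constraint before it knows
the second attribute. -/
theorem test_eq_pair {r : Constraint (Fin l)} (hr : r.attrs.card ≤ 2) (X : ℕ → Bool) :
    r.test X = r.test (pair r.first (X r.first) (X r.second)) := by
  have h : ∀ a ∈ r.attrs, X a = pair r.first (X r.first) (X r.second) a := by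
    intro a ha
    unfold pair
    split_ifs with h
    · rw [h]
    · rcases eq_first_or_second hr ha with h' | h'
      · exact absurd h' h
      · rw [h']
  rw [test, test, Formula.test_congr r.lhs fun a ha => h a (Finset.mem_union_left _ ha),
    Formula.test_congr r.rhs fun a ha => h a (Finset.mem_union_right _ ha)]

end Constraint

/-! ### Reading formulas -/

theorem exec_pushLiteral {N : ℕ} {M : Mem Cell} {l u v : ℕ} {x y : Bool} (p : Bool) (a : Fin l)
    (h : M .tok 0 = if p then (a : ℤ) + 2 else -((a : ℤ) + 2))
    (hu : M .u 0 = u) (hv : M .v 0 = v) (hx : M .bx 0 = bit x) (hy : M .bz 0 = bit y) :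
    exec N pushLiteral M .sp 0 = M .sp 0 + 1 ∧
      exec N pushLiteral M .v 0 = ((Formula.lit p a).last u v : ℕ) ∧
      exec N pushLiteral M .stk = Function.update (M .stk) (M .sp 0)
        (bit ((Formula.lit p a).test (pair u x y))) := by
  simp only [pushLiteral, exec_seq]
  have hsgn : (0 ≤ M .tok 0) ↔ p = true := by rw [h]; cases p <;> simp <;> omega
  set M₁ := exec N literalAttr M with hM₁
  have f1 : ∀ c ≠ Cell.attr, M₁ c = M c := fun c hc =>
    exec_of_not_writes _ _ _ _ (by simp [literalAttr, LProg.writes, assign, hc])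
  have a1 : M₁ .attr 0 = (a : ℕ) := by
    simp only [hM₁, literalAttr, exec_ite, eval_le, eval_zero, eval_load, eval_const, hsgn]
    cases p <;> simp [Mem.write, h]
  set M₂ := exec N literalVal M₁ with hM₂
  have f2 : ∀ c, c ≠ Cell.val → c ≠ .v → M₂ c = M₁ c := fun c hc hc' =>
    exec_of_not_writes _ _ _ _ (by simp [literalVal, LProg.writes, assign, hc, hc'])
  have v2 : M₂ .val 0 = bit (pair u x y a) ∧ M₂ .v 0 = (if (a : ℕ) = u then v else a : ℕ) := by
    simp only [hM₂, literalVal, exec_ite, eval_eqE, eval_load, eval_const, a1, f1 .u (by simp), hu,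
      Nat.cast_inj, pair]
    by_cases hau : (a : ℕ) = u <;> simp [hau, Mem.write, f1, hx, hy, hv, a1]
  set M₃ := exec N literalSign M₂ with hM₃
  have f3 : ∀ c, c ≠ Cell.val → M₃ c = M₂ c := fun c hc =>
    exec_of_not_writes _ _ _ _ (by simp [literalSign, LProg.writes, assign, hc])
  have v3 : M₃ .val 0 = bit ((Formula.lit p a).test (pair u x y)) := by
    simp only [hM₃, literalSign, exec_ite, eval_le, eval_zero, eval_load, eval_const,
      f2 .tok (by simp) (by simp), f1 .tok (by simp), hsgn, Formula.test]
    cases p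
    · simp [Mem.write, v2.1]
      cases pair u x y a <;> simp [bit]
    · simp [v2.1]
  have sp3 : M₃ .sp 0 = M .sp 0 := by
    rw [f3 _ (by simp), f2 _ (by simp) (by simp), f1 _ (by simp)]
  have stk3 : M₃ .stk = M .stk := by
    rw [f3 _ (by simp), f2 _ (by simp) (by simp), f1 _ (by simp)]
  refine ⟨by simp [Mem.write, sp3], ?_, ?_⟩
  · simp [Mem.write, f3, v2.2, Formula.last]
  · funext k
    simp [Mem.write, sp3, stk3, v3, Function.update_apply]

/-- The effect of reading a token on the stack pointer, the stack and `v`. -/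
structure Pushed {l : ℕ} (f : Formula (Fin l)) (u : ℕ) (x y : Bool) (n : ℕ) (M M' : Mem Cell) :
    Prop where
  pos : M' .pos 0 = M .pos 0 + n
  sp : M' .sp 0 = M .sp 0 + 1
  v : ∀ w : ℕ, M .v 0 = w → M' .v 0 = (f.last u w : ℕ)
  top : M' .stk (M .sp 0) = bit (f.test (pair u x y))
  below : ∀ k < M .sp 0, M' .stk k = M .stk k

theorem exec_readToken_literal {N : ℕ} {M : Mem Cell} {l u v : ℕ} {x y : Bool} (p : Bool)
    (a : Fin l) (h : Reads (M .inp) (M .pos 0) (Formula.lit p a).tokens)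
    (hu : M .u 0 = u) (hv : M .v 0 = v) (hx : M .bx 0 = bit x) (hy : M .bz 0 = bit y) :
    Pushed (.lit p a) u x y 1 M (exec N readToken M) := by
  have h1 := h.1
  set M₁ := exec N (.pos ≔ Cell.pos + 1) (exec N (.tok ≔ .load .inp Cell.pos) M) with hM₁
  have f1 : ∀ c, c ≠ Cell.tok → c ≠ .pos → M₁ c = M c := fun c hc hc' =>
    (write_of_ne _ hc' _ _).trans (write_of_ne _ hc _ _)
  have t1 : M₁ .tok 0 = if p then (a : ℤ) + 2 else -((a : ℤ) + 2) := by
    rw [← h1]; simp [hM₁, Mem.write]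
  have e : exec N readToken M = exec N pushLiteral M₁ := by
    simp only [readToken, exec_seq]
    rw [← hM₁, exec_ite, if_neg]
    -- Literals have absolute value at least 2, so they are not taken for the operators 0 and 1.
    have hne : ¬ (0 ≤ M₁ .tok 0 ∧ M₁ .tok 0 ≤ 1) := by
      have : (0 : ℤ) ≤ (a : ℕ) := by omega
      rw [t1]; cases p <;> simp <;> omega
    simp only [eval_le, eval_add, eval_load, eval_const, eval_zero, eval_one, eval_two]
    rw [if_neg (by split_ifs <;> omega)]
    norm_num
  obtain ⟨r1, r2, r3⟩ := exec_pushLiteral (N := N) p a t1 (by rw [f1 _ (by simp) (by simp), hu])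
    (by rw [f1 _ (by simp) (by simp), hv]) (by rw [f1 _ (by simp) (by simp), hx])
    (by rw [f1 _ (by simp) (by simp), hy])
  rw [f1 .sp (by simp) (by simp)] at r1 r3
  rw [f1 .stk (by simp) (by simp)] at r3
  rw [e]
  refine ⟨?_, r1, ?_, by rw [r3, Function.update_self], ?_⟩
  · rw [exec_of_not_writes _ _ _ _ rfl]; simp [hM₁, Mem.write]
  · intro v' hv'
    rw [hv] at hv'
    rw [r2]; congr 2; exact_mod_cast hv'
  · intro k hk
    rw [r3, Function.update_of_ne (by omega)]

theorem exec_readToken_operator {N : ℕ} {M : Mem Cell} {b x y : Bool}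
    (h : M .inp (M .pos 0) = bit b) (hx : M .stk (M .sp 0 - 2) = bit x)
    (hy : M .stk (M .sp 0 - 1) = bit y) :
    exec N readToken M .pos 0 = M .pos 0 + 1 ∧ exec N readToken M .sp 0 = M .sp 0 - 1 ∧
      exec N readToken M .v = M .v ∧ exec N readToken M .stk =
        Function.update (M .stk) (M .sp 0 - 2) (bit (if b then x || y else x && y)) := by
  set M₁ := exec N (.pos ≔ Cell.pos + 1) (exec N (.tok ≔ .load .inp Cell.pos) M) with hM₁
  have f1 : ∀ c, c ≠ Cell.tok → c ≠ .pos → M₁ c = M c := fun c hc hc' =>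
    (write_of_ne _ hc' _ _).trans (write_of_ne _ hc _ _)
  have t1 : M₁ .tok 0 = bit b := by rw [← h]; simp [hM₁, Mem.write]
  have e : exec N readToken M = exec N applyOperator M₁ := by
    simp only [readToken, exec_seq]
    rw [← hM₁, exec_ite, if_pos]
    simp only [eval_le, eval_add, eval_load, eval_const, eval_zero, eval_one, eval_two, t1]
    cases b <;> simp [bit]
  have sp1 : M₁ .sp 0 = M .sp 0 := by rw [f1 _ (by simp) (by simp)]
  have stk1 : M₁ .stk = M .stk := by rw [f1 _ (by simp) (by simp)]
  have pos1 : M₁ .pos 0 = M .pos 0 + 1 := by simp [hM₁, Mem.write]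
  have e1 : M .sp 0 - 1 - 1 = M .sp 0 - 2 := by ring
  rw [e, applyOperator]
  refine ⟨by simp [Mem.write, pos1], by simp [Mem.write, sp1], ?_, ?_⟩
  · rw [← applyOperator, exec_of_not_writes _ _ _ _ rfl, f1 _ (by simp) (by simp)]
  funext k
  simp [Mem.write, sp1, stk1, t1, e1, hx, hy, Function.update_apply]
  split_ifs <;> cases b <;> cases x <;> cases y <;> simp_all [bit]

theorem iter_of_not_writes (N : ℕ) (v c : Cell) (P : LProg Cell) (s n : ℕ) (M : Mem Cell)
    (hv : c ≠ v) (hP : P.writes c = false) :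
    iter (fun i M => exec N P (M.write v 0 i)) s n M c = M c := by
  induction n with
  | zero => rfl
  | succ n ih => rw [iter, exec_of_not_writes _ _ _ _ hP, write_of_ne _ hv, ih]

/-- The body of the loop that reads the tokens of a formula. -/
abbrev tokenStep (N : ℕ) : ℕ → Mem Cell → Mem Cell :=
  fun i M => exec N readToken (M.write .i 0 i)

theorem iter_tokenStep_of_mem (N : ℕ) {c : Cell} (hc : c ∈ [Cell.inp, .u, .bx, .bz]) (s n : ℕ)
    (M : Mem Cell) : iter (tokenStep N) s n M c = M c := by
  simp only [List.mem_cons, List.not_mem_nil, or_false] at hc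
  rcases hc with rfl | rfl | rfl | rfl <;>
    exact iter_of_not_writes _ _ _ _ _ _ _ (by simp) rfl

/-- Conjunction and disjunction share this induction step. The value of `f` is pushed first and
stays untouched below the value of `g`, by `Pushed.below`; the operator then replaces both by one
value, so the net effect is again a single push. -/
theorem iter_readToken_binary {N l u : ℕ} {x y b : Bool} {f g o : Formula (Fin l)} {s : ℕ}
    {M : Mem Cell} (ho : o.tokens = f.tokens ++ g.tokens ++ [bit b])
    (hlast : ∀ v, o.last u v = g.last u (f.last u v))
    (htest : ∀ X, o.test X = if b then f.test X || g.test X else f.test X && g.test X)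
    (hr : Reads (M .inp) (M .pos 0) o.tokens) (hu : M .u 0 = u) (hv : ∃ v : ℕ, M .v 0 = v)
    (hx : M .bx 0 = bit x) (hy : M .bz 0 = bit y)
    (pf : Reads (M .inp) (M .pos 0) f.tokens →
      Pushed f u x y f.tokens.length M (iter (tokenStep N) s f.tokens.length M))
    (pg : ∀ s (M : Mem Cell), Reads (M .inp) (M .pos 0) g.tokens → M .u 0 = u →
      (∃ v : ℕ, M .v 0 = v) → M .bx 0 = bit x → M .bz 0 = bit y →
      Pushed g u x y g.tokens.length M (iter (tokenStep N) s g.tokens.length M)) :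
    Pushed o u x y o.tokens.length M (iter (tokenStep N) s o.tokens.length M) := by
  rw [ho, reads_append, reads_append] at hr
  obtain ⟨⟨r1, r2⟩, r3⟩ := hr
  have pf := pf r1
  rw [ho, List.length_append, List.length_append, iter_add, iter_add]
  set M₁ := iter (tokenStep N) s f.tokens.length M with hM₁
  have e1 : ∀ c ∈ [Cell.inp, .u, .bx, .bz], M₁ c = M c := fun c hc => iter_tokenStep_of_mem N hc _ _ _
  obtain ⟨v, hv⟩ := hv
  have pg := pg (s + f.tokens.length) M₁ (by rw [e1 _ (by simp), pf.pos]; exact r2)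
    (by rw [e1 _ (by simp), hu]) ⟨_, pf.v v hv⟩ (by rw [e1 _ (by simp), hx])
    (by rw [e1 _ (by simp), hy])
  set M₂ := iter (tokenStep N) (s + f.tokens.length) g.tokens.length M₁ with hM₂
  have e2 : M₂ .inp = M .inp := by rw [hM₂, iter_tokenStep_of_mem N (by simp), e1 _ (by simp)]
  change Pushed o u x y _ M (exec N readToken
    (M₂.write .i 0 ((s + (f.tokens.length + g.tokens.length) + 0 : ℕ) : ℤ)))
  set M₃ := M₂.write .i 0 ((s + (f.tokens.length + g.tokens.length) + 0 : ℕ) : ℤ) with hM₃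
  have e3 : ∀ c ≠ Cell.i, M₃ c = M₂ c := fun c hc => write_of_ne _ hc _ _
  have sp3 : M₃ .sp 0 = M .sp 0 + 2 := by rw [e3 _ (by simp), pg.sp, pf.sp]; ring
  have pos3 : M₃ .pos 0 = M .pos 0 + f.tokens.length + g.tokens.length := by
    rw [e3 _ (by simp), pg.pos, pf.pos]
  obtain ⟨q1, q2, q4, q3⟩ := exec_readToken_operator (N := N) (M := M₃) (b := b)
    (x := f.test (pair u x y)) (y := g.test (pair u x y))
    (by
      rw [pos3, e3 _ (by simp), e2, add_assoc]
      have := r3.1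
      rwa [List.length_append, Nat.cast_add] at this)
    (by
      rw [sp3, e3 _ (by simp), add_sub_cancel_right, pg.below _ (by rw [pf.sp]; omega), pf.top])
    (by
      rw [sp3, e3 _ (by simp), ← pg.top, pf.sp]; congr 1; ring)
  refine ⟨?_, ?_, ?_, ?_, ?_⟩
  · rw [q1, pos3]; push_cast; simp; ring
  · rw [q2, sp3]; ring
  · intro v hv
    rw [q4, e3 _ (by simp), pg.v _ (pf.v v hv), hlast]
  · rw [q3, sp3, add_sub_cancel_right, Function.update_self, htest]
  · intro k hk
    rw [q3, sp3, add_sub_cancel_right, Function.update_of_ne (by omega), e3 _ (by simp),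
      pg.below _ (by rw [pf.sp]; omega), pf.below _ hk]

theorem iter_readToken {N l u : ℕ} {x y : Bool} (f : Formula (Fin l)) (s : ℕ) (M : Mem Cell)
    (h : Reads (M .inp) (M .pos 0) f.tokens) (hu : M .u 0 = u) (hv : ∃ v : ℕ, M .v 0 = v)
    (hx : M .bx 0 = bit x) (hy : M .bz 0 = bit y) :
    Pushed f u x y f.tokens.length M (iter (tokenStep N) s f.tokens.length M) := by
  induction f generalizing s M with
  | lit p a =>
    obtain ⟨v, hv⟩ := hv
    have e : ∀ c ≠ Cell.i, (M.write .i 0 (s : ℤ)) c = M c := fun c hc => write_of_ne _ hc _ _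
    have := exec_readToken_literal (N := N) (M := M.write .i 0 (s : ℤ)) p a
      (by rw [e _ (by simp), e _ (by simp)]; exact h) (by rw [e _ (by simp), hu])
      (by rw [e _ (by simp), hv]) (by rw [e _ (by simp), hx]) (by rw [e _ (by simp), hy])
    have this' : Pushed (.lit p a) u x y 1 (M.write .i 0 (s : ℤ))
      (iter (tokenStep N) s 1 M) := this
    refine ⟨?_, ?_, ?_, ?_, ?_⟩
    · have := this'.pos; rwa [e _ (by simp)] at this
    · have := this'.sp; rwa [e _ (by simp)] at this
    · have := this'.v; rwa [e _ (by simp)] at this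
    · have := this'.top; rwa [e _ (by simp)] at this
    · have := this'.below; rwa [e _ (by simp), e _ (by simp)] at this
  | and f g hf hg =>
    exact iter_readToken_binary (b := false) rfl (fun _ => rfl) (fun _ => rfl) h hu hv hx hy
      (fun h => hf s M h hu hv hx hy) hg
  | or f g hf hg =>
    exact iter_readToken_binary (b := true) rfl (fun _ => rfl) (fun _ => rfl) h hu hv hx hy
      (fun h => hf s M h hu hv hx hy) hg

theorem exec_readFormula {N l u : ℕ} {x y : Bool} (f : Formula (Fin l)) (M : Mem Cell)
    (hN : f.tokens.length ≤ N)
    (h : Reads (M .inp) (M .pos 0) f.encode) (hu : M .u 0 = u) (hv : ∃ v : ℕ, M .v 0 = v)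
    (hx : M .bx 0 = bit x) (hy : M .bz 0 = bit y) :
    Pushed f u x y f.encode.length M (exec N readFormula M) := by
  obtain ⟨h1, h2⟩ := h
  set M₁ := exec N (.pos ≔ Cell.pos + 1) (exec N (.cnt ≔ .load .inp Cell.pos) M) with hM₁
  have f1 : ∀ c, c ≠ Cell.cnt → c ≠ .pos → M₁ c = M c := fun c hc hc' =>
    (write_of_ne _ hc' _ _).trans (write_of_ne _ hc _ _)
  have pos1 : M₁ .pos 0 = M .pos 0 + 1 := by simp [hM₁, Mem.write]
  have cnt1 : M₁ .cnt 0 = f.tokens.length := by rw [← h1]; simp [hM₁, Mem.write]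
  have e : exec N readFormula M = iter (tokenStep N) 0 f.tokens.length M₁ := by
    simp only [readFormula, exec_seq]
    rw [← hM₁, exec, eval_load, eval_const, cnt1, Int.toNat_natCast, min_eq_left hN]
  have := iter_readToken (N := N) (x := x) (y := y) f 0 M₁
    (by rw [f1 _ (by simp) (by simp), pos1]; exact h2) (by rw [f1 _ (by simp) (by simp), hu])
    (by rw [f1 _ (by simp) (by simp)]; exact hv) (by rw [f1 _ (by simp) (by simp), hx])
    (by rw [f1 _ (by simp) (by simp), hy])
  rw [e]
  refine ⟨?_, ?_, ?_, ?_, ?_⟩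
  · rw [this.pos, pos1, Formula.encode, List.length_cons]; push_cast; ring
  · rw [this.sp, f1 _ (by simp) (by simp)]
  · intro v hv
    exact this.v v (by rw [f1 _ (by simp) (by simp), hv])
  · have := this.top; rwa [f1 _ (by simp) (by simp)] at this
  · have := this.below; rwa [f1 _ (by simp) (by simp), f1 _ (by simp) (by simp)] at this

/-! ### Reading constraints -/

/-- The position of a pair of truth values in the order of the loops over `bx` and `bz`. -/
def num (x y : Bool) : ℕ := 2 * x.toNat + y.toNat

theorem num_lt (x y : Bool) : num x y < 4 := by cases x <;> cases y <;> simp [num]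

theorem num_lt_succ {x y x' y' : Bool} :
    num x' y' < num x y + 1 ↔ num x' y' < num x y ∨ (x' = x ∧ y' = y) := by
  cases x <;> cases y <;> cases x' <;> cases y' <;> simp [num]

/-- The rule for a loop over all pairs of truth values. -/
theorem rep_bits {N : ℕ} (hN : 2 ≤ N) {P : LProg Cell} (hP : P.writes .bx = false) {M₀ : Mem Cell}
    (Inv : ℕ → Mem Cell → Prop)
    (hst : ∀ k (M M' : Mem Cell), (∀ c, c ≠ .bx → c ≠ .bz → M' c = M c) → Inv k M → Inv k M')
    (h0 : Inv 0 M₀)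
    (hstep : ∀ x y (M : Mem Cell),
      (∀ c, (LProg.rep .bx 2 (.rep .bz 2 P)).writes c = false → M c = M₀ c) →
      M .bx 0 = bit x → M .bz 0 = bit y → Inv (num x y) M → Inv (num x y + 1) (exec N P M)) :
    Inv 4 (exec N (.rep .bx 2 (.rep .bz 2 P)) M₀) := by
  refine rep_induction (n := 2) (by simp) hN (fun (i : ℕ) (M : Mem Cell) => Inv (2 * i) M) h0 ?_
  intro i hi M₁ hM₁ inv₁
  obtain ⟨x, hx, hx'⟩ : ∃ x : Bool, bit x = i ∧ x.toNat = i := by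
    obtain rfl | rfl : i = 0 ∨ i = 1 := by omega
    · exact ⟨false, rfl, rfl⟩
    · exact ⟨true, rfl, rfl⟩
  refine rep_induction (n := 2) (by simp) hN
    (fun (j : ℕ) (M : Mem Cell) => Inv (2 * i + j) M)
    (hst _ M₁ _ (fun c hc _ => write_of_ne _ hc _ _) inv₁) ?_
  intro j hj M₂ hM₂ inv₂
  obtain ⟨y, hy, hy'⟩ : ∃ y : Bool, bit y = j ∧ y.toNat = j := by
    obtain rfl | rfl : j = 0 ∨ j = 1 := by omega
    · exact ⟨false, rfl, rfl⟩
    · exact ⟨true, rfl, rfl⟩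
  have hn : 2 * i + j = num x y := by rw [num, hx', hy']
  rw [← add_assoc, hn]
  rw [hn] at inv₂
  refine hstep x y _ ?_ ?_ ?_ (hst _ M₂ _ (fun c _ hc => write_of_ne _ hc _ _) inv₂)
  · intro c hc
    have h := hc
    simp only [LProg.writes, Bool.or_eq_false_iff, decide_eq_false_iff_not] at h
    rw [write_of_ne _ h.2.1, hM₂ c (by simp [LProg.writes, h]), write_of_ne _ h.1, hM₁ c hc]
  · rw [write_of_ne _ (by simp), hM₂ _ (by simp [LProg.writes, hP]), hx]
    simp [Mem.write]
  · rw [hy]; simp [Mem.write]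

theorem exec_evalConstraint {N l k : ℕ} {x y : Bool} (r : Constraint (Fin l)) (M : Mem Cell)
    (hl : r.lhs.tokens.length ≤ N) (hr : r.rhs.tokens.length ≤ N)
    (h : Reads (M .inp) (M .start 0) r.encode) (hu : M .u 0 = r.first)
    (hx : M .bx 0 = bit x) (hy : M .bz 0 = bit y) (hrow : Rows N M) (hk : M .con 0 = k)
    (hkN : k ≤ N) :
    exec N evalConstraint M .pos 0 = M .start 0 + r.encode.length ∧
      exec N evalConstraint M .v 0 = r.second ∧
      exec N evalConstraint M .tab = Function.update (M .tab) (addr N k 0 x y)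
        (bit (r.test (pair r.first x y))) := by
  set M₁ := exec N (.sp ≔ 0) (exec N (.v ≔ Cell.u) (exec N (.pos ≔ Cell.start) M)) with hM₁
  have f1 : ∀ c, c ≠ Cell.pos → c ≠ .v → c ≠ .sp → M₁ c = M c := fun c h1 h2 h3 =>
    (write_of_ne _ h3 _ _).trans ((write_of_ne _ h2 _ _).trans (write_of_ne _ h1 _ _))
  have pos1 : M₁ .pos 0 = M .start 0 := by simp [hM₁, Mem.write]
  have v1 : M₁ .v 0 = r.first := by simp [hM₁, Mem.write, hu]
  have sp1 : M₁ .sp 0 = 0 := by simp [hM₁, Mem.write]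
  rw [Constraint.encode, reads_append] at h
  have p2 := exec_readFormula (N := N) (x := x) (y := y) (u := r.first) r.lhs M₁ hl
    (by rw [f1 _ (by simp) (by simp) (by simp), pos1]; exact h.1)
    (by rw [f1 _ (by simp) (by simp) (by simp), hu]) ⟨_, v1⟩
    (by rw [f1 _ (by simp) (by simp) (by simp), hx])
    (by rw [f1 _ (by simp) (by simp) (by simp), hy])
  set M₂ := exec N readFormula M₁ with hM₂
  have f2 : ∀ c ∈ [Cell.inp, .u, .bx, .bz, .row, .con, .tab], M₂ c = M c := by
    intro c hc
    simp only [List.mem_cons, List.not_mem_nil, or_false] at hc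
    rcases hc with rfl | rfl | rfl | rfl | rfl | rfl | rfl <;>
      exact (exec_of_not_writes _ _ _ _ rfl).trans (f1 _ (by simp) (by simp) (by simp))
  have p3 := exec_readFormula (N := N) (x := x) (y := y) (u := r.first) r.rhs M₂ hr
    (by rw [f2 _ (by simp), p2.pos, pos1]; exact h.2)
    (by rw [f2 _ (by simp), hu]) ⟨_, p2.v _ v1⟩
    (by rw [f2 _ (by simp), hx]) (by rw [f2 _ (by simp), hy])
  set M₃ := exec N readFormula M₂ with hM₃
  have f3 : ∀ c ∈ [Cell.inp, .u, .bx, .bz, .row, .con, .tab], M₃ c = M c := by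
    intro c hc
    have hc' := hc
    simp only [List.mem_cons, List.not_mem_nil, or_false] at hc
    rcases hc with rfl | rfl | rfl | rfl | rfl | rfl | rfl <;>
      exact (exec_of_not_writes _ _ _ _ rfl).trans (f2 _ hc')
  have e : exec N evalConstraint M = M₃.write .tab (addr N k 0 x y)
      (bit (r.test (pair r.first x y))) := by
    simp only [evalConstraint, exec_seq]
    rw [← hM₁, ← hM₂, ← hM₃, exec_store, eval_adr (hrow.congr (f3 _ (by simp))) (i' := k) (j' := 0)
      (x' := x) (y' := y) (by simp [f3, hk]) hkN (by simp) (by simp [f3, hx]) (by simp [f3, hy])]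
    congr 1
    have s0 : M₃ .stk 0 = bit (r.lhs.test (pair r.first x y)) := by
      rw [p3.below _ (by rw [p2.sp, sp1]; norm_num), ← p2.top, sp1]
    have s1 : M₃ .stk 1 = bit (r.rhs.test (pair r.first x y)) := by
      rw [← p3.top, p2.sp, sp1]; rfl
    simp only [eval_le, eval_load, eval_zero, eval_one, s0, s1, Constraint.test]
    cases r.lhs.test (pair r.first x y) <;> cases r.rhs.test (pair r.first x y) <;> simp [bit]
  rw [e]
  refine ⟨?_, ?_, ?_⟩
  · rw [write_of_ne _ (by simp), p3.pos, p2.pos, pos1, Constraint.encode, List.length_append]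
    push_cast; ring
  · rw [write_of_ne _ (by simp), p3.v _ (p2.v _ v1), Constraint.second]
  · funext z
    simp [Mem.write, Function.update_apply, f3]

theorem exec_readConstraint {N l k : ℕ} (r : Constraint (Fin l)) (M : Mem Cell)
    (hl : r.lhs.tokens.length ≤ N) (hr : r.rhs.tokens.length ≤ N) (hN : 2 ≤ N)
    (h : Reads (M .inp) (M .pos 0) r.encode) (hrow : Rows N M) (hk : M .con 0 = k)
    (hkN : k < N) :
    exec N readConstraint M .pos 0 = M .pos 0 + r.encode.length ∧
      exec N readConstraint M .uu = Function.update (M .uu) k r.first ∧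
      exec N readConstraint M .vv = Function.update (M .vv) k r.second ∧
      exec N readConstraint M .act = Function.update (M .act) k 1 ∧
      (∀ x y, exec N readConstraint M .tab (addr N k 0 x y) = bit (r.test (pair r.first x y))) ∧
      ∀ z, (∀ x y, z ≠ addr N k 0 x y) → exec N readConstraint M .tab z = M .tab z := by
  simp only [readConstraint, exec_seq]
  set M₁ := exec N readFirst (exec N (.start ≔ Cell.pos) M) with hM₁
  have f1 : ∀ c, c ≠ Cell.start → c ≠ .u → M₁ c = M c := fun c h1 h2 =>
    (exec_of_not_writes _ _ _ _ (by simp [readFirst, LProg.writes, assign, h2])).trans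
      (write_of_ne _ h1 _ _)
  have start1 : M₁ .start 0 = M .pos 0 := by
    rw [hM₁, exec_of_not_writes _ _ _ _ rfl]; simp [Mem.write]
  have u1 : M₁ .u 0 = r.first := by
    obtain ⟨w, hw⟩ := r.lhs.tokens_eq_cons
    rw [Constraint.encode, reads_append, Formula.encode] at h
    have hfirst : (0 : ℤ) ≤ r.first := by omega
    simp only [hM₁, readFirst, exec_ite, exec_assign, eval_le, eval_zero, eval_load, eval_add, eval_const,
      eval_one, eval_sub, eval_two]
    have e : ∀ c, c ≠ Cell.start → (M.write .start 0 (M .pos 0)) c = M c :=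
      fun c hc => write_of_ne _ hc _ _
    rw [e _ (by simp), e _ (by simp)]
    rcases hw with hw | hw <;> rw [hw] at h
    · rw [h.1.2.1]
      change (if (if 0 ≤ ((r.first : ℤ) + 2) then (1 : ℤ) else 0) ≠ 0 then _ else _ : Mem Cell) _ _ = _
      rw [if_pos (show (0 : ℤ) ≤ (r.first : ℤ) + 2 by omega), if_pos one_ne_zero]
      simp [Mem.write, Constraint.first]
    · rw [h.1.2.1]
      change (if (if 0 ≤ (-((r.first : ℤ) + 2)) then (1 : ℤ) else 0) ≠ 0 then _ else _ : Mem Cell) _ _ = _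
      rw [if_neg (show ¬ (0 : ℤ) ≤ -((r.first : ℤ) + 2) by omega), if_neg (by simp)]
      simp [Mem.write, Constraint.first]
  set M₂ := exec N (.rep .bx 2 (.rep .bz 2 evalConstraint)) M₁ with hM₂
  have main := rep_bits hN (P := evalConstraint) rfl (M₀ := M₁)
    (fun n M' => (∀ x y, num x y < n → M' .tab (addr N k 0 x y) = bit (r.test (pair r.first x y))) ∧
      (∀ z, (∀ x y, z ≠ addr N k 0 x y) → M' .tab z = M .tab z) ∧
      -- The four evaluations reread the same tokens, and each of them leaves the same position and
      -- second attribute. Before the first one, neither is known.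
      (0 < n → M' .pos 0 = M .pos 0 + r.encode.length ∧ M' .v 0 = r.second)) ?_ ?_ ?_
  · obtain ⟨h1, h2, h3⟩ := main
    obtain ⟨h3, h4⟩ := h3 (by norm_num)
    have f2 : ∀ c ∈ [Cell.uu, .vv, .act], M₂ c = M c := by
      intro c hc
      simp only [List.mem_cons, List.not_mem_nil, or_false] at hc
      rcases hc with rfl | rfl | rfl <;>
        exact (exec_of_not_writes _ _ _ _ rfl).trans (f1 _ (by simp) (by simp))
    have con2 : M₂ .con 0 = k := by
      rw [hM₂, exec_of_not_writes _ _ _ _ rfl, f1 _ (by simp) (by simp), hk]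
    have u2 : M₂ .u 0 = r.first := by rw [hM₂, exec_of_not_writes _ _ _ _ rfl, u1]
    rw [← hM₂] at h1 h2 h3 h4
    refine ⟨by simp [Mem.write, h3], ?_, ?_, ?_, ?_, ?_⟩
    · funext z; simp [Mem.write, Function.update_apply, f2, con2, u2]
    · funext z; simp [Mem.write, Function.update_apply, f2, con2, h4]
    · funext z; simp [Mem.write, Function.update_apply, f2, con2]
    · intro x y; simpa [Mem.write] using h1 x y (num_lt x y)
    · intro z hz; simpa [Mem.write] using h2 z hz
  · rintro n M M' hM ⟨h1, h2, h3⟩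
    rw [hM .tab (by simp) (by simp), hM .pos (by simp) (by simp), hM .v (by simp) (by simp)]
    exact ⟨h1, h2, h3⟩
  · exact ⟨fun _ _ h => by omega, fun z _ => by rw [f1 _ (by simp) (by simp)], fun h => by omega⟩
  · rintro x y M' hM' hx hy ⟨h1, h2, -⟩
    have f2 : ∀ c ∈ [Cell.inp, .row, .con], M' c = M c := by
      intro c hc
      simp only [List.mem_cons, List.not_mem_nil, or_false] at hc
      rcases hc with rfl | rfl | rfl <;>
        exact (hM' _ rfl).trans (f1 _ (by simp) (by simp))
    have start2 : M' .start 0 = M .pos 0 := by rw [hM' _ rfl, start1]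
    obtain ⟨q1, q2, q3⟩ := exec_evalConstraint (N := N) (k := k) (x := x) (y := y) r M' hl hr
      (by rw [f2 _ (by simp), start2]; exact h) (by rw [hM' _ rfl, u1]) hx hy
      (hrow.congr (f2 _ (by simp))) (by rw [f2 _ (by simp), hk]) hkN.le
    refine ⟨?_, ?_, fun _ => ⟨by rw [q1, start2], q2⟩⟩
    · intro x' y' hxy
      rw [q3, Function.update_apply]
      simp only [addr_inj (by omega : 0 < N) (by omega : 0 < N), true_and]
      rcases num_lt_succ.1 hxy with h | ⟨rfl, rfl⟩
      · split_ifs with h'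
        · rw [h'.1, h'.2]
        · exact h1 _ _ h
      · simp
    · intro z hz
      rw [q3, Function.update_of_ne (hz x y), h2 z hz]

/-! ### Factors in memory -/

/-- The memory holds a family of factors. -/
structure Holding (N : ℕ) (M : Mem Cell) (F : Factors (PowerSeries Cost)) : Prop where
  act : ∀ i < N, M .act i = if i ∈ F.act then 1 else 0
  uu : ∀ i < N, M .uu i = F.u i
  vv : ∀ i < N, M .vv i = F.v i
  tab : ∀ i < N, ∀ j < N, ∀ x y, M .tab (addr N i j x y) = (PowerSeries.coeff j (F.t i x y)).enc

theorem Holding.congr {N : ℕ} {M M' : Mem Cell} {F : Factors (PowerSeries Cost)}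
    (h : Holding N M F) (hM : ∀ c ∈ [Cell.act, .uu, .vv, .tab], M' c = M c) : Holding N M' F := by
  constructor
  · rw [hM _ (by simp)]; exact h.act
  · rw [hM _ (by simp)]; exact h.uu
  · rw [hM _ (by simp)]; exact h.vv
  · rw [hM _ (by simp)]; exact h.tab

/-- The factors of a list of constraints. -/
noncomputable def constraintFactors {l : ℕ} (cs : List (Constraint (Fin l))) :
    Factors (PowerSeries Cost) where
  act := Finset.range cs.length
  u i := (cs[i]?).elim 0 Constraint.first
  v i := (cs[i]?).elim 0 Constraint.second
  t i x y := (cs[i]?).elim 0 fun r => if r.test (pair r.first x y) then 1 else 0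

theorem enc_coeff_ite (b : Bool) (j : ℕ) :
    (PowerSeries.coeff j (if b then 1 else 0 : PowerSeries Cost)).enc =
      if j = 0 then bit b else 0 := by
  cases b
  · simp [Cost.enc_zero, bit]
  · simp only [if_true, PowerSeries.coeff_one]
    split_ifs <;> rfl

theorem exec_readConstraints {N l : ℕ} {M₀ : Mem Cell} (cs : List (Constraint (Fin l)))
    (hlen : ∀ r ∈ cs, r.lhs.tokens.length ≤ N ∧ r.rhs.tokens.length ≤ N) (hN : 2 ≤ N)
    (hn : M₀ .inp 2 = cs.length) (hnN : cs.length ≤ N) (hrow : Rows N M₀)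
    (hreads : Reads (M₀ .inp) (M₀ .pos 0) (cs.flatMap Constraint.encode))
    (h0 : ∀ c ∈ [Cell.act, .uu, .vv, .tab], M₀ c = 0) :
    Holding N (exec N readConstraints M₀) (constraintFactors cs) := by
  have := rep_induction (N := N) (v := .con) (e := .load .inp 2)
    (P := readConstraint) (M₀ := M₀) (n := cs.length) (by simp [hn]) hnN
    (fun (k : ℕ) (M : Mem Cell) => Holding N M (constraintFactors (cs.take k)) ∧
      Reads (M₀ .inp) (M .pos 0) ((cs.drop k).flatMap Constraint.encode)) ?_ ?_
  · have h := this.1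
    rw [List.take_length] at h
    exact h
  · refine ⟨⟨?_, ?_, ?_, ?_⟩, by simpa using hreads⟩
    · intro i _; simp [h0, constraintFactors]
    · intro i _; simp [h0, constraintFactors]
    · intro i _; simp [h0, constraintFactors]
    · intro i _ j _ x y; simp [h0, constraintFactors, Cost.enc_zero]
  · rintro k hk M hM ⟨inv1, inv2⟩
    set r := cs[k] with hr
    rw [List.drop_eq_getElem_cons hk, List.flatMap_cons, reads_append, ← hr] at inv2
    set M₁ := M.write .con 0 k with hM₁
    have e1 : ∀ c ≠ Cell.con, M₁ c = M c := fun c hc => write_of_ne _ hc _ _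
    obtain ⟨l1, l2⟩ := hlen r (List.getElem_mem _)
    obtain ⟨q1, q2, q3, q4, q5, q6⟩ := exec_readConstraint (N := N) (k := k) r M₁ l1 l2 hN
      (by rw [e1 _ (by simp), e1 _ (by simp), hM _ rfl]; exact inv2.1)
      (hrow.congr (by rw [e1 _ (by simp), hM _ rfl])) (by simp [hM₁, Mem.write]) (by omega)
    have hget : ∀ i, (cs.take (k + 1))[i]? = if i = k then some r else (cs.take k)[i]? := by
      intro i
      rw [List.getElem?_take, List.getElem?_take]
      by_cases hik : i = k
      · subst hik; simp [hr]
      · by_cases h : i < k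
        · simp [h, hik, (by omega : i < k + 1)]
        · rw [if_neg (by omega), if_neg hik, if_neg h]
    refine ⟨⟨?_, ?_, ?_, ?_⟩, ?_⟩
    · intro i hi
      have e2 : (i ∈ (constraintFactors (cs.take (k + 1))).act) ↔
          i = k ∨ i ∈ (constraintFactors (cs.take k)).act := by
        simp only [constraintFactors, Finset.mem_range, List.length_take]; omega
      rw [q4, Function.update_apply, e1 _ (by simp), inv1.act i hi]
      simp only [Nat.cast_inj, e2]
      by_cases h : i = k <;> simp [h]
    · intro i hi
      rw [q2, Function.update_apply, e1 _ (by simp), inv1.uu i hi]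
      simp only [constraintFactors, hget, Nat.cast_inj]
      split_ifs <;> rfl
    · intro i hi
      rw [q3, Function.update_apply, e1 _ (by simp), inv1.vv i hi]
      simp only [constraintFactors, hget, Nat.cast_inj]
      split_ifs <;> rfl
    · intro i hi j hj x y
      have old : (∀ x' y', addr N i j x y ≠ addr N k 0 x' y') →
          exec N readConstraint M₁ .tab (addr N i j x y) =
          (PowerSeries.coeff j ((constraintFactors (cs.take k)).t i x y)).enc := by
        intro h; rw [q6 _ h, e1 _ (by simp), inv1.tab i hi j hj]
      simp only [Ne, addr_inj hj (by omega : 0 < N)] at old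
      by_cases hik : i = k
      · subst hik
        have : (constraintFactors (cs.take (i + 1))).t i x y =
            if r.test (pair r.first x y) then 1 else 0 := by
          simp [constraintFactors, hr, hk]
        rw [this, enc_coeff_ite]
        split_ifs with hj0
        · rw [hj0, q5]
        -- The indicator of a constraint is a constant series. Entries of positive degree are never
        -- written and still hold the default 0.
        · rw [old (by tauto)]
          simp [constraintFactors, Cost.enc_zero]
      · rw [old (by tauto)]
        simp only [constraintFactors, hget, hik, if_false]
    · rw [q1, e1 _ (by simp)]
      exact inv2.2

/-- The last table was zero, so writing the code of 1 in degree 0 suffices to make all its entries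
the series 1. -/
theorem exec_neutral {N : ℕ} {M₀ : Mem Cell} {F : Factors (PowerSeries Cost)} (hN : 2 ≤ N)
    (hrow : Rows N M₀) (h : Holding N M₀ F) (h0 : F.t (N - 1) = 0) :
    Holding N (exec N neutral M₀) { F with t := Function.update F.t (N - 1) 1 } := by
  have main := rep_bits hN (P := .store .tab (adr (.len - 1) 0 Cell.bx Cell.bz) 1) rfl (M₀ := M₀)
    (fun n M => (∀ x y, num x y < n → M .tab (addr N (N - 1) 0 x y) = 1) ∧
      ∀ z, (∀ x y, z ≠ addr N (N - 1) 0 x y) → M .tab z = M₀ .tab z) ?_ ?_ ?_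
  · obtain ⟨h1, h2⟩ := main
    constructor
    · rw [neutral, exec_of_not_writes _ _ _ _ rfl]; exact h.act
    · rw [neutral, exec_of_not_writes _ _ _ _ rfl]; exact h.uu
    · rw [neutral, exec_of_not_writes _ _ _ _ rfl]; exact h.vv
    · intro i hi j hj x y
      have old : (∀ x' y', addr N i j x y ≠ addr N (N - 1) 0 x' y') →
          exec N neutral M₀ .tab (addr N i j x y) = (PowerSeries.coeff j (F.t i x y)).enc := by
        intro hz; rw [neutral, h2 _ hz, h.tab i hi j hj]
      simp only [Ne, addr_inj hj (by omega : 0 < N)] at old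
      by_cases hiN : i = N - 1
      · subst hiN
        simp only [Function.update_self, Pi.one_apply, PowerSeries.coeff_one]
        split_ifs with hj0
        · subst hj0; exact h1 _ _ (num_lt x y)
        · rw [old (by tauto), h0]; simp
      · rw [old (by tauto)]
        simp only [Function.update_of_ne hiN]
  · rintro n M M' hM ⟨h1, h2⟩
    rw [hM .tab (by simp) (by simp)]
    exact ⟨h1, h2⟩
  · exact ⟨fun _ _ h => by omega, fun _ _ => rfl⟩
  · rintro x y M hM hx hy ⟨h1, h2⟩
    rw [exec_store, eval_adr (hrow.congr (hM _ rfl)) (i' := N - 1) (j' := 0) (x' := x) (y' := y)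
      (by simp; omega) (by omega) rfl (by simpa using hx) (by simpa using hy), eval_one]
    refine ⟨fun x' y' h => ?_, fun z hz => ?_⟩
    · simp only [Mem.write, true_and, addr_inj (by omega : 0 < N) (by omega : 0 < N)]
      rcases num_lt_succ.1 h with h | h
      · rw [h1 _ _ h]; simp
      · simp [h]
    · simp [Mem.write, hz x y, h2 z hz]

/-! ### Elimination of a variable in memory -/

/-- The memory holds the factor `i`. -/
structure HoldsTable (N : ℕ) (M : Mem Cell) (F : Factors (PowerSeries Cost)) (i : ℕ) : Prop where
  lt : i < N
  uu : M .uu i = F.u i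
  vv : M .vv i = F.v i
  tab : ∀ j < N, ∀ x y, M .tab (addr N i j x y) = (PowerSeries.coeff j (F.t i x y)).enc

theorem Holding.holdsTable {N : ℕ} {M : Mem Cell} {F : Factors (PowerSeries Cost)}
    (h : Holding N M F) {i : ℕ} (hi : i < N) : HoldsTable N M F i :=
  ⟨hi, h.uu i hi, h.vv i hi, h.tab i hi⟩

theorem HoldsTable.congr {N i : ℕ} {M M' : Mem Cell} {F : Factors (PowerSeries Cost)}
    (h : HoldsTable N M F i) (hM : ∀ c ∈ [Cell.uu, .vv, .tab], M' c = M c) :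
    HoldsTable N M' F i := by
  refine ⟨h.lt, ?_, ?_, ?_⟩
  · rw [hM _ (by simp)]; exact h.uu
  · rw [hM _ (by simp)]; exact h.vv
  · rw [hM _ (by simp)]; exact h.tab

theorem exec_assignVars {N a p q j₁ : ℕ} {x y : Bool} {M : Mem Cell} (ha : M .a 0 = a)
    (hp : M .p 0 = p) (hq : M .q 0 = q) (hx : M .bx 0 = bit x) (hy : M .bz 0 = bit y)
    (h1 : M .j1 0 = j₁) {c : ℕ} (hc : c = a ∨ c = p ∨ c = q) :
    exec N assignVars M .asg c = bit (Factors.pick a q x y (decide (1 ≤ j₁)) c) := by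
  have hb : (if (1 : ℤ) ≤ j₁ then (1 : ℤ) else 0) = bit (decide (1 ≤ j₁)) := by
    by_cases h : 1 ≤ j₁
    · have : (1 : ℤ) ≤ j₁ := by exact_mod_cast h
      simp [h, this, bit]
    · have : ¬ (1 : ℤ) ≤ j₁ := by exact_mod_cast h
      simp [h, this, bit]
  simp only [assignVars, exec_seq, exec_store, eval_load, eval_const, eval_le, eval_one, Mem.write,
    ha, hp, hq, hx, hy, h1, hb, true_and, Nat.cast_inj, Factors.pick, reduceCtorEq, false_and,
    if_false]
  rcases hc with rfl | rfl | rfl <;> split_ifs <;> simp_all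

/-- The array `asg` holds stale values outside `a`, `p` and `q`. The last hypothesis ensures that
only these three cells are read. -/
theorem exec_fetch {N l i i' j₁ j₂ j₃ a p q : ℕ} {x y : Bool} {F : Factors (PowerSeries Cost)}
    {d : ℕ → PowerSeries Cost} {M : Mem Cell} (hrow : Rows N M) (hown : Own N l M d)
    (hi : HoldsTable N M F i) (hi' : HoldsTable N M F i') (hal : a ≤ l) (hlN : l ≤ N)
    (ha : M .a 0 = a) (hp : M .p 0 = p) (hq : M .q 0 = q)
    (hx : M .bx 0 = bit x) (hy : M .bz 0 = bit y) (hi1 : M .i1 0 = i) (hi2 : M .i2 0 = i')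
    (h1 : M .j1 0 = j₁) (h2 : M .j2 0 = j₂) (h3 : M .j3 0 = j₃)
    (h1N : j₁ < N) (h2N : j₂ < N) (h3N : j₃ < N)
    (hc : ∀ c, c = F.u i ∨ c = F.v i ∨ c = F.u i' ∨ c = F.v i' → c = a ∨ c = p ∨ c = q) :
    exec N fetch M .x1 0 = (PowerSeries.coeff j₁ (d a)).enc ∧
      exec N fetch M .x2 0 = (PowerSeries.coeff j₂
        (F.factor i (Factors.pick a q x y (decide (1 ≤ j₁))))).enc ∧
      exec N fetch M .x3 0 = (PowerSeries.coeff j₃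
        (F.factor i' (Factors.pick a q x y (decide (1 ≤ j₁))))).enc := by
  have hasg := fun c hc => exec_assignVars (N := N) ha hp hq hx hy h1 (c := c) hc
  have f1 : ∀ c ≠ Cell.asg, exec N assignVars M c = M c := fun c hc =>
    exec_of_not_writes _ _ _ _ (by simp [assignVars, LProg.writes, hc])
  simp only [fetch, exec_seq]
  set M₁ := exec N assignVars M with hM₁
  set M₂ := exec N (.x1 ≔ .load .own (adr Cell.a Cell.j1 0 0)) M₁ with hM₂
  have f2 : ∀ c ≠ Cell.x1, M₂ c = M₁ c := fun c hc => write_of_ne _ hc _ _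
  have r1 : Rows N M₁ := hrow.congr (f1 _ (by simp))
  have r2 : Rows N M₂ := r1.congr (f2 _ (by simp))
  have x1 : M₂ .x1 0 = (PowerSeries.coeff j₁ (d a)).enc := by
    rw [hM₂, exec_assign, eval_load, eval_adr_zero r1 (i' := a) (j' := j₁) (by simp [f1, ha])
      (by omega) (by simp [f1, h1]), f1 _ (by simp), hown a hal _ h1N]
    simp [Mem.write]
  set M₃ := exec N (.x2 ≔ .load .tab (adr Cell.i1 Cell.j2 (.load .asg (.load .uu Cell.i1))
        (.load .asg (.load .vv Cell.i1)))) M₂ with hM₃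
  have f3 : ∀ c ≠ Cell.x2, M₃ c = M₂ c := fun c hc => write_of_ne _ hc _ _
  have r3 : Rows N M₃ := r2.congr (f3 _ (by simp))
  have x2 : M₃ .x2 0 = (PowerSeries.coeff j₂
        (F.factor i (Factors.pick a q x y (decide (1 ≤ j₁))))).enc := by
    rw [hM₃, exec_assign, eval_load, eval_adr r2 (i' := i) (j' := j₂)
      (x' := Factors.pick a q x y (decide (1 ≤ j₁)) (F.u i))
      (y' := Factors.pick a q x y (decide (1 ≤ j₁)) (F.v i)) (by simp [f2, f1, hi1])
      hi.lt.le (by simp [f2, f1, h2])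
      (by simp [f2, f1, hi1, hi.uu, hasg _ (hc _ (.inl rfl))])
      (by simp [f2, f1, hi1, hi.vv, hasg _ (hc _ (.inr (.inl rfl)))]), f2 _ (by simp),
      f1 _ (by simp), hi.tab _ h2N]
    simp [Mem.write, Factors.factor]
  refine ⟨?_, ?_, ?_⟩
  · rw [exec_assign, write_of_ne _ (by simp), f3 _ (by simp), x1]
  · rw [exec_assign, write_of_ne _ (by simp), x2]
  · rw [exec_assign, eval_load, eval_adr r3 (i' := i') (j' := j₃)
      (x' := Factors.pick a q x y (decide (1 ≤ j₁)) (F.u i'))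
      (y' := Factors.pick a q x y (decide (1 ≤ j₁)) (F.v i')) (by simp [f3, f2, f1, hi2])
      hi'.lt.le (by simp [f3, f2, f1, h3])
      (by simp [f3, f2, f1, hi2, hi'.uu, hasg _ (hc _ (.inr (.inr (.inl rfl))))])
      (by simp [f3, f2, f1, hi2, hi'.vv, hasg _ (hc _ (.inr (.inr (.inr rfl))))]), f3 _ (by simp),
      f2 _ (by simp), f1 _ (by simp), hi'.tab _ h3N]
    simp [Mem.write, Factors.factor]

theorem exec_join {N l i i' a out : ℕ} {F : Factors (PowerSeries Cost)}
    {d : ℕ → PowerSeries Cost} {g : Bool → PowerSeries Cost} {M₀ : Mem Cell} (hN : 2 ≤ N)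
    (hrow : Rows N M₀) (hown : Own N l M₀ d) (hi : HoldsTable N M₀ F i)
    (hi' : HoldsTable N M₀ F i') (hio : i ≠ out) (hio' : i' ≠ out) (hout : out < N)
    (hal : a ≤ l) (hlN : l ≤ N) (ha : M₀ .a 0 = a)
    (hp : M₀ .p 0 = (F.u i + F.v i - a : ℕ)) (hq : M₀ .q 0 = (F.u i' + F.v i' - a : ℕ))
    (hi1 : M₀ .i1 0 = i) (hi2 : M₀ .i2 0 = i') (hoc : M₀ .out 0 = out)
    (hg : ∀ x j, PowerSeries.coeff j (g x) =
      if decide (1 ≤ j) = x then PowerSeries.coeff j (d a) else 0)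
    (ht : F.u i = a ∨ F.v i = a) (ht' : F.u i' = a ∨ F.v i' = a) :
    (∀ j < N, ∀ x y, exec N join M₀ .tab (addr N out j x y) =
      (PowerSeries.coeff j (F.joint g a i i' x y)).enc) ∧
    ∀ z, (∀ j < N, ∀ x y, z ≠ addr N out j x y) → exec N join M₀ .tab z = M₀ .tab z := by
  have main := rep_bits hN (P := .rep .j .len
    (convolve fetch ;; .store .tab (adr Cell.out Cell.j Cell.bx Cell.bz) Cell.acc)) rfl (M₀ := M₀)
    (fun n M => (∀ j < N, ∀ x y, num x y < n → M .tab (addr N out j x y) =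
      (PowerSeries.coeff j (F.joint g a i i' x y)).enc) ∧
      ∀ z, (∀ j < N, ∀ x y, z ≠ addr N out j x y) → M .tab z = M₀ .tab z) ?_ ?_ ?_
  · exact ⟨fun j hj x y => main.1 j hj x y (num_lt x y), main.2⟩
  · rintro n M M' hM ⟨h1, h2⟩
    rw [hM .tab (by simp) (by simp)]
    exact ⟨h1, h2⟩
  · exact ⟨fun _ _ _ _ h => by omega, fun _ _ => rfl⟩
  · rintro x y M hM hx hy ⟨h1, h2⟩
    have := rep_induction (N := N) (v := .j) (e := .len)
      (P := convolve fetch ;; .store .tab (adr Cell.out Cell.j Cell.bx Cell.bz) Cell.acc)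
      (M₀ := M) (n := N) (by simp) le_rfl
      (fun (k : ℕ) (M : Mem Cell) =>
        -- Complete are the entries for the earlier pairs of truth values, and for the current pair
        -- those of degree below `k`.
        (∀ j < N, ∀ x' y', (num x' y' < num x y ∨ (x' = x ∧ y' = y ∧ j < k)) →
          M .tab (addr N out j x' y') = (PowerSeries.coeff j (F.joint g a i i' x' y')).enc) ∧
        ∀ z, (∀ j < N, ∀ x y, z ≠ addr N out j x y) → M .tab z = M₀ .tab z) ?_ ?_
    · refine ⟨fun j hj x' y' h => this.1 j hj x' y' ?_, this.2⟩
      rcases num_lt_succ.1 h with h | h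
      · exact .inl h
      · exact .inr ⟨h.1, h.2, hj⟩
    · exact ⟨fun j hj x' y' h => h1 j hj x' y' (by tauto), h2⟩
    · rintro k hk M' hM' ⟨inv1, inv2⟩
      set M₁ := M'.write .j 0 k with hM₁
      have f1 : ∀ c ∈ [Cell.row, .own, .uu, .vv, .a, .p, .q, .i1, .i2, .out], M₁ c = M₀ c := by
        intro c hc
        simp only [List.mem_cons, List.not_mem_nil, or_false] at hc
        rcases hc with rfl | rfl | rfl | rfl | rfl | rfl | rfl | rfl | rfl | rfl <;>
          exact (write_of_ne _ (by simp) _ _).trans ((hM' _ rfl).trans (hM _ rfl))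
      have fb : ∀ c ∈ [Cell.bx, .bz], M₁ c = M c := by
        intro c hc
        simp only [List.mem_cons, List.not_mem_nil, or_false] at hc
        rcases hc with rfl | rfl <;>
          exact (write_of_ne _ (by simp) _ _).trans (hM' _ rfl)
      have ft : M₁ .tab = M' .tab := write_of_ne _ (by simp) _ _
      have j1 : M₁ .j 0 = k := by simp [hM₁, Mem.write]
      -- The new table is written while the old ones are still being read; this is safe because it
      -- has an index of its own.
      have table : ∀ {i}, i ≠ out → HoldsTable N M₀ F i → HoldsTable N M₁ F i := by
        intro i hio hi
        refine ⟨hi.lt, ?_, ?_, fun j hj x y => ?_⟩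
        · rw [f1 _ (by simp), hi.uu]
        · rw [f1 _ (by simp), hi.vv]
        · rw [ft, inv2, hi.tab j hj]
          intro j' hj' x' y'
          rw [Ne, addr_inj hj hj']
          tauto
      have t1 := table hio hi
      have t2 := table hio' hi'
      have acc := exec_convolve (N := N) (pre := fetch) (M₀ := M₁) j1
        (by simp [fetch, assignVars, LProg.writes, assign]) (fun j₁ => PowerSeries.coeff j₁ (d a))
        (fun j₁ j₂ => PowerSeries.coeff j₂ (F.factor i
          (Factors.pick a (F.u i' + F.v i' - a) x y (decide (1 ≤ j₁)))))
        (fun j₁ j₃ => PowerSeries.coeff j₃ (F.factor i'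
          (Factors.pick a (F.u i' + F.v i' - a) x y (decide (1 ≤ j₁))))) (by
          intro j₁ hj₁ j₂ hj₂ hle M₂ hM₂ e1 e2 e3
          refine exec_fetch (l := l) (p := F.u i + F.v i - a)
            (hrow.congr ((hM₂ _ rfl).trans (f1 _ (by simp))))
            (hown.congr ((hM₂ _ rfl).trans (f1 _ (by simp)))) (t1.congr ?_) (t2.congr ?_) hal hlN
            (by rw [hM₂ _ rfl, f1 _ (by simp), ha])
            (by rw [hM₂ _ rfl, f1 _ (by simp), hp])
            (by rw [hM₂ _ rfl, f1 _ (by simp), hq])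
            (by rw [hM₂ _ rfl, fb _ (by simp), hx])
            (by rw [hM₂ _ rfl, fb _ (by simp), hy])
            (by rw [hM₂ _ rfl, f1 _ (by simp), hi1])
            (by rw [hM₂ _ rfl, f1 _ (by simp), hi2]) e1 e2 e3 hj₁ hj₂ (by omega) ?_
          · intro c hc
            simp only [List.mem_cons, List.not_mem_nil, or_false] at hc
            rcases hc with rfl | rfl | rfl <;> exact hM₂ _ rfl
          · intro c hc
            simp only [List.mem_cons, List.not_mem_nil, or_false] at hc
            rcases hc with rfl | rfl | rfl <;> exact hM₂ _ rfl
          · intro c hc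
            omega)
      rw [← coeff_sum_mul_mul (fun j₁ => PowerSeries.coeff j₁ (d a)) g
        (fun b => F.factor i (Factors.pick a (F.u i' + F.v i' - a) x y b))
        (fun b => F.factor i' (Factors.pick a (F.u i' + F.v i' - a) x y b)) hg hk] at acc
      rw [exec_seq]
      set M₂ := exec N (convolve fetch) M₁ with hM₂
      have f2 : ∀ c, (convolve fetch).writes c = false → M₂ c = M₁ c := fun c hc =>
        exec_of_not_writes _ _ _ _ hc
      rw [exec_store, eval_adr (hrow.congr ((f2 _ rfl).trans (f1 _ (by simp)))) (i' := out)
        (j' := k) (x' := x) (y' := y) (by simp [f2 .out rfl, f1, hoc]) hout.le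
        (by simp [f2 .j rfl, j1]) (by simp [f2 .bx rfl, fb, hx]) (by simp [f2 .bz rfl, fb, hy]),
        eval_load, eval_const, acc]
      refine ⟨fun j hj x' y' h => ?_, fun z hz => ?_⟩
      · simp only [Mem.write, true_and, addr_inj hj hk]
        split_ifs with hjk
        · obtain ⟨rfl, rfl, rfl⟩ := hjk
          rfl
        · rw [f2 _ rfl, ft]
          refine inv1 j hj x' y' ?_
          rcases h with h | ⟨h1, h2, h3⟩
          · exact .inl h
          · refine .inr ⟨h1, h2, ?_⟩
            have : j ≠ k := by tauto
            omega
      · simp only [Mem.write, true_and]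
        rw [if_neg (hz k hk x y), f2 _ rfl, ft, inv2 z hz]

/-- The two conditionals mirror the branch in `scan`: the first hit goes to `i1`, the next one to
`i2`. -/
theorem Lists.insert {r i j k : ℕ} {T : Finset ℕ} (h : Lists r T i j) (hkr : k ≠ r)
    (hk : k ∉ T) (hcard : T.card ≤ 1) :
    Lists r (insert k T) (if i = r then k else i) (if i = r then j else k) := by
  rcases h with ⟨h1, h2, rfl⟩ | ⟨h1, h2, rfl⟩ | ⟨h1, h2, h3, rfl⟩
  · rw [if_pos h1, if_pos h1]
    exact .inr (.inl ⟨hkr, h2, rfl⟩)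
  · rw [if_neg h1, if_neg h1]
    exact .inr (.inr ⟨h1, hkr, fun h => hk (by simp [h]), Finset.pair_comm _ _⟩)
  · rw [Finset.card_pair h3] at hcard
    omega

theorem Lists.mem {r i j : ℕ} {T : Finset ℕ} (h : Lists r T i j) :
    (i = r ∨ i ∈ T) ∧ (j = r ∨ j ∈ T) := by
  rcases h with ⟨h1, h2, rfl⟩ | ⟨h1, h2, rfl⟩ | ⟨h1, h2, h3, rfl⟩ <;> simp [*]

theorem exec_scan {N a : ℕ} {F : Factors (PowerSeries Cost)} {M₀ : Mem Cell} (hN : 0 < N)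
    (h : Holding N M₀ F) (ha : M₀ .a 0 = a) (hact : ∀ i ∈ F.act, i < N - 1)
    (hcard : (F.touching a).card ≤ 2) :
    ∃ i j, exec N scan M₀ .i1 0 = (i : ℕ) ∧ exec N scan M₀ .i2 0 = (j : ℕ) ∧
      (F.setScope (N - 1) a).Selects (N - 1) a i j ∧
      Holding N (exec N scan M₀) (F.setScope (N - 1) a) := by
  have hr : N - 1 ∉ F.act := fun h => lt_irrefl _ (hact _ h)
  simp only [scan, exec_seq]
  set M₁ := exec N (.store .vv (.len - 1) Cell.a) (exec N (.store .uu (.len - 1) Cell.a)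
    (exec N (.i2 ≔ .len - 1) (exec N (.i1 ≔ .len - 1) M₀))) with hM₁
  have hN1 : (N : ℤ) - 1 = (N - 1 : ℕ) := by omega
  have u1 : M₁ .uu = Function.update (M₀ .uu) ((N - 1 : ℕ) : ℤ) a := by
    funext z
    simp [hM₁, Mem.write, Function.update_apply, ha, hN1]
  have v1 : M₁ .vv = Function.update (M₀ .vv) ((N - 1 : ℕ) : ℤ) a := by
    funext z
    simp [hM₁, Mem.write, Function.update_apply, ha, hN1]
  have f1 : ∀ c, c ≠ .i1 → c ≠ .i2 → c ≠ .uu → c ≠ .vv → M₁ c = M₀ c := fun c h1 h2 h3 h4 =>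
    (write_of_ne _ h4 _ _).trans ((write_of_ne _ h3 _ _).trans
      ((write_of_ne _ h2 _ _).trans (write_of_ne _ h1 _ _)))
  have hold1 : Holding N M₁ (F.setScope (N - 1) a) := by
    constructor
    · rw [f1 _ (by simp) (by simp) (by simp) (by simp)]; exact h.act
    · intro i hi
      simp only [u1, Function.update_apply, Nat.cast_inj, h.uu i hi, Factors.setScope]
      split_ifs <;> rfl
    · intro i hi
      simp only [v1, Function.update_apply, Nat.cast_inj, h.vv i hi, Factors.setScope]
      split_ifs <;> rfl
    · rw [f1 _ (by simp) (by simp) (by simp) (by simp)]; exact h.tab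
  set G := F.setScope (N - 1) a with hG
  have htG : G.touching a = F.touching a := F.touching_setScope hr a a
  have main := rep_induction (N := N) (v := .i) (e := .len - 1)
    (P := .ite (.le 2 (.load .act Cell.i +
        .le 1 (eqE (.load .uu Cell.i) Cell.a + eqE (.load .vv Cell.i) Cell.a)))
      (.ite (eqE Cell.i1 (.len - 1)) (.i1 ≔ Cell.i) (.i2 ≔ Cell.i)) .skip) (M₀ := M₁) (n := N - 1)
    (by simp; omega) (by omega)
    (fun (k : ℕ) (M : Mem Cell) => ∃ i j : ℕ, M .i1 0 = i ∧ M .i2 0 = j ∧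
      Lists (N - 1) ((G.touching a).filter (· < k)) i j) ?_ ?_
  · obtain ⟨i, j, e1, e2, e3⟩ := main
    refine ⟨i, j, e1, e2, ?_, hold1.congr ?_⟩
    · have : (G.touching a).filter (· < N - 1) = G.touching a :=
        Finset.filter_true_of_mem fun i hi => hact i (Finset.mem_filter.1 hi).1
      rw [this] at e3
      exact e3
    · intro c hc
      simp only [List.mem_cons, List.not_mem_nil, or_false] at hc
      rcases hc with rfl | rfl | rfl | rfl <;> exact exec_of_not_writes _ _ _ _ rfl
  · refine ⟨N - 1, N - 1, ?_, ?_, .inl ⟨rfl, rfl, by simp⟩⟩ <;> simp [hM₁, Mem.write] <;> omega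
  · rintro k hk M hM ⟨i, j, e1, e2, e3⟩
    set M₂ := M.write .i 0 k with hM₂
    have f2 : ∀ c ∈ [Cell.act, .uu, .vv, .a], M₂ c = M₁ c := by
      intro c hc
      simp only [List.mem_cons, List.not_mem_nil, or_false] at hc
      rcases hc with rfl | rfl | rfl | rfl <;>
        exact (write_of_ne _ (by simp) _ _).trans (hM _ rfl)
    have i2 : M₂ .i 0 = k := by simp [hM₂, Mem.write]
    have a2 : M₂ .a 0 = a := by
      rw [f2 _ (by simp), f1 _ (by simp) (by simp) (by simp) (by simp), ha]
    have hi1 : M₂ .i1 0 = i := by rw [hM₂, write_of_ne _ (by simp), e1]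
    have hi2 : M₂ .i2 0 = j := by rw [hM₂, write_of_ne _ (by simp), e2]
    have hcond : Ex.eval N M₂ (.le 2 (.load .act Cell.i +
        .le 1 (eqE (.load .uu Cell.i) Cell.a + eqE (.load .vv Cell.i) Cell.a))) =
        if k ∈ G.touching a then 1 else 0 := by
      simp only [eval_le, eval_add, eval_load, eval_const, eval_eqE, eval_one, eval_two, i2, a2,
        f2 .act (by simp), f2 .uu (by simp), f2 .vv (by simp), hold1.act k (by omega),
        hold1.uu k (by omega), hold1.vv k (by omega), Nat.cast_inj, Factors.touching,
        Finset.mem_filter]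
      by_cases q1 : k ∈ G.act <;> by_cases q2 : G.u k = a <;> by_cases q3 : G.v k = a <;>
        simp [q1, q2, q3]
    rw [exec_ite, hcond]
    by_cases hkt : k ∈ G.touching a
    · have hins : (G.touching a).filter (· < k + 1) =
          insert k ((G.touching a).filter (· < k)) := by
        ext c
        simp only [Finset.mem_filter, Finset.mem_insert]
        constructor
        · rintro ⟨h1, h2⟩
          by_cases hck : c = k
          · exact .inl hck
          · exact .inr ⟨h1, by omega⟩
        · rintro (rfl | ⟨h1, h2⟩)
          · exact ⟨hkt, by omega⟩
          · exact ⟨h1, by omega⟩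
      have hnot : k ∉ (G.touching a).filter (· < k) := by simp
      -- There are at most two factors on `a` and `k` is one of them, so at most one was found
      -- before and the second slot is still free.
      have hc1 : ((G.touching a).filter (· < k)).card ≤ 1 := by
        have h1 := Finset.card_le_card (Finset.filter_subset (· < k + 1) (G.touching a))
        rw [hins, Finset.card_insert_of_notMem hnot] at h1
        rw [htG] at h1 ⊢
        omega
      have key := e3.insert (by omega : k ≠ N - 1) hnot hc1
      rw [← hins] at key
      rw [if_pos hkt, if_pos one_ne_zero, exec_ite]
      refine ⟨_, _, ?_, ?_, key⟩ <;>
      · simp only [eval_eqE, eval_load, eval_const, eval_sub, eval_len, eval_one, hi1, hN1,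
          Nat.cast_inj]
        by_cases hiN : i = N - 1
        · simp [hiN, Mem.write, i2, hi2]
        · simp [hiN, Mem.write, i2, hi1]
    · rw [if_neg hkt, if_neg (by simp), exec_skip]
      refine ⟨i, j, hi1, hi2, ?_⟩
      convert e3 using 1
      refine Finset.filter_congr fun c hc => ?_
      have : c ≠ k := fun h => hkt (h ▸ hc)
      omega

theorem exec_eliminateVar {N l n a : ℕ} {F : Factors (PowerSeries Cost)}
    {d : ℕ → PowerSeries Cost} {g : Bool → PowerSeries Cost} {M₀ : Mem Cell} (hN : 2 ≤ N)
    (hrow : Rows N M₀) (hown : Own N l M₀ d) (h : Holding N M₀ F) (ha : M₀ .a 0 = a)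
    (hal : a ≤ l) (hlN : l ≤ N) (hn : M₀ .inp 2 = n) (hout : n + a < N - 1)
    (hact : ∀ i ∈ F.act, i < n + a) (hcard : (F.touching a).card ≤ 2)
    (hg : ∀ x j, PowerSeries.coeff j (g x) =
      if decide (1 ≤ j) = x then PowerSeries.coeff j (d a) else 0) :
    ∃ i j, (F.setScope (N - 1) a).Selects (N - 1) a i j ∧
      Holding N (exec N eliminateVar M₀) ((F.setScope (N - 1) a).eliminate g a i j (n + a)) := by
  obtain ⟨i, i', hi, hi', hsel, hold⟩ := exec_scan (by omega) h ha
    (fun i hi => (hact i hi).trans hout) hcard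
  refine ⟨i, i', hsel, ?_⟩
  set G := F.setScope (N - 1) a with hG
  obtain ⟨ht, ht'⟩ := hsel.touches (by simp [hG, Factors.setScope])
  obtain ⟨hm, hm'⟩ := Lists.mem hsel
  -- A selected factor is either the neutral one, with index N - 1 above the output index n + a, or
  -- an active one, with an index below it.
  have hb : ∀ {c}, (c = N - 1 ∨ c ∈ G.touching a) → c < N ∧ c ≠ n + a := by
    rintro c (hc | hc)
    · omega
    · have := hact c (Finset.mem_filter.1 hc).1
      omega
  obtain ⟨hiN, hio⟩ := hb hm
  obtain ⟨hiN', hio'⟩ := hb hm'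
  rw [eliminateVar, exec_seq]
  set M₁ := exec N scan M₀ with hM₁
  have f1 : ∀ c ∈ [Cell.row, .own, .a, .inp], M₁ c = M₀ c := by
    intro c hc
    simp only [List.mem_cons, List.not_mem_nil, or_false] at hc
    rcases hc with rfl | rfl | rfl | rfl <;> exact exec_of_not_writes _ _ _ _ rfl
  rw [exec_seq, exec_seq, exec_seq, exec_seq]
  set M₂ := exec N (.p ≔ .load .uu Cell.i1 + .load .vv Cell.i1 - Cell.a) M₁ with hM₂
  set M₃ := exec N (.q ≔ .load .uu Cell.i2 + .load .vv Cell.i2 - Cell.a) M₂ with hM₃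
  set M₄ := exec N (.out ≔ .load .inp 2 + Cell.a) M₃ with hM₄
  have f2 : ∀ c, c ≠ .p → M₂ c = M₁ c := fun c h => write_of_ne _ h _ _
  have f3 : ∀ c, c ≠ .q → M₃ c = M₂ c := fun c h => write_of_ne _ h _ _
  have f4 : ∀ c, c ≠ .out → M₄ c = M₃ c := fun c h => write_of_ne _ h _ _
  have f24 : ∀ c, c ≠ .p → c ≠ .q → c ≠ .out → M₄ c = M₁ c := fun c h1 h2 h3 =>
    (f4 c h3).trans ((f3 c h2).trans (f2 c h1))
  have a1 : M₁ .a 0 = a := by rw [f1 _ (by simp), ha]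
  have p4 : M₄ .p 0 = (G.u i + G.v i - a : ℕ) := by
    rw [f4 _ (by simp), f3 _ (by simp), hM₂]
    simp [Mem.write, hi, a1, hold.uu i hiN, hold.vv i hiN]
    omega
  have q4 : M₄ .q 0 = (G.u i' + G.v i' - a : ℕ) := by
    rw [f4 _ (by simp), hM₃]
    simp [Mem.write, f2, hi', a1, hold.uu i' hiN', hold.vv i' hiN']
    omega
  have out4 : M₄ .out 0 = (n + a : ℕ) := by
    simp [hM₄, Mem.write, f3, f2, a1, f1, hn]
  have hold4 : Holding N M₄ G := hold.congr fun c hc => by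
    simp only [List.mem_cons, List.not_mem_nil, or_false] at hc
    rcases hc with rfl | rfl | rfl | rfl <;> exact f24 _ (by simp) (by simp) (by simp)
  have i14 : M₄ .i1 0 = i := by rw [f24 _ (by simp) (by simp) (by simp), hi]
  have i24 : M₄ .i2 0 = i' := by rw [f24 _ (by simp) (by simp) (by simp), hi']
  obtain ⟨t1, t2⟩ := exec_join (i := i) (i' := i') (a := a) (out := n + a) (F := G) (d := d)
    (g := g) (M₀ := M₄) hN
    (hrow.congr ((f24 _ (by simp) (by simp) (by simp)).trans (f1 _ (by simp))))
    (hown.congr ((f24 _ (by simp) (by simp) (by simp)).trans (f1 _ (by simp))))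
    (hold4.holdsTable hiN) (hold4.holdsTable hiN') hio hio' (by omega) hal hlN
    (by rw [f24 _ (by simp) (by simp) (by simp), a1]) p4 q4 i14 i24 out4 hg ht ht'
  set M₅ := exec N join M₄ with hM₅
  have f5 : ∀ c ∈ [Cell.i1, .i2, .out, .p, .q, .act, .uu, .vv], M₅ c = M₄ c := by
    intro c hc
    simp only [List.mem_cons, List.not_mem_nil, or_false] at hc
    rcases hc with rfl | rfl | rfl | rfl | rfl | rfl | rfl | rfl <;>
      exact exec_of_not_writes _ _ _ _ rfl
  constructor
  · intro c hc
    have e := hold4.act c hc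
    simp only [replaceFactors, exec_seq, exec_store, Mem.write, eval_load, eval_const, eval_zero,
      eval_one, f5 .i1 (by simp), f5 .i2 (by simp), f5 .out (by simp), f5 .act (by simp), i14, i24,
      out4, e, Nat.cast_inj, true_and, reduceCtorEq, false_and, if_false, Factors.eliminate,
      Finset.mem_insert, Finset.mem_erase]
    by_cases q1 : c = n + a
    · simp [q1]
    by_cases q2 : c = i'
    · simp [q2]
    by_cases q3 : c = i
    · simp [q3]
    simp [q1, q2, q3]
  · intro c hc
    have e := hold4.uu c hc
    simp only [replaceFactors, exec_seq, exec_store, Mem.write, eval_load, eval_const,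
      f5 .out (by simp), f5 .uu (by simp), f5 .p (by simp),
      out4, p4, e, Nat.cast_inj, true_and, reduceCtorEq, false_and, if_false, Factors.eliminate,
      Function.update_apply]
    split_ifs <;> rfl
  · intro c hc
    have e := hold4.vv c hc
    simp only [replaceFactors, exec_seq, exec_store, Mem.write, eval_load, eval_const,
      f5 .out (by simp), f5 .vv (by simp), f5 .q (by simp),
      out4, q4, e, Nat.cast_inj, true_and, reduceCtorEq, false_and, if_false, Factors.eliminate,
      Function.update_apply]
    split_ifs <;> rfl
  · intro c hc j hj x y
    rw [exec_of_not_writes _ .tab replaceFactors _ rfl]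
    by_cases q : c = n + a
    · subst q
      rw [t1 j hj]
      simp [Factors.eliminate]
    · rw [t2, hold4.tab c hc j hj]
      · simp [Factors.eliminate, q]
      · intro j' hj' x' y'
        rw [Ne, addr_inj hj hj']
        tauto

/-- After the variables below `a` are eliminated, the product of the active factors is the partial
sum `sumOver` up to `a`. The degree bound is kept only for the variables from `a` on: an eliminated
variable may survive as a dummy variable of any number of factors, because missing factors lend it
to the new ones. -/
theorem exec_eliminateAll {N l n : ℕ} {F : Factors (PowerSeries Cost)}
    {d : ℕ → PowerSeries Cost} {g : ℕ → Bool → PowerSeries Cost} {M₀ : Mem Cell} (hN : 2 ≤ N)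
    (hrow : Rows N M₀) (hown : Own N l M₀ d) (h : Holding N M₀ F) (hl : M₀ .inp 1 = l)
    (hn : M₀ .inp 2 = n) (hN' : n + l + 1 ≤ N - 1) (hact : ∀ i ∈ F.act, i < n)
    (hcard : ∀ b, (F.touching b).card ≤ 2) (hneu : F.t (N - 1) = 1)
    (hg : ∀ a x j, PowerSeries.coeff j (g a x) =
      if decide (1 ≤ j) = x then PowerSeries.coeff j (d a) else 0) :
    ∃ G : Factors (PowerSeries Cost), Holding N (exec N eliminateAll M₀) G ∧
      (∀ i ∈ G.act, i < N) ∧ G.t (N - 1) = 1 ∧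
      ∀ X, G.value X = sumOver g F.value (l + 1) X := by
  have main := rep_induction (N := N) (v := .a) (e := .load .inp 1 + 1) (P := eliminateVar)
    (M₀ := M₀) (n := l + 1) (by simp [hl]) (by omega)
    (fun (a : ℕ) (M : Mem Cell) => ∃ G : Factors (PowerSeries Cost), Holding N M G ∧
      (∀ i ∈ G.act, i < n + a) ∧ G.t (N - 1) = 1 ∧ (∀ b, a ≤ b → (G.touching b).card ≤ 2) ∧
      ∀ X, G.value X = sumOver g F.value a X) ?_ ?_
  · obtain ⟨G, h1, h2, h3, -, h4⟩ := main
    exact ⟨G, h1, fun i hi => (h2 i hi).trans (by omega), h3, h4⟩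
  · exact ⟨F, h, hact, hneu, fun b _ => hcard b, fun _ => rfl⟩
  · rintro a hal M hM ⟨G, h1, h2, h3, h4, h5⟩
    set M₁ := M.write .a 0 a with hM₁
    have f1 : ∀ c, c ≠ .a → M₁ c = M c := fun c h => write_of_ne _ h _ _
    have f0 : ∀ c ∈ [Cell.row, .own, .inp], M₁ c = M₀ c := by
      intro c hc
      simp only [List.mem_cons, List.not_mem_nil, or_false] at hc
      rcases hc with rfl | rfl | rfl <;> exact (f1 _ (by simp)).trans (hM _ rfl)
    obtain ⟨i, j, hsel, hold⟩ := exec_eliminateVar (a := a) (M₀ := M₁) (g := g a) hN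
      (hrow.congr (f0 _ (by simp))) (hown.congr (f0 _ (by simp)))
      (h1.congr fun c hc => f1 c (by rintro rfl; simp at hc)) (by simp [hM₁, Mem.write])
      (by omega) (by omega) (by rw [f0 _ (by simp), hn]) (by omega) h2 (h4 a le_rfl) (hg a)
    have hr : N - 1 ∉ G.act := fun h => by have := h2 _ h; omega
    have hk : n + a ∉ (G.setScope (N - 1) a).act := fun h => by have := h2 _ h; omega
    have hru : (G.setScope (N - 1) a).u (N - 1) = a := by simp [Factors.setScope]
    have hrv : (G.setScope (N - 1) a).v (N - 1) = a := by simp [Factors.setScope]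
    refine ⟨_, hold, ?_, ?_, ?_, ?_⟩
    · intro c hc
      simp only [Factors.eliminate, Finset.mem_insert, Finset.mem_erase] at hc
      rcases hc with hc | hc
      · omega
      · have := h2 c hc.2.2; omega
    · have : N - 1 ≠ n + a := by omega
      simp only [Factors.eliminate, Function.update_of_ne this]
      exact h3
    · intro b hb
      refine (Factors.card_touching_eliminate (F := G.setScope (N - 1) a) hr hru hrv hk hsel (g a) (by omega)).trans ?_
      rw [G.touching_setScope hr]
      exact h4 b (by omega)
    · intro X
      rw [Factors.value_eliminate (F := G.setScope (N - 1) a) hr hru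
        (fun x y => congrFun (congrFun h3 x) y) hk hsel, sumOver]
      simp only [G.value_setScope hr, h5]

/-! ### The product of the remaining factors -/

theorem exec_multiplyFetch {N i c j₁ j₂ j₃ : ℕ} {M : Mem Cell} {G : Factors (PowerSeries Cost)}
    {s : PowerSeries Cost} (hrow : Rows N M) (ht : HoldsTable N M G c) (hi : M .i 0 = i)
    (hiN : i ≤ N) (hfin : ∀ j < N, M .fin (addr N i j false false) = (PowerSeries.coeff j s).enc)
    (hc : M .i1 0 = c) (h1 : M .j1 0 = j₁) (h2 : M .j2 0 = j₂) (h3 : M .j3 0 = j₃)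
    (h1N : j₁ < N) (h2N : j₂ < N) :
    exec N multiplyFetch M .x1 0 = (PowerSeries.coeff j₁ s).enc ∧
      exec N multiplyFetch M .x2 0 = (PowerSeries.coeff j₂ (G.t c false false)).enc ∧
      exec N multiplyFetch M .x3 0 = (PowerSeries.coeff j₃ (1 : PowerSeries Cost)).enc := by
  simp only [multiplyFetch, exec_seq]
  set M₁ := exec N (.x1 ≔ .load .fin (adr Cell.i Cell.j1 0 0)) M with hM₁
  have f1 : ∀ c, c ≠ .x1 → M₁ c = M c := fun c h => write_of_ne _ h _ _
  have x1 : M₁ .x1 0 = (PowerSeries.coeff j₁ s).enc := by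
    rw [hM₁, exec_assign, eval_load, eval_adr_zero hrow (i' := i) (j' := j₁) (by simp [hi]) hiN
      (by simp [h1]), hfin _ h1N]
    simp [Mem.write]
  set M₂ := exec N (.x2 ≔ .load .tab (adr Cell.i1 Cell.j2 0 0)) M₁ with hM₂
  have f2 : ∀ c, c ≠ .x2 → M₂ c = M₁ c := fun c h => write_of_ne _ h _ _
  have x2 : M₂ .x2 0 = (PowerSeries.coeff j₂ (G.t c false false)).enc := by
    rw [hM₂, exec_assign, eval_load, eval_adr_zero (hrow.congr (f1 _ (by simp))) (i' := c)
      (j' := j₂) (by simp [f1, hc]) ht.lt.le (by simp [f1, h2]), f1 _ (by simp), ht.tab _ h2N]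
    simp [Mem.write]
  refine ⟨?_, ?_, ?_⟩
  · rw [exec_assign, write_of_ne _ (by simp), f2 _ (by simp), x1]
  · rw [exec_assign, write_of_ne _ (by simp), x2]
  · rw [PowerSeries.coeff_one]
    simp only [exec_assign, Mem.write, eval_le, eval_load, eval_const, eval_zero,
      f2 .j3 (by simp), f1 .j3 (by simp), h3]
    by_cases h : j₃ = 0
    · simp [h, Cost.enc_one]
    · have : ¬ (j₃ : ℤ) ≤ 0 := by omega
      rw [if_neg this, if_neg h, Cost.enc_zero]
      simp

theorem exec_multiplyRow {N i c : ℕ} {M₀ : Mem Cell} {G : Factors (PowerSeries Cost)}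
    {s : PowerSeries Cost} (hrow : Rows N M₀) (ht : HoldsTable N M₀ G c) (hi : M₀ .i 0 = i)
    (hiN : i < N) (hfin : ∀ j < N, M₀ .fin (addr N i j false false) = (PowerSeries.coeff j s).enc)
    (hc : M₀ .i1 0 = c) {j : ℕ} (hj : j < N) :
    exec N (.rep .j .len multiplyEntry) M₀ .fin (addr N (i + 1) j false false) =
      (PowerSeries.coeff j (s * G.t c false false)).enc := by
  have main := rep_induction (N := N) (v := .j) (e := .len) (P := multiplyEntry) (M₀ := M₀)
    (n := N) (by simp) le_rfl
    (fun (k : ℕ) (M : Mem Cell) =>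
      (∀ j < N, j < k → M .fin (addr N (i + 1) j false false) =
        (PowerSeries.coeff j (s * G.t c false false)).enc) ∧
      ∀ j < N, M .fin (addr N i j false false) = (PowerSeries.coeff j s).enc) ?_ ?_
  · exact main.1 j hj hj
  · exact ⟨fun _ _ h => by omega, hfin⟩
  · rintro k hk M hM ⟨inv1, inv2⟩
    set M₁ := M.write .j 0 k with hM₁
    have f1 : ∀ c ∈ [Cell.row, .uu, .vv, .tab, .i, .i1], M₁ c = M₀ c := by
      intro c hc
      simp only [List.mem_cons, List.not_mem_nil, or_false] at hc
      rcases hc with rfl | rfl | rfl | rfl | rfl | rfl <;>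
        exact (write_of_ne _ (by simp) _ _).trans (hM _ rfl)
    have fin1 : M₁ .fin = M .fin := write_of_ne _ (by simp) _ _
    have j1 : M₁ .j 0 = k := by simp [hM₁, Mem.write]
    have acc := exec_convolve (N := N) (pre := multiplyFetch) (M₀ := M₁) j1
      (by simp [multiplyFetch, LProg.writes, assign]) (fun j₁ => PowerSeries.coeff j₁ s)
      (fun _ j₂ => PowerSeries.coeff j₂ (G.t c false false))
      (fun _ j₃ => PowerSeries.coeff j₃ (1 : PowerSeries Cost)) (by
        intro j₁ hj₁ j₂ hj₂ hle M₂ hM₂ e1 e2 e3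
        refine exec_multiplyFetch (i := i) (hrow.congr ((hM₂ _ rfl).trans (f1 _ (by simp))))
          (ht.congr fun c hc => ?_) (by rw [hM₂ _ rfl, f1 _ (by simp), hi]) hiN.le
          (by rw [hM₂ _ rfl, fin1]; exact inv2) (by rw [hM₂ _ rfl, f1 _ (by simp), hc])
          e1 e2 e3 hj₁ hj₂
        simp only [List.mem_cons, List.not_mem_nil, or_false] at hc
        rcases hc with rfl | rfl | rfl <;> exact (hM₂ _ rfl).trans (f1 _ (by simp)))
    rw [← coeff_mul_mul _ _ _ hk, mul_one] at acc
    rw [multiplyEntry, exec_seq]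
    set M₂ := exec N (convolve multiplyFetch) M₁ with hM₂
    have f2 : ∀ c, (convolve multiplyFetch).writes c = false → M₂ c = M₁ c := fun c hc =>
      exec_of_not_writes _ _ _ _ hc
    rw [exec_store, eval_adr_zero (hrow.congr ((f2 _ rfl).trans (f1 _ (by simp)))) (i' := i + 1)
      (j' := k) (by simp [f2 .i rfl, f1, hi]) hiN (by simp [f2 .j rfl, j1]),
      eval_load, eval_const, acc]
    refine ⟨fun j hj hjk => ?_, fun j hj => ?_⟩
    · simp only [Mem.write, true_and, addr_inj hj hk]
      split_ifs with h
      · rw [h.1]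
      · rw [f2 _ rfl, fin1]
        refine inv1 j hj ?_
        have : j ≠ k := by tauto
        omega
    · simp only [Mem.write, true_and, addr_inj hj hk]
      rw [if_neg (by omega), f2 _ rfl, fin1, inv2 j hj]

/-- Inactive indices are replaced by the neutral factor, so each of the N rounds is a multiplication
and row i + 1 of `fin` arises from row i. Reading the tables at false, false evaluates the product
at the assignment that is false everywhere. -/
theorem exec_multiply {N : ℕ} {M₀ : Mem Cell} {G : Factors (PowerSeries Cost)} (hN : 0 < N)
    (hrow : Rows N M₀) (h : Holding N M₀ G) (hact : ∀ i ∈ G.act, i < N)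
    (hneu : G.t (N - 1) = 1) (h0 : M₀ .fin = 0) {j : ℕ} (hj : j < N) :
    exec N multiply M₀ .fin (addr N N j false false) =
      (PowerSeries.coeff j (G.value fun _ => false)).enc := by
  rw [multiply, exec_seq]
  set M₁ := exec N (.store .fin 0 1) M₀ with hM₁
  have f1 : ∀ c, c ≠ .fin → M₁ c = M₀ c := fun c h => write_of_ne _ h _ _
  have main := rep_induction (N := N) (v := .i) (e := .len)
    (P := multiplySelect ;; .rep .j .len multiplyEntry) (M₀ := M₁)
    (n := N) (by simp) le_rfl
    (fun (k : ℕ) (M : Mem Cell) => ∀ j < N, M .fin (addr N k j false false) =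
      (PowerSeries.coeff j (∏ i ∈ G.act.filter (· < k), G.t i false false)).enc) ?_ ?_
  · refine (main j hj).trans ?_
    rw [Finset.filter_true_of_mem hact]
    rfl
  · intro j hj
    have e : addr N 0 0 false false = 0 := by simp [addr, bit]
    have e' : addr N 0 j false false = 0 ↔ j = 0 := by
      rw [← e, addr_inj hj hN]; simp
    simp only [hM₁, exec_store, Mem.write, eval_zero, eval_one, true_and, e', h0, not_lt_zero,
      Finset.filter_false, Finset.prod_empty, PowerSeries.coeff_one]
    split_ifs
    · rfl
    · rfl
  · intro k hk M hM inv
    set M₂ := M.write .i 0 k with hM₂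
    have f2 : ∀ c ∈ [Cell.row, .act, .uu, .vv, .tab], M₂ c = M₀ c := by
      intro c hc
      simp only [List.mem_cons, List.not_mem_nil, or_false] at hc
      rcases hc with rfl | rfl | rfl | rfl | rfl <;>
        exact (write_of_ne _ (by simp) _ _).trans ((hM _ rfl).trans (f1 _ (by simp)))
    have fin2 : M₂ .fin = M .fin := write_of_ne _ (by simp) _ _
    have i2 : M₂ .i 0 = k := by simp [hM₂, Mem.write]
    rw [exec_seq]
    set M₃ := exec N multiplySelect M₂ with hM₃
    have f3 : ∀ c, c ≠ .i1 → M₃ c = M₂ c := fun c hc =>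
      exec_of_not_writes _ _ _ _ (by simp [multiplySelect, LProg.writes, assign, hc])
    have i13 : M₃ .i1 0 = ((if k ∈ G.act then k else N - 1 : ℕ) : ℤ) := by
      simp only [hM₃, multiplySelect, exec_seq, exec_ite, exec_assign, eval_load, eval_const,
        eval_sub, eval_len, eval_one, write_of_ne _ (by simp : Cell.act ≠ .i1),
        write_of_ne _ (by simp : Cell.i ≠ .i1), i2, f2 .act (by simp), h.act k hk]
      by_cases hk' : k ∈ G.act
      · simp [hk', Mem.write]
      · simp [hk', Mem.write]; omega
    have ht : HoldsTable N M₃ G (if k ∈ G.act then k else N - 1) := by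
      refine (h.holdsTable (by split_ifs <;> omega)).congr fun c hc => ?_
      simp only [List.mem_cons, List.not_mem_nil, or_false] at hc
      rcases hc with rfl | rfl | rfl <;> exact (f3 _ (by simp)).trans (f2 _ (by simp))
    intro j hj
    refine (exec_multiplyRow (hrow.congr ((f3 _ (by simp)).trans (f2 _ (by simp)))) ht
      (by rw [f3 _ (by simp), i2]) hk (by rw [f3 _ (by simp), fin2]; exact inv) i13 hj).trans ?_
    congr 2
    by_cases hk' : k ∈ G.act
    · have : G.act.filter (· < k + 1) = insert k (G.act.filter (· < k)) := by
        ext c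
        simp only [Finset.mem_filter, Finset.mem_insert]
        constructor
        · rintro ⟨h1, h2⟩
          by_cases hck : c = k
          · exact .inl hck
          · exact .inr ⟨h1, by omega⟩
        · rintro (rfl | ⟨h1, h2⟩)
          · exact ⟨hk', by omega⟩
          · exact ⟨h1, by omega⟩
      rw [if_pos hk', this, Finset.prod_insert (by simp), mul_comm]
    · rw [if_neg hk', hneu]
      simp only [Pi.one_apply, mul_one]
      refine Finset.prod_congr (Finset.filter_congr fun c hc => ?_) fun _ _ => rfl
      have : c ≠ k := fun h => hk' (h ▸ hc)
      omega

/-! ### Correctness -/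

theorem Formula.one_le_occ {l : ℕ} {a : Fin l} {f : Formula (Fin l)} (h : a ∈ f.attrs) :
    1 ≤ f.occ a := by
  induction f with
  | lit p b =>
    obtain rfl : a = b := by simpa [attrs] using h
    simp [occ]
  | and f g hf hg =>
    rw [occ]
    rcases Finset.mem_union.1 h with h | h
    · have := hf h; omega
    · have := hg h; omega
  | or f g hf hg =>
    rw [occ]
    rcases Finset.mem_union.1 h with h | h
    · have := hf h; omega
    · have := hg h; omega

theorem Constraint.one_le_occ {l : ℕ} {a : Fin l} {r : Constraint (Fin l)} (h : a ∈ r.attrs) :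
    1 ≤ r.occ a := by
  rw [occ]
  rcases Finset.mem_union.1 h with h | h
  · have := Formula.one_le_occ h; omega
  · have := Formula.one_le_occ h; omega

theorem card_filter_range_le_sum {α : Type} (L : List α) (f : α → ℕ) (p : ℕ → Prop)
    [DecidablePred p] (h : ∀ i (hi : i < L.length), p i → 1 ≤ f L[i]) :
    ((Finset.range L.length).filter p).card ≤ (L.map f).sum := by
  have e : (L.map f).sum = ∑ i ∈ Finset.range L.length, (L[i]?).elim 0 f := by
    clear h
    induction L with
    | nil => simp
    | cons x L ih =>
      rw [List.map_cons, List.sum_cons, List.length_cons, Finset.sum_range_succ', ih, add_comm]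
      simp
  rw [e, Finset.card_filter]
  refine Finset.sum_le_sum fun i hi => ?_
  rw [Finset.mem_range] at hi
  split_ifs with hp
  · simpa [hi] using h i hi hp
  · exact Nat.zero_le _

/-- Both variables of a constraint factor occur in that constraint, so the factors on `b` are at
most as many as the occurrences of `b`. Indices from `l` on, such as that of the class without
attribute, occur in no constraint. -/
theorem touching_constraintFactors {I : Instance} (hocc : ∀ a, I.occ a ≤ 2) (b : ℕ) :
    ((constraintFactors I.constraints).touching b).card ≤ 2 := by
  have mem : ∀ i (hi : i < I.constraints.length),
      (constraintFactors I.constraints).u i = b ∨ (constraintFactors I.constraints).v i = b →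
      ∃ a ∈ I.constraints[i].attrs, (a : ℕ) = b := by
    intro i hi h
    simp only [constraintFactors, List.getElem?_eq_getElem hi, Option.elim_some] at h
    rcases h with h | h
    · rw [← h]; exact I.constraints[i].first_mem
    · rw [← h]; exact I.constraints[i].second_mem
  by_cases hb : b < I.l
  · refine (card_filter_range_le_sum I.constraints (fun r => r.occ ⟨b, hb⟩) _ ?_).trans
      (hocc ⟨b, hb⟩)
    intro i hi h
    obtain ⟨a, ha, hab⟩ := mem i hi h
    obtain rfl : a = ⟨b, hb⟩ := Fin.ext hab
    exact Constraint.one_le_occ ha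
  · have : (constraintFactors I.constraints).touching b = ∅ := by
      refine Finset.filter_eq_empty_iff.2 fun i hi h => ?_
      obtain ⟨a, -, hab⟩ := mem i (Finset.mem_range.1 hi) h
      have := a.2
      omega
    simp [this]

open Classical in
theorem value_constraintFactors {l : ℕ} {cs : List (Constraint (Fin l))}
    (hcs : ∀ r ∈ cs, r.attrs.card ≤ 2) (X : ℕ → Bool) :
    (constraintFactors cs).value X =
      if ∀ r ∈ cs, r.Holds fun a : Fin l => X a = true then 1 else 0 := by
  have e : ∀ i (hi : i < cs.length), (constraintFactors cs).factor i X =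
      if cs[i].Holds fun a : Fin l => X a = true then 1 else 0 := by
    intro i hi
    simp only [Factors.factor, constraintFactors, List.getElem?_eq_getElem hi, Option.elim_some]
    rw [← Constraint.test_eq_pair (hcs _ (List.getElem_mem hi))]
    simp only [Constraint.test_iff]
  unfold Factors.value
  split_ifs with h
  · refine Finset.prod_eq_one fun i hi => ?_
    rw [e i (Finset.mem_range.1 hi), if_pos (h _ (List.getElem_mem _))]
  · push Not at h
    obtain ⟨r, hr, hr'⟩ := h
    obtain ⟨i, hi, rfl⟩ := List.getElem_of_mem hr
    refine Finset.prod_eq_zero (Finset.mem_range.2 hi) ?_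
    rw [e i hi, if_neg hr']

theorem mul_length_le_length_flatMap {α β : Type} (L : List α) (f : α → List β) (c : ℕ)
    (h : ∀ x ∈ L, c ≤ (f x).length) : c * L.length ≤ (L.flatMap f).length := by
  induction L with
  | nil => simp
  | cons x L ih =>
    have h1 := h x (by simp)
    have h2 := ih fun y hy => h y (by simp [hy])
    simp only [List.length_cons, List.flatMap_cons, List.length_append, mul_add]
    omega

theorem length_le_length_flatMap {α β : Type} {L : List α} (f : α → List β) {x : α} (h : x ∈ L) :
    (f x).length ≤ (L.flatMap f).length := by
  rw [List.length_flatMap]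
  exact List.le_sum_of_mem (List.mem_map_of_mem h)

namespace Instance

variable (I : Instance)

theorem length_encode : I.encode.length = 5 + I.l +
    ((List.finRange I.m).flatMap I.encodeCandidate).length +
    (I.constraints.flatMap Constraint.encode).length := by
  simp [encode]
  omega

theorem length_encode_ge : 5 + I.l + I.m + I.constraints.length ≤ I.encode.length := by
  have h1 := mul_length_le_length_flatMap (List.finRange I.m) I.encodeCandidate 1
    fun c _ => by simp [encodeCandidate]
  have h2 := mul_length_le_length_flatMap I.constraints Constraint.encode 1
    fun r _ => by simp [Constraint.encode, Formula.encode]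
  rw [List.length_finRange] at h1
  rw [length_encode]
  omega

theorem length_tokens_le {r : Constraint (Fin I.l)} (hr : r ∈ I.constraints) :
    r.lhs.tokens.length ≤ I.encode.length ∧ r.rhs.tokens.length ≤ I.encode.length := by
  have h := length_le_length_flatMap Constraint.encode hr
  rw [length_encode]
  simp only [Constraint.encode, Formula.encode, List.length_append, List.length_cons] at h
  omega

variable {I}

theorem override_attrOf (hcard : ∀ c, (I.attributes c).card ≤ 1) (W : Finset (Fin I.m))
    (X : ℕ → Bool) : (fun a : Fin I.l => override I.attrOf (I.l + 1) W X a = true) =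
      I.assignment W := by
  funext a
  have := a.2
  simp only [override, assignment, if_pos (by omega : (a : ℕ) < I.l + 1), decide_eq_true_eq,
    mem_attributes_iff (hcard _)]

end Instance

theorem exec_program {I : Instance} (hcard : ∀ c, (I.attributes c).card ≤ 1)
    (hocc : ∀ a, I.occ a ≤ 2) :
    exec I.encode.length program (start .inp I.encode) .inp 0 =
      if Cost.enc (PowerSeries.coeff I.k
        (sumOver (ownWeight I.attrOf fun c => PowerSeries.C (I.cost c) * PowerSeries.X)
          (constraintFactors I.constraints).value (I.l + 1) fun _ => false)) ≤ 1 - 2 * I.p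
      then 1 else 0 := by
  have hlen := I.length_encode_ge
  have htok := fun r hr => I.length_tokens_le (r := r) hr
  have hk := I.k_le
  have hreads := reads_start I.encode
  set N := I.encode.length with hN
  set M₀ := start Cell.inp I.encode with hM₀
  have zero : ∀ c, c ≠ .inp → M₀ c = 0 := by
    intro c hc; funext z; simp [hM₀, BoundedLoop.start, hc]
  rw [Instance.encode, List.append_assoc, List.append_assoc, reads_append, reads_append] at hreads
  obtain ⟨⟨hm, hl, hn, hk', hp, -⟩, -, hreads⟩ := hreads
  norm_num at hm hl hn hk' hp hreads
  simp only [program, exec_seq]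
  set M₁ := exec N prepareRows M₀ with hM₁
  have row1 : Rows N M₁ := exec_prepareRows (by rw [zero _ (by simp)]; rfl)
  have f1 : ∀ c, prepareRows.writes c = false → M₁ c = M₀ c := fun c => exec_of_not_writes _ _ _ _
  set M₂ := exec N prepareOwn M₁ with hM₂
  have own2 : Own N I.l M₂ 1 := exec_prepareOwn (by rw [f1 _ rfl, hl]) (by omega) row1
    (by rw [f1 _ rfl, zero _ (by simp)])
  have f2 : ∀ c, prepareOwn.writes c = false → M₂ c = M₁ c := fun c => exec_of_not_writes _ _ _ _
  have inp2 : M₂ .inp = M₀ .inp := by rw [f2 _ rfl, f1 _ rfl]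
  have row2 : Rows N M₂ := row1.congr (f2 _ rfl)
  obtain ⟨own3, hreads3⟩ := exec_readCandidates (N := N) (M₀ := M₂) (I := I)
    (w := I.constraints.flatMap Constraint.encode) hcard (by omega) (by omega)
    (by rw [inp2, hm]) (by rw [inp2, hl]) row2 own2 (by rw [inp2]; exact hreads)
  set M₃ := exec N readCandidates M₂ with hM₃
  have f3 : ∀ c, readCandidates.writes c = false → M₃ c = M₂ c := fun c =>
    exec_of_not_writes _ _ _ _
  have inp3 : M₃ .inp = M₀ .inp := by rw [f3 _ rfl, inp2]
  have row3 : Rows N M₃ := row2.congr (f3 _ rfl)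
  have hold4 := exec_readConstraints (N := N) (M₀ := M₃) I.constraints htok (by omega)
    (by rw [inp3, hn]) (by omega) row3 (by rw [inp3, ← inp2]; exact hreads3) (by
      intro c hc
      simp only [List.mem_cons, List.not_mem_nil, or_false] at hc
      rcases hc with rfl | rfl | rfl | rfl <;> rw [f3 _ rfl, f2 _ rfl, f1 _ rfl, zero _ (by simp)])
  set M₄ := exec N readConstraints M₃ with hM₄
  have f4 : ∀ c, readConstraints.writes c = false → M₄ c = M₃ c := fun c =>
    exec_of_not_writes _ _ _ _
  have row4 : Rows N M₄ := row3.congr (f4 _ rfl)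
  have hlast : (constraintFactors I.constraints).t (N - 1) = 0 := by
    funext x y
    simp [constraintFactors, (by omega : I.constraints.length ≤ N - 1)]
  have hold5 := exec_neutral (by omega) row4 hold4 hlast
  set M₅ := exec N neutral M₄ with hM₅
  set F : Factors (PowerSeries Cost) := { constraintFactors I.constraints with
    t := Function.update (constraintFactors I.constraints).t (N - 1) 1 } with hF
  have hFact : ∀ i ∈ F.act, i < I.constraints.length := fun i hi => Finset.mem_range.1 hi
  have hFvalue : F.value = (constraintFactors I.constraints).value := by
    funext X
    refine Finset.prod_congr rfl fun i hi => ?_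
    have : i ≠ N - 1 := by have := hFact i hi; omega
    simp [Factors.factor, hF, this]
  have f5 : ∀ c ∈ [Cell.row, .own, .inp, .fin], M₅ c = M₃ c := by
    intro c hc
    simp only [List.mem_cons, List.not_mem_nil, or_false] at hc
    rcases hc with rfl | rfl | rfl | rfl <;>
      exact (exec_of_not_writes _ _ _ _ rfl).trans (f4 _ rfl)
  have row5 : Rows N M₅ := row3.congr (f5 _ (by simp))
  obtain ⟨G, hold6, hGact, hGneu, hGvalue⟩ := exec_eliminateAll (N := N) (l := I.l)
    (n := I.constraints.length) (M₀ := M₅)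
    (g := ownWeight I.attrOf fun c => PowerSeries.C (I.cost c) * PowerSeries.X)
    (by omega) row5 (own3.congr (f5 _ (by simp))) hold5
    (by rw [f5 _ (by simp), inp3, hl]) (by rw [f5 _ (by simp), inp3, hn]) (by omega) hFact
    (touching_constraintFactors hocc) (by simp [hF])
    (fun a x j => coeff_ownWeight _ _ a x j)
  set M₆ := exec N eliminateAll M₅ with hM₆
  have f6 : ∀ c, eliminateAll.writes c = false → M₆ c = M₅ c := fun c =>
    exec_of_not_writes _ _ _ _
  have row6 : Rows N M₆ := row5.congr (f6 _ rfl)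
  have fin7 := exec_multiply (N := N) (M₀ := M₆) (by omega) row6 hold6 hGact hGneu
    (by rw [f6 _ rfl, f5 _ (by simp), f3 _ rfl, f2 _ rfl, f1 _ rfl, zero _ (by simp)])
    (by omega : I.k < N)
  set M₇ := exec N multiply M₆ with hM₇
  have f7 : ∀ c, multiply.writes c = false → M₇ c = M₆ c := fun c =>
    exec_of_not_writes _ _ _ _
  have inp7 : M₇ .inp = M₀ .inp := by rw [f7 _ rfl, f6 _ rfl, f5 _ (by simp), inp3]
  rw [hGvalue, hFvalue] at fin7
  rw [answer, exec_store, eval_le, eval_load, eval_adr_zero (row6.congr (f7 _ rfl)) (i' := N)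
    (j' := I.k) (by simp) le_rfl (by simp [inp7, hk']), fin7]
  simp only [Mem.write, eval_zero, and_self, if_true, eval_sub, eval_load, eval_one,
    inp7, two_mul, sub_sub]
  rfl

open Classical in
theorem hasCommittee_iff {I : Instance} (hcard : ∀ c, (I.attributes c).card ≤ 1)
    (hcs : ∀ r ∈ I.constraints, r.attrs.card ≤ 2) :
    Cost.enc (PowerSeries.coeff I.k
        (sumOver (ownWeight I.attrOf fun c => PowerSeries.C (I.cost c) * PowerSeries.X)
          (constraintFactors I.constraints).value (I.l + 1) fun _ => false)) ≤ 1 - 2 * I.p ↔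
      I.HasCommittee := by
  have e : (constraintFactors I.constraints).value = fun X => if ∀ r ∈ I.constraints,
      r.Holds fun a : Fin I.l => X a = true then 1 else 0 := by
    funext X
    rw [value_constraintFactors hcs]
  have hp : (0 : ℤ) < I.p := by exact_mod_cast I.p_pos
  rw [e]
  refine (enc_coeff_sumOver_le I.attrOf I.profit I.attrOf_lt (fun X => ∀ r ∈ I.constraints,
      r.Holds fun a : Fin I.l => X a = true) _ _ hp).trans ?_
  simp only [Instance.override_attrOf hcard]
  rfl

end CECAC

theorem theorem10 :
    RAM.SolvableInPolyTime CECAC.Instance.encode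
      (fun I : CECAC.Instance =>
        (∀ c : Fin I.m, (I.attributes c).card ≤ 1) ∧
        (∀ a : Fin I.l, I.occ a ≤ 2) ∧
        (∀ r ∈ I.constraints, r.attrs.card ≤ 2))
      (fun I : CECAC.Instance => I.HasCommittee) := by
  refine BoundedLoop.solvableInPolyTime (inp := CECAC.Cell.inp) CECAC.Cell.ctorIdx_injective rfl
    CECAC.program ?_
  rintro I ⟨hcard, hocc, hcs⟩
  have h := CECAC.hasCommittee_iff hcard hcs
  rw [CECAC.exec_program hcard hocc]
  exact ⟨fun hI => if_pos (h.2 hI), fun hI => if_neg fun hle => hI (h.1 hle)⟩
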